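/- Let $\Omega\subset\mathbb{R}^3$ be a bounded Lipschitz polyhedron with connected boundary and let $\Gamma\subseteq\partial\Omega$ be a nonempty, relatively open, connected subset; if $\Gamma\neq\partial\Omega$, the relative boundary of $\Gamma$ in $\partial\Omega$ is Lipschitz, i.e. near each of its points $\Gamma$ is a Lipschitz hypograph in graph coordinates of $\partial\Omega$. Let $\widehat S=[-1,1]^2$, let $\ell_n$ be the Legendre polynomials, $L_j(x)=\int_{-1}^x\ell_{j-1}(t)\,dt$, and let $\varphi_0(x)=\tfrac12(1-x)$, $\varphi_1(x)=\tfrac12(1+x)$, $\varphi_j=L_j/\|\ell_{j-1}\|_{L^2(-1,1)}$ for $j\ge 2$. The products $\varphi_i\otimes\varphi_j$, $0\le i,j\le p$, form the Babuška–Szabó basis of the space $\mathcal{Q}^p(\widehat S)$ of polynomials of degree at most $p$ in each variable. A conforming affine quadrilateral mesh $\mathcal{T}$ of $\Gamma$ is a finite family of sets $K=F_K(\widehat S)$ with injective affine maps $F_K:\mathbb{R}^2\to\mathbb{R}^3$ such that $\bigcup_{K} K=\overline\Gamma$ and any two different elements are disjoint or share exactly one common vertex or exactly one common edge. Its size is $h=\max_K\operatorname{diam}K$;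 it is $\gamma$-shape regular if $\operatorname{diam}(K)^2\le\gamma|K|$ for all $K$, and quasi-uniform with constant $\kappa$ if $h\le\kappa\operatorname{diam}K$ for all $K$. For $p\ge1$ let $$\widetilde{\mathcal{Q}}^p(\mathcal{T})=\{u\in\widetilde H^{1/2}(\Gamma): u|_K\circ F_K\in\mathcal{Q}^p(\widehat S)\ \ \forall K\in\mathcal{T}\},\qquad \widetilde H^{1/2}(\Gamma)=[L^2(\Gamma),\widetilde H^1(\Gamma)]_{1/2}$$ (real interpolation by the $K$-functional with exponent $2$; $\widetilde H^1(\Gamma)$ consists of the functions on $\Gamma$ whose extension by zero lies in $H^1(\partial\Omega)$). The global Babuška–Szabó basis of this space consists of the functions obtained by mapping the $\varphi_i\otimes\varphi_j$ to the elements and identifying them at shared vertices and edges (the edge functions of degree $j$ with the sign $(-1)^j$ if the local edge is oriented against an arbitrarily fixed orientation of the mesh edges); the vertex and edge functions of vertices and edges on the boundary of $\Gamma$ are omitted. Then for all $\gamma,\kappa$ there are constants $c_0,c_1,C_0,C_1>0$, depending only on $\Omega$, $\Gamma$, $\gamma$ and $\kappa$, such that for every conforming affine quadrilateral mesh $\mathcal{T}$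 of $\Gamma$ that is $\gamma$-shape regular and quasi-uniform with constant $\kappa$, every orientation of the mesh edges, every $p\ge1$, and every $u\in\widetilde{\mathcal{Q}}^p(\mathcal{T})$ with coefficient vector $\mathfrak{u}$ with respect to the global Babuška–Szabó basis, $$c_0h^{-2}\|u\|_{L^2(\Gamma)}^2\le\|\mathfrak{u}\|_{\ell^2}^2\le C_0h^{-2}p^8\|u\|_{L^2(\Gamma)}^2,\qquad c_1\|u\|_{H^1(\Gamma)}^2\le\|\mathfrak{u}\|_{\ell^2}^2\le C_1\,(p^4+h^{-2})\|u\|_{H^1(\Gamma)}^2 .$$ -/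

import Mathlib

open MeasureTheory Set
open scoped ENNReal NNReal ContDiff RealInnerProductSpace

noncomputable section

namespace QuadBEM

/-- Euclidean three-space. -/
abbrev E3 : Type := EuclideanSpace ℝ (Fin 3)

/-! ### The geometry: Lipschitz polyhedra and boundary pieces -/

/-- In the rigid coordinates `ρ` the set `Ω` is, inside `U`, the hypograph of `ζ`. -/
def IsHypographIn (Ω U : Set E3) (ρ : E3 ≃ᵃⁱ[ℝ] E3) (ζ : ℝ × ℝ → ℝ) : Prop :=
  (∃ L : ℝ≥0, LipschitzWith L ζ) ∧ ∀ y ∈ U, (y ∈ Ω ↔ ρ y 2 < ζ (ρ y 0, ρ y 1))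

/-- `Ω ⊆ ℝ³` is a bounded Lipschitz polyhedron with connected boundary: bounded, open, locally a
Lipschitz hypograph, with boundary contained in finitely many planes `{x | ⟪n, x⟫ = b}`. -/
structure IsLipschitzPolyhedron (Ω : Set E3) : Prop where
  isOpen : IsOpen Ω
  isBounded : Bornology.IsBounded Ω
  isConnected_frontier : IsConnected (frontier Ω)
  isLipschitz : ∀ x ∈ frontier Ω, ∃ U ∈ nhds x, ∃ ρ ζ, IsHypographIn Ω U ρ ζ
  isPolyhedral : ∃ P : Set (E3 × ℝ), P.Finite ∧ (∀ q ∈ P, q.1 ≠ 0) ∧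
    ∀ x ∈ frontier Ω, ∃ q ∈ P, ⟪q.1, x⟫ = q.2

/-- `Γ` is a nonempty, relatively open, connected part of `∂Ω`, and near each of its relative
boundary points it is a Lipschitz hypograph in graph coordinates of `∂Ω`. There are no relative
boundary points if `Γ = ∂Ω`. -/
structure IsLipschitzPiece (Ω Γ : Set E3) : Prop where
  isRelOpen : ∃ O : Set E3, IsOpen O ∧ Γ = O ∩ frontier Ω
  isConnected : IsConnected Γ
  isLipschitz : ∀ x ∈ closure Γ \ Γ, ∃ U ∈ nhds x, ∃ ρ ζ, IsHypographIn Ω U ρ ζ ∧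
    ∃ η : ℝ → ℝ, (∃ L : ℝ≥0, LipschitzWith L η) ∧
      ∀ y ∈ U ∩ frontier Ω, (y ∈ Γ ↔ ρ y 0 < η (ρ y 1))

/-! ### Sobolev spaces on boundary pieces, with respect to surface measure `μHE[2]` -/

/-- `ν` is the outer unit normal of `Ω` at `x`: near `x`, `Ω` is the half-space
`{y | ⟪ν, y - x⟫ < 0}`. -/
def IsOuterNormal (Ω : Set E3) (x ν : E3) : Prop :=
  ‖ν‖ = 1 ∧ ∃ ε > 0, ∀ y ∈ Metric.ball x ε, (y ∈ Ω ↔ ⟪ν, y - x⟫ < 0)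

open Classical in
/-- The outer unit normal of a polyhedron, which exists at almost every boundary point; zero where
it does not exist. -/
def outerNormal (Ω : Set E3) (x : E3) : E3 :=
  if h : ∃ ν, IsOuterNormal Ω x ν then h.choose else 0

/-- The tangential derivative `(n_j ∂_k - n_k ∂_j) φ` of an ambient function `φ`. -/
def tangDeriv (Ω : Set E3) (φ : E3 → ℝ) (j k : Fin 3) (x : E3) : ℝ :=
  outerNormal Ω x j * fderiv ℝ φ x (EuclideanSpace.single k 1)
    - outerNormal Ω x k * fderiv ℝ φ x (EuclideanSpace.single j 1)

/-- `u ∈ H¹(A)` with weak surface gradient `∇_Γ u = g`, for a relatively open `A ⊆ ∂Ω`: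
`u, g ∈ L²(A)`, `g` is tangential, and `∫_A u (n × ∇φ) = - ∫_A φ (n × g)` for all smooth compactly
supported `φ` whose support does not meet `∂Ω \ A`. -/
structure HasSurfGrad (Ω A : Set E3) (u : E3 → ℝ) (g : E3 → E3) : Prop where
  memLp : MemLp u 2 (μHE[2].restrict A)
  memLp_grad : MemLp g 2 (μHE[2].restrict A)
  tangential : ∀ᵐ x ∂(μHE[2].restrict A : Measure E3), ⟪g x, outerNormal Ω x⟫ = 0
  weak : ∀ φ : E3 → ℝ, ContDiff ℝ ∞ φ → HasCompactSupport φ →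
    Disjoint (tsupport φ) (frontier Ω \ A) → ∀ j k : Fin 3,
      ∫ x in A, u x * tangDeriv Ω φ j k x ∂μHE[2]
        = -∫ x in A, φ x * (outerNormal Ω x j * g x k - outerNormal Ω x k * g x j) ∂μHE[2]

/-- `‖f‖²_{L²(A)}`. -/
def l2NormSq {E : Type*} [NormedAddCommGroup E] (A : Set E3) (f : E3 → E) : ℝ≥0∞ :=
  ∫⁻ x in A, ‖f x‖ₑ ^ 2 ∂μHE[2]

/-- `‖u‖²_{H¹(A)} = ‖u‖²_{L²(A)} + ‖∇_Γ u‖²_{L²(A)}`, which is `∞` if `u ∉ H¹(A)`. -/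
def h1NormSq (Ω A : Set E3) (u : E3 → ℝ) : ℝ≥0∞ :=
  ⨅ (g : E3 → E3) (_ : HasSurfGrad Ω A u g), l2NormSq A u + l2NormSq A g

open Classical in
/-- `‖u‖²` in `H̃¹(A)`, the space of functions on `A` whose extension by zero lies in `H¹(∂Ω)`:
`‖∇_Γ u‖²_{L²(A)}` if `∂Ω \ A` has positive measure, the full `H¹`-norm otherwise; the value is `∞`
if `u` is not in the space. -/
def tildeH1NormSq (Ω A : Set E3) (u : E3 → ℝ) : ℝ≥0∞ :=
  ⨅ (g : E3 → E3) (_ : HasSurfGrad Ω (frontier Ω) (A.indicator u) g),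
    if μHE[2] (frontier Ω \ A) = 0 then l2NormSq A u + l2NormSq A g else l2NormSq A g

/-- The functional `K(t, u) = inf_v ‖u - v‖_{L²(A)} + t ‖v‖_{H̃¹(A)}`. -/
def kFunctional (Ω A : Set E3) (t : ℝ) (u : E3 → ℝ) : ℝ≥0∞ :=
  ⨅ (v : E3 → ℝ) (_ : tildeH1NormSq Ω A v < ⊤),
    l2NormSq A (u - v) ^ (1 / 2 : ℝ) + ENNReal.ofReal t * tildeH1NormSq Ω A v ^ (1 / 2 : ℝ)

/-- The squared interpolation norm of `[L²(A), H̃¹(A)]_s`. -/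
def tildeHsNormSq (Ω A : Set E3) (s : ℝ) (u : E3 → ℝ) : ℝ≥0∞ :=
  ∫⁻ t in Ioi (0 : ℝ), ENNReal.ofReal (t ^ (-2 * s)) * kFunctional Ω A t u ^ 2 / ENNReal.ofReal t

/-- `u ∈ H̃^{1/2}(A)`. -/
def MemTildeHHalf (Ω A : Set E3) (u : E3 → ℝ) : Prop :=
  MemLp u 2 (μHE[2].restrict A) ∧ tildeHsNormSq Ω A (1 / 2) u < ⊤

/-! ### The Babuška–Szabó basis on the reference square -/

/-- Legendre polynomials on `[-1, 1]` (Rodrigues' formula). -/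
def legendre (n : ℕ) : Polynomial ℝ :=
  Polynomial.C (1 / (2 ^ n * (n.factorial : ℝ))) *
    Polynomial.derivative^[n] ((Polynomial.X ^ 2 - 1) ^ n)

/-- The integrated Legendre polynomial `L_n`, for `n ≥ 1`. -/
def intLegendre (n : ℕ) (x : ℝ) : ℝ := ∫ t in (-1 : ℝ)..x, (legendre (n - 1)).eval t

/-- The one-dimensional shape functions `φ_j`. -/
def shape1D : ℕ → ℝ → ℝ
  | 0 => fun x => (1 - x) / 2
  | 1 => fun x => (1 + x) / 2
  | j + 2 => fun x =>
      intLegendre (j + 2) x / Real.sqrt (∫ t in (-1 : ℝ)..1, (legendre (j + 1)).eval t ^ 2)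

/-- The reference square `[-1, 1]²`. -/
def refSquare : Set (ℝ × ℝ) := Icc (-1) 1 ×ˢ Icc (-1) 1

/-- The tensor product shape function `φ_i ⊗ φ_j`. -/
def shape2D (i j : ℕ) (x : ℝ × ℝ) : ℝ := shape1D i x.1 * shape1D j x.2

/-- `f` agrees a.e. on the reference square with a polynomial of degree at most `p` in each
variable. -/
def MemQ (p : ℕ) (f : ℝ × ℝ → ℝ) : Prop :=
  ∃ q : MvPolynomial (Fin 2) ℝ, (∀ i, q.degreeOf i ≤ p) ∧
    ∀ᵐ x ∂(volume.restrict refSquare), f x = MvPolynomial.eval ![x.1, x.2] q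

/-- The points `-1` and `1`, indexed such that `shape1D a` is `1` at `endpt a`, `a = 0, 1`. -/
def endpt (a : Fin 2) : ℝ := if a = 0 then -1 else 1

/-- The vertices of the reference square. -/
def refVertex (a : Fin 2 × Fin 2) : ℝ × ℝ := (endpt a.1, endpt a.2)

/-- The edges of the reference square, parametrized over `[-1, 1]`: `d` is the coordinate that
varies along the edge and `b` is the side on which the other one is fixed. -/
def refEdge (d b : Fin 2) (s : ℝ) : ℝ × ℝ := if d = 0 then (s, endpt b) else (endpt b, s)

/-- The shape function of degree `j ≥ 2` belonging to the edge `refEdge d b`. -/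
def edgeShape (d b : Fin 2) (j : ℕ) : ℝ × ℝ → ℝ := if d = 0 then shape2D j b else shape2D b j

/-! ### Meshes of affine quadrilaterals -/

/-- A regular (conforming) mesh of `Γ` consisting of finitely many nondegenerate affine
quadrilaterals `K = F K '' [-1, 1]²`. Two different elements are disjoint or share exactly one
vertex or exactly one edge. -/
structure QuadMesh (Γ : Set E3) where
  N : ℕ
  F : Fin N → (ℝ × ℝ →ᵃ[ℝ] E3)
  injective : ∀ K, Function.Injective (F K)
  cover : ⋃ K, F K '' refSquare = closure Γ
  conforming : ∀ K K', K ≠ K' →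
    F K '' refSquare ∩ F K' '' refSquare = ∅ ∨
    (∃ a a', F K (refVertex a) = F K' (refVertex a') ∧
      F K '' refSquare ∩ F K' '' refSquare = {F K (refVertex a)}) ∨
    (∃ d b d' b', F K '' (refEdge d b '' Icc (-1) 1) = F K' '' (refEdge d' b' '' Icc (-1) 1) ∧
      F K '' refSquare ∩ F K' '' refSquare = F K '' (refEdge d b '' Icc (-1) 1))

namespace QuadMesh

variable {Γ : Set E3} (T : QuadMesh Γ)

/-- The element with index `K`. -/
def elem (K : Fin T.N) : Set E3 := T.F K '' refSquare

/-- The mesh size, i.e. the largest element diameter. -/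
def size : ℝ := ⨆ K, Metric.diam (T.elem K)

/-- `γ`-shape regularity: `diam(K)² / |K| ≤ γ` for all elements. -/
def IsShapeRegular (γ : ℝ) : Prop :=
  ∀ K, Metric.diam (T.elem K) ^ 2 / (μHE[2] (T.elem K)).toReal ≤ γ

/-- Quasi-uniformity with constant `κ`: all element diameters are comparable to the mesh size. -/
def IsQuasiUniform (κ : ℝ) : Prop := ∀ K, T.size ≤ κ * Metric.diam (T.elem K)

/-- The space `Q̃^p(T)` of functions in `H̃^{1/2}(Γ)` that are elementwise mapped tensor product
polynomials of degree `p`. -/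
def MemTildeQ (Ω : Set E3) (p : ℕ) (u : E3 → ℝ) : Prop :=
  MemTildeHHalf Ω Γ u ∧ ∀ K, MemQ p (u ∘ T.F K)

/-- The edge `refEdge d b` of the element `K`. -/
def edge (K : Fin T.N) (d b : Fin 2) : Set E3 := T.F K '' (refEdge d b '' Icc (-1) 1)

open Classical in
/-- The mesh vertices that are not on the boundary of `Γ`. -/
def vertices : Finset E3 :=
  (Finset.univ.image fun q : Fin T.N × Fin 2 × Fin 2 => T.F q.1 (refVertex q.2)).filter (· ∈ Γ)

open Classical in
/-- The mesh edges that are not on the boundary of `Γ`. -/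
def edges : Finset (Set E3) :=
  (Finset.univ.image fun q : Fin T.N × Fin 2 × Fin 2 => T.edge q.1 q.2.1 q.2.2).filter
    fun e => ¬ e ⊆ closure Γ \ Γ

/-- The global degrees of freedom for degree `p`: one for each vertex off the boundary of `Γ`,
`p - 1` for each edge off the boundary of `Γ`, and `(p - 1)²` for each element. The index `j` in
`Fin (p - 1)` belongs to the one-dimensional shape function of degree `j + 2`. -/
abbrev Dof (p : ℕ) : Type :=
  T.vertices ⊕ (T.edges × Fin (p - 1)) ⊕ (Fin T.N × Fin (p - 1) × Fin (p - 1))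

/-- An orientation of the mesh edges, given by the choice of a starting point for each of them. -/
structure Orientation where
  start : Set E3 → E3
  start_mem : ∀ K d b, start (T.edge K d b) = T.F K (refEdge d b (-1)) ∨
    start (T.edge K d b) = T.F K (refEdge d b 1)

variable {T}

open Classical in
/-- The pull-back under `F K` of the global basis function belonging to a degree of freedom. It is
a shape function, with the sign `(-1)^j` for an edge function of degree `j` whose
reference edge is oriented against the global orientation, or zero. -/
def localShape (o : T.Orientation) {p : ℕ} (K : Fin T.N) : T.Dof p → ℝ × ℝ → ℝ
  | .inl z => fun x =>
      ∑ a : Fin 2 × Fin 2, if T.F K (refVertex a) = z then shape2D a.1 a.2 x else 0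
  | .inr (.inl (e, j)) => fun x =>
      ∑ q : Fin 2 × Fin 2, if T.edge K q.1 q.2 = e then
        (if o.start e = T.F K (refEdge q.1 q.2 (-1)) then 1 else (-1) ^ (j.val + 2)) *
          edgeShape q.1 q.2 (j.val + 2) x
        else 0
  | .inr (.inr (K', i, j)) => fun x =>
      if K' = K then shape2D (i.val + 2) (j.val + 2) x else 0

open Classical in
/-- The global basis functions. On a point of several elements one of them is chosen; the pull-backs
match on common vertices and edges, so that the choice does not matter. -/
def basisFun (o : T.Orientation) {p : ℕ} (δ : T.Dof p) (x : E3) : ℝ :=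
  if h : ∃ K, x ∈ T.elem K then
    localShape o h.choose δ (Function.invFun (T.F h.choose) x)
  else 0

/-- `c` is the coefficient vector of `u`, i.e. `u = ∑ c_δ Φ_δ` as functions in `L²(Γ)`. -/
def IsCoeffVector (o : T.Orientation) {p : ℕ} (u : E3 → ℝ) (c : T.Dof p → ℝ) : Prop :=
  ∀ᵐ x ∂(μHE[2].restrict Γ : Measure E3), u x = ∑ δ, c δ * basisFun o δ x

end QuadMesh

end QuadBEM

end

open QuadBEM

/-!
The elements of the mesh are affine images of the reference square `S = [-1, 1]²`, and on each of
them a function of the discrete space is a combination `∑ c_kl φ_k ⊗ φ_l` of tensor products of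
one-dimensional shape functions. The global estimates therefore follow from estimates on `S`, a
scaling argument, and a count of how often a global coefficient occurs as a local one.

*Reference square.* The derivatives of the shape functions of degree at least two are orthonormal
and the two nodal coefficients are the end point values, so that in one dimension `∑ d_k²` is
equivalent to the squared `H¹(-1, 1)`-norm, uniformly in the degree
(`sum_sq_le_polyInner_shapeComb`, `polyInner_shapeComb_le`, `polyInner_derivative_shapeComb_le`).
Tensorization makes `∑ c_kl²` equivalent to the squared norm of `H¹ ⊗ H¹`, which involves the mixed
second derivative. Markov's inequality in `L²(-1, 1)`, `‖q'‖² ≤ 3 p⁴ ‖q‖²`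
(`polyInner_derivative_self_le`), removes the mixed derivative at the expense of `p⁴`, and all
derivatives at the expense of `p⁸` (`coeffSq_le_h1`, `coeffSq_le_l2`). The opposite bounds
`sqInt_biComb_le` etc. do not depend on `p`.

*Scaling.* For a shape regular, quasi-uniform mesh the area density of each parametrization is
comparable to `h²`, and the `L²`-norm of the gradient is invariant under scaling
(`norm_tangVec_sq_mul_jac_le`, `sq_add_sq_le_jac_mul`). As `h` is at most the diameter of `∂Ω`, the
`L²`-part of the `H¹`-norm does not need a power of `h` in the third estimate.

*Counting.* Each global degree of freedom that is nonzero on an element is, up to sign, exactly one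
of its local coefficients, which yields `∑ c_δ² ≤ ∑_K ∑ c_kl² ≤ 4 M ∑ c_δ²`, where `M` bounds the
number of elements that meet at a point (`sum_sq_le_sum_coeffSq`, `sum_coeffSq_le`). Such a bound
holds because the elements at a point have area comparable to `h²` and lie in the part of the
finitely many planes containing `∂Ω` that is in a ball of radius `h` (`exists_card_elem_le`).

*The `H¹`-norm.* It is defined by the weak surface gradient, and has to be identified with the
norm of the elementwise gradient, i.e. the elementwise gradient of a function of the discrete space
has to be its weak gradient (`hasSurfGrad_surfGrad`), and the weak gradient has to be unique
(`ae_eq_of_hasSurfGrad`). The global basis functions are continuous (`localShape_eq_of_apply_eq`).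
After the product rule, integration by parts reads `∑_K ± ∫_S d(φu) ∧ d⟪F_K, v⟫ = 0`, with the signs
given by the outer normal (`sum_setIntegral_wedge`). A partition of unity reduces this to the case
that the test function `φ` is supported where `∂Ω` is the graph of a Lipschitz function. In graph
coordinates the signs disappear and the sum becomes `∫ dW ∧ df` over the plane, for Lipschitz
functions `W` and `f` with `W` compactly supported. This is zero by integration by parts for
Lipschitz functions (`integral_lineDeriv_mul_lineDeriv_comm`). No boundary terms appear because `φ`
vanishes on `∂Ω \ Γ`.
-/

noncomputable section

namespace QuadBEM

/-! ### Legendre polynomials and Markov's inequality in `L²(-1, 1)` -/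

section Legendre

open Polynomial

/-- The `L²(-1, 1)` inner product of two polynomials. -/
def polyInner (f g : ℝ[X]) : ℝ := ∫ x in (-1 : ℝ)..1, f.eval x * g.eval x

lemma polyInner_comm (f g : ℝ[X]) : polyInner f g = polyInner g f := by
  simp only [polyInner, mul_comm]

lemma polyInner_add_left (f g h : ℝ[X]) :
    polyInner (f + g) h = polyInner f h + polyInner g h := by
  simp only [polyInner, eval_add, add_mul]
  exact intervalIntegral.integral_add (by apply Continuous.intervalIntegrable; fun_prop)
    (by apply Continuous.intervalIntegrable; fun_prop)

lemma polyInner_C_mul_left (a : ℝ) (f g : ℝ[X]) :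
    polyInner (C a * f) g = a * polyInner f g := by
  simp only [polyInner, eval_mul, eval_C, mul_assoc]
  exact intervalIntegral.integral_const_mul _ _

lemma polyInner_add_right (f g h : ℝ[X]) :
    polyInner f (g + h) = polyInner f g + polyInner f h := by
  rw [polyInner_comm, polyInner_add_left, polyInner_comm g, polyInner_comm h]

lemma polyInner_C_mul_right (a : ℝ) (f g : ℝ[X]) :
    polyInner f (C a * g) = a * polyInner f g := by
  rw [polyInner_comm, polyInner_C_mul_left, polyInner_comm g]

lemma polyInner_self_nonneg (f : ℝ[X]) : 0 ≤ polyInner f f :=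
  intervalIntegral.integral_nonneg (by norm_num) fun _ _ => mul_self_nonneg _

lemma polyInner_sq_le (f g : ℝ[X]) :
    polyInner f g ^ 2 ≤ polyInner f f * polyInner g g := by
  have h : ∀ t : ℝ, 0 ≤ polyInner f f * (t * t) + (2 * polyInner f g) * t + polyInner g g := by
    intro t
    have := polyInner_self_nonneg (C t * f + g)
    simp only [polyInner_add_left, polyInner_add_right, polyInner_C_mul_left,
      polyInner_C_mul_right, polyInner_comm g f] at this
    linarith
  have := discrim_le_zero h
  rw [discrim] at this
  linarith

lemma integral_derivative_eval (f : ℝ[X]) (a b : ℝ) :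
    ∫ x in a..b, (derivative f).eval x = f.eval b - f.eval a :=
  intervalIntegral.integral_eq_sub_of_hasDerivAt (fun x _ => f.hasDerivAt x)
    (by apply Continuous.intervalIntegrable; fun_prop)

lemma polyInner_derivative_left (f g : ℝ[X]) :
    polyInner (derivative f) g =
      f.eval 1 * g.eval 1 - f.eval (-1) * g.eval (-1) - polyInner f (derivative g) := by
  have h := integral_derivative_eval (f * g) (-1) 1
  simp only [derivative_mul, eval_add, eval_mul] at h
  rw [intervalIntegral.integral_add (by apply Continuous.intervalIntegrable; fun_prop)
    (by apply Continuous.intervalIntegrable; fun_prop)] at h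
  simp only [polyInner]
  linarith

lemma eval_iterate_derivative_rodrigues {n k : ℕ} (hk : k < n) {x : ℝ} (hx : x ^ 2 = 1) :
    (derivative^[k] ((X ^ 2 - 1 : ℝ[X]) ^ n)).eval x = 0 := by
  obtain ⟨q, hq⟩ := pow_sub_dvd_iterate_derivative_pow (X ^ 2 - 1 : ℝ[X]) n k
  rw [hq]
  have : n - k ≠ 0 := by omega
  simp [hx, this]

lemma polyInner_iterate_derivative_rodrigues (n : ℕ) : ∀ (k m : ℕ) (q : ℝ[X]), k ≤ m → m ≤ n →
    derivative^[k] q = 0 → polyInner (derivative^[m] ((X ^ 2 - 1) ^ n)) q = 0 := by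
  intro k
  induction k with
  | zero =>
    intro m q _ _ hq
    simp only [Function.iterate_zero, id_eq] at hq
    simp [polyInner, hq]
  | succ k ih =>
    intro m q hkm hmn hq
    obtain ⟨m, rfl⟩ : ∃ m', m = m' + 1 := ⟨m - 1, by omega⟩
    rw [Function.iterate_succ_apply', polyInner_derivative_left,
      eval_iterate_derivative_rodrigues (by omega) (by norm_num),
      eval_iterate_derivative_rodrigues (by omega) (by norm_num),
      ih m (derivative q) (by omega) (by omega) (by rwa [← Function.iterate_succ_apply])]
    simp

/-- `ℓ_n` is orthogonal to all polynomials of smaller degree. -/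
lemma polyInner_legendre_of_natDegree_lt {n : ℕ} {q : ℝ[X]} (hq : q.natDegree < n) :
    polyInner (legendre n) q = 0 := by
  rw [legendre, polyInner_C_mul_left,
    polyInner_iterate_derivative_rodrigues n n n q le_rfl le_rfl
      (iterate_derivative_eq_zero hq), mul_zero]

lemma natDegree_rodrigues (n : ℕ) : ((X ^ 2 - 1 : ℝ[X]) ^ n).natDegree = 2 * n := by
  rw [natDegree_pow]
  have : (X ^ 2 - 1 : ℝ[X]).natDegree = 2 := by compute_degree!
  rw [this, mul_comm]

lemma natDegree_legendre (n : ℕ) : (legendre n).natDegree = n := by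
  rw [legendre, natDegree_C_mul (by positivity)]
  refine le_antisymm ((natDegree_iterate_derivative _ _).trans ?_) (le_natDegree_of_ne_zero ?_)
  · rw [natDegree_rodrigues]; omega
  · have hm : (X ^ 2 - 1 : ℝ[X]).Monic := by monicity!
    have hc := (hm.pow n).coeff_natDegree
    rw [natDegree_rodrigues, two_mul] at hc
    rw [coeff_iterate_derivative, hc, nsmul_one, Nat.cast_ne_zero]
    exact (Nat.descFactorial_pos.mpr (by omega)).ne'

lemma legendre_ne_zero (n : ℕ) : legendre n ≠ 0 := by
  intro h
  have h1 := natDegree_legendre n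
  rcases n with _ | n
  · simp [legendre] at h
  · rw [h] at h1; simp at h1

lemma legendre_coeff_ne_zero (n : ℕ) : (legendre n).coeff n ≠ 0 := by
  conv => enter [1, 2]; rw [← natDegree_legendre n]
  exact leadingCoeff_ne_zero.mpr (legendre_ne_zero n)

/-- The derivatives of `(X² - 1)^n` at `1`, read off from `(X² - 1)^n = (X - 1)^n (X - 1 + 2)^n`. -/
lemma eval_one_iterate_derivative_rodrigues (n k : ℕ) :
    (derivative^[n + k] ((X ^ 2 - 1 : ℝ[X]) ^ n)).eval 1 =
      (n + k).factorial * ((X + C 2 : ℝ[X]) ^ n).coeff k := by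
  have h1 : derivative^[n + k] ((X ^ 2 - 1 : ℝ[X]) ^ n) =
      ((n + k).factorial : ℝ[X]) * hasseDeriv (n + k) ((X ^ 2 - 1 : ℝ[X]) ^ n) := by
    rw [← nsmul_eq_mul]
    exact (congrFun (factorial_smul_hasseDeriv (R := ℝ) (n + k)) _).symm
  have h2 : taylor 1 ((X ^ 2 - 1 : ℝ[X]) ^ n) = X ^ n * (X + C 2) ^ n := by
    rw [taylor_pow, ← mul_pow]
    congr 1
    simp only [map_sub, taylor_pow, taylor_X, taylor_one]
    have : (C 2 : ℝ[X]) = 2 := rfl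
    rw [this]; simp only [map_one]; ring
  rw [h1, eval_mul, eval_natCast, ← taylor_coeff, h2, add_comm n k, coeff_X_pow_mul]

lemma legendre_eval_one (n : ℕ) : (legendre n).eval 1 = 1 := by
  have := eval_one_iterate_derivative_rodrigues n 0
  rw [add_zero, coeff_zero_eq_eval_zero] at this
  rw [legendre, eval_mul, eval_C, this]
  have : (n.factorial : ℝ) ≠ 0 := by positivity
  simp
  field_simp

lemma derivative_legendre_eval_one (n : ℕ) :
    (derivative (legendre n)).eval 1 = n * (n + 1) / 2 := by
  have := eval_one_iterate_derivative_rodrigues n 1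
  rw [Function.iterate_succ_apply'] at this
  rw [legendre, derivative_C_mul, eval_mul, eval_C, this, coeff_X_add_C_pow]
  have : (n.factorial : ℝ) ≠ 0 := by positivity
  rcases n with _ | n
  · simp
  · simp [Nat.factorial_succ (n + 1)]
    field_simp
    ring

lemma iterate_derivative_rodrigues_comp_neg (n k : ℕ) :
    (derivative^[k] ((X ^ 2 - 1 : ℝ[X]) ^ n)).comp (-X) =
      (-1) ^ k * derivative^[k] ((X ^ 2 - 1 : ℝ[X]) ^ n) := by
  induction k with
  | zero => simp
  | succ k ih =>
    rw [Function.iterate_succ_apply']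
    have h := congrArg derivative ih
    rw [derivative_comp, show ((-1 : ℝ[X]) ^ k) = C ((-1) ^ k) by simp, derivative_C_mul] at h
    simp only [derivative_neg, derivative_X] at h
    rw [show ((-1 : ℝ[X]) ^ (k + 1)) = -C ((-1) ^ k) by simp [pow_succ], neg_mul, ← h]
    ring

lemma legendre_eval_neg (n : ℕ) (x : ℝ) :
    (legendre n).eval (-x) = (-1) ^ n * (legendre n).eval x := by
  have h := congrArg (eval x) (iterate_derivative_rodrigues_comp_neg n n)
  simp only [eval_comp, eval_neg, eval_X, eval_mul, eval_pow, eval_one] at h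
  rw [legendre, eval_mul, eval_mul, h]
  simp only [eval_C]
  ring

lemma derivative_legendre_eval_neg (n : ℕ) (x : ℝ) :
    (derivative (legendre n)).eval (-x) = (-1) ^ (n + 1) * (derivative (legendre n)).eval x := by
  have h := congrArg (eval x) (iterate_derivative_rodrigues_comp_neg n (n + 1))
  simp only [eval_comp, eval_neg, eval_X, eval_mul, eval_pow, eval_one,
    Function.iterate_succ_apply'] at h
  rw [legendre, derivative_C_mul, eval_mul, eval_mul, h]
  simp only [eval_C]
  ring

/-- `‖ℓ_n‖² = 2 / (2 n + 1)`, from `∫ x (ℓ_n²)' = 2 - ‖ℓ_n‖²` and `x ℓ_n' = n ℓ_n + (lower order)`. -/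
lemma polyInner_legendre_self (n : ℕ) :
    (2 * n + 1) * polyInner (legendre n) (legendre n) = 2 := by
  rcases Nat.eq_zero_or_pos n with rfl | hn
  · simp [polyInner, legendre]; norm_num
  set l := legendre n
  have h1 := polyInner_derivative_left (X * l) l
  have hd : derivative (X * l) = l + X * derivative l := by simp
  have hs : polyInner (X * l) (derivative l) = polyInner l (X * derivative l) := by
    simp only [polyInner, eval_mul, eval_X]
    congr 1; ext x; ring
  have hX : polyInner l (X * derivative l) = n * polyInner l l := by
    have hlow : (X * derivative l - C (n : ℝ) * l).natDegree < n := by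
      refine lt_of_le_of_ne ?_ ?_
      · refine (natDegree_sub_le _ _).trans (max_le ?_ ?_)
        · refine natDegree_mul_le.trans ?_
          have := natDegree_derivative_le l
          have h2 : l.natDegree = n := natDegree_legendre n
          rw [natDegree_X]; omega
        · exact (natDegree_C_mul_le _ _).trans (natDegree_legendre n).le
      · intro h
        have hc : (X * derivative l - C (n : ℝ) * l).coeff n = 0 := by
          obtain ⟨m, rfl⟩ : ∃ m, n = m + 1 := ⟨n - 1, by omega⟩
          rw [coeff_sub, coeff_X_mul, coeff_derivative, coeff_C_mul]
          push_cast; ring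
        have h0 : X * derivative l - C (n : ℝ) * l = 0 := by
          rw [← leadingCoeff_eq_zero, leadingCoeff, h, hc]
        rw [h0] at h; simp at h; omega
    have h3 := polyInner_legendre_of_natDegree_lt hlow
    have : X * derivative l = (X * derivative l - C (n : ℝ) * l) + C (n : ℝ) * l := by ring
    rw [this, polyInner_add_right, h3, polyInner_C_mul_right, zero_add]
  rw [hd, polyInner_add_left, polyInner_comm (X * derivative l), hs, hX] at h1
  have h4 : l.eval (-1) ^ 2 = 1 := by
    rw [legendre_eval_neg, legendre_eval_one, mul_one, ← pow_mul, mul_comm, pow_mul]; simp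
  have h5 : l.eval 1 = 1 := legendre_eval_one n
  simp only [eval_mul, eval_X, h5] at h1
  nlinarith

lemma polyInner_legendre_self_pos (n : ℕ) : 0 < polyInner (legendre n) (legendre n) := by
  have := polyInner_legendre_self n
  by_contra h
  nlinarith [show (0 : ℝ) ≤ n from n.cast_nonneg]

lemma polyInner_derivative_legendre_self (n : ℕ) :
    polyInner (derivative (legendre n)) (derivative (legendre n)) = n * (n + 1) := by
  rcases Nat.eq_zero_or_pos n with rfl | hn
  · simp [polyInner, legendre]
  rw [polyInner_derivative_left]
  have h : polyInner (legendre n) (derivative (derivative (legendre n))) = 0 := by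
    refine polyInner_legendre_of_natDegree_lt ?_
    have h1 := natDegree_derivative_le (legendre n)
    have h2 := natDegree_derivative_le (derivative (legendre n))
    rw [natDegree_legendre] at h1
    omega
  rw [h, legendre_eval_neg, derivative_legendre_eval_neg, legendre_eval_one,
    derivative_legendre_eval_one, pow_succ]
  have : ((-1 : ℝ) ^ n) * (-1) ^ n = 1 := by rw [← mul_pow]; simp
  linear_combination (n * (n + 1) / 2 : ℝ) * this

/-- Markov's inequality in `L²(-1, 1)`, by induction on the degree: the component along `ℓ_{p+1}`
is split off, which is orthogonal to the rest and has `‖ℓ_n'‖² = n (n + 1) (2 n + 1) / 2 ‖ℓ_n‖²`. -/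
lemma polyInner_derivative_self_le (p : ℕ) : ∀ q : ℝ[X], q.natDegree ≤ p →
    polyInner (derivative q) (derivative q) ≤ 3 * (p : ℝ) ^ 4 * polyInner q q := by
  induction p with
  | zero =>
    intro q hq
    rw [eq_C_of_natDegree_le_zero hq]
    simp [polyInner]
  | succ p ih =>
    intro q hq
    set l := legendre (p + 1)
    set a := q.coeff (p + 1) / l.coeff (p + 1)
    set r := q - C a * l
    have hlc : l.coeff (p + 1) ≠ 0 := legendre_coeff_ne_zero _
    have hr : r.natDegree ≤ p := by
      refine natDegree_le_iff_coeff_eq_zero.mpr fun N hN => ?_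
      rcases eq_or_lt_of_le (Nat.succ_le_of_lt hN) with h | h
      · subst h
        simp only [r, coeff_sub, coeff_C_mul, a, Nat.succ_eq_add_one]
        field_simp; ring
      · rw [coeff_sub, coeff_C_mul, coeff_eq_zero_of_natDegree_lt (by omega : q.natDegree < N),
          coeff_eq_zero_of_natDegree_lt (by rw [natDegree_legendre]; omega : l.natDegree < N)]
        simp
    have hq' : q = r + C a * l := by simp [r]
    have h0 : polyInner l r = 0 := polyInner_legendre_of_natDegree_lt (by omega)
    have hN := polyInner_legendre_self (p + 1)
    have hD := polyInner_derivative_legendre_self (p + 1)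
    have hNp := polyInner_legendre_self_pos (p + 1)
    have hI := ih r hr
    have hCS := polyInner_sq_le (derivative r) (derivative l)
    have hR := polyInner_self_nonneg r
    rw [hq']
    simp only [derivative_add, derivative_C_mul, polyInner_add_left, polyInner_add_right,
      polyInner_C_mul_left, polyInner_C_mul_right, polyInner_comm r l, h0,
      polyInner_comm (derivative l) (derivative r)]
    set N := polyInner l l
    set D := polyInner (derivative l) (derivative l)
    set Y := polyInner (derivative r) (derivative l)
    set R := polyInner r r
    set R' := polyInner (derivative r) (derivative r)
    push_cast at hN hD ⊢
    set ρ : ℝ := (p + 1) * (p + 2) * (2 * p + 3) / 2 with hρ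
    have hDN : D = ρ * N := by rw [hD, hρ]; linear_combination (-(p + 1) * (p + 2) / 2 : ℝ) * hN
    have hp0 : (0 : ℝ) ≤ p := p.cast_nonneg
    have hρ0 : 0 ≤ ρ := by positivity
    set B : ℝ := 3 * (p : ℝ) ^ 4 with hB
    have hB0 : 0 ≤ B := by positivity
    have hY : 2 * (a * Y) ≤ ρ * R + B * (a ^ 2 * N) := by
      refine le_trans (le_abs_self _) (abs_le_of_sq_le_sq ?_ (by positivity))
      have h1 : Y ^ 2 ≤ B * R * (ρ * N) := by
        rw [← hDN]; exact hCS.trans (mul_le_mul_of_nonneg_right hI (polyInner_self_nonneg _))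
      have h2 : a ^ 2 * Y ^ 2 ≤ a ^ 2 * (B * R * (ρ * N)) := by gcongr
      nlinarith [sq_nonneg (ρ * R - B * (a ^ 2 * N))]
    have hBB : B + ρ ≤ 3 * ((p : ℝ) + 1) ^ 4 := by
      rw [hB, hρ]; nlinarith [pow_nonneg hp0 2, pow_nonneg hp0 3]
    have hS : 0 ≤ R + a ^ 2 * N := by positivity
    have := mul_le_mul_of_nonneg_right hBB hS
    rw [hDN]
    nlinarith
end Legendre

/-! ### One-dimensional shape functions -/

section Shape

open Polynomial

lemma polyInner_sum_left {ι : Type*} (s : Finset ι) (f : ι → ℝ[X]) (g : ℝ[X]) :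
    polyInner (∑ i ∈ s, f i) g = ∑ i ∈ s, polyInner (f i) g := by
  classical
  induction s using Finset.induction_on with
  | empty => simp [polyInner]
  | insert a s ha ih => rw [Finset.sum_insert ha, Finset.sum_insert ha, polyInner_add_left, ih]

lemma polyInner_sum_right {ι : Type*} (s : Finset ι) (f : ℝ[X]) (g : ι → ℝ[X]) :
    polyInner f (∑ i ∈ s, g i) = ∑ i ∈ s, polyInner f (g i) := by
  simp only [polyInner_comm f, polyInner_sum_left]

/-- The one-dimensional shape functions as polynomials; the integral defining `L_{j+2}` is resolved
by Rodrigues' formula. -/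
def shapePoly : ℕ → ℝ[X]
  | 0 => C (1 / 2) * (1 - X)
  | 1 => C (1 / 2) * (1 + X)
  | j + 2 => C (1 / √(polyInner (legendre (j + 1)) (legendre (j + 1)))) *
      (C (1 / (2 ^ (j + 1) * ((j + 1).factorial : ℝ))) *
        derivative^[j] ((X ^ 2 - 1) ^ (j + 1)))

lemma derivative_shapePoly (j : ℕ) : derivative (shapePoly (j + 2)) =
    C (1 / √(polyInner (legendre (j + 1)) (legendre (j + 1)))) * legendre (j + 1) := by
  rw [shapePoly, derivative_C_mul, derivative_C_mul, legendre, Function.iterate_succ_apply']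

lemma shapePoly_eval_of_sq_eq_one (j : ℕ) {x : ℝ} (hx : x ^ 2 = 1) :
    (shapePoly (j + 2)).eval x = 0 := by
  rw [shapePoly, eval_mul, eval_mul, eval_iterate_derivative_rodrigues (by omega) hx]
  simp

lemma shape1D_eq_eval (j : ℕ) (x : ℝ) : shape1D j x = (shapePoly j).eval x := by
  match j with
  | 0 => simp [shape1D, shapePoly]; ring
  | 1 => simp [shape1D, shapePoly]; ring
  | j + 2 =>
    have h := integral_derivative_eval (shapePoly (j + 2)) (-1) x
    rw [shapePoly_eval_of_sq_eq_one j (x := -1) (by norm_num), derivative_shapePoly] at h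
    simp only [eval_mul, eval_C, intervalIntegral.integral_const_mul, sub_zero] at h
    rw [← h]
    simp only [shape1D, intLegendre, polyInner, pow_two, Nat.reduceSubDiff]
    ring_nf

lemma natDegree_shapePoly_le (j : ℕ) : (shapePoly j).natDegree ≤ max 1 j := by
  match j with
  | 0 => rw [shapePoly]; compute_degree!
  | 1 => rw [shapePoly]; compute_degree!
  | j + 2 =>
    rw [shapePoly]
    refine (natDegree_C_mul_le _ _).trans ((natDegree_C_mul_le _ _).trans
      ((natDegree_iterate_derivative _ _).trans ?_))
    rw [natDegree_rodrigues]
    omega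

lemma shape1D_neg (j : ℕ) (x : ℝ) : shape1D (j + 2) (-x) = (-1) ^ j * shape1D (j + 2) x := by
  have h := congrArg (eval x) (iterate_derivative_rodrigues_comp_neg (j + 1) j)
  simp only [eval_comp, eval_neg, eval_X, eval_mul, eval_pow, eval_one] at h
  simp only [shape1D_eq_eval, shapePoly, eval_mul, eval_C, h]
  ring

lemma endpt_sq (a : Fin 2) : endpt a ^ 2 = 1 := by
  unfold endpt; split_ifs <;> norm_num

lemma shape1D_endpt (j : ℕ) (a : Fin 2) : shape1D (j + 2) (endpt a) = 0 := by
  rw [shape1D_eq_eval, shapePoly_eval_of_sq_eq_one j (endpt_sq a)]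

lemma shape1D_fin_endpt (a b : Fin 2) : shape1D a (endpt b) = if a = b then 1 else 0 := by
  fin_cases a <;> fin_cases b <;> norm_num [shape1D, endpt]

/-- The degree index of a one-dimensional shape function: `inl` are the two nodal functions, `inr`
the functions vanishing at both end points. -/
def shapeIdx {m : ℕ} : Fin 2 ⊕ Fin m → ℕ
  | .inl a => a
  | .inr j => j + 2

lemma natDegree_shapePoly_shapeIdx_le {m : ℕ} (k : Fin 2 ⊕ Fin m) :
    (shapePoly (shapeIdx k)).natDegree ≤ m + 1 := by
  refine (natDegree_shapePoly_le _).trans ?_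
  rcases k with a | j <;> simp only [shapeIdx] <;> omega

/-- The polynomial `∑ d_k φ_k`. -/
def shapeComb {m : ℕ} (d : Fin 2 ⊕ Fin m → ℝ) : ℝ[X] :=
  ∑ k, C (d k) * shapePoly (shapeIdx k)

lemma natDegree_shapeComb_le {m : ℕ} (d : Fin 2 ⊕ Fin m → ℝ) :
    (shapeComb d).natDegree ≤ m + 1 :=
  natDegree_sum_le_of_forall_le _ _ fun k _ =>
    (natDegree_C_mul_le _ _).trans (natDegree_shapePoly_shapeIdx_le k)

lemma shapeComb_eval_endpt {m : ℕ} (d : Fin 2 ⊕ Fin m → ℝ) (a : Fin 2) :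
    (shapeComb d).eval (endpt a) = d (.inl a) := by
  rw [shapeComb, eval_finsetSum]
  simp only [eval_mul, eval_C, ← shape1D_eq_eval]
  rw [Fintype.sum_sum_type]
  simp only [shapeIdx, shape1D_endpt, shape1D_fin_endpt]
  simp

/-- The derivatives of the shape functions of degree at least two are orthonormal and orthogonal to
the constants. -/
lemma polyInner_derivative_shapeComb {m : ℕ} (d : Fin 2 ⊕ Fin m → ℝ) :
    polyInner (derivative (shapeComb d)) (derivative (shapeComb d)) =
      (d (.inl 1) - d (.inl 0)) ^ 2 / 2 + ∑ j, d (.inr j) ^ 2 := by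
  set N : ℕ → ℝ := fun n => polyInner (legendre n) (legendre n)
  have hder : derivative (shapeComb d) = C ((d (.inl 1) - d (.inl 0)) / 2) +
      ∑ j : Fin m, C (d (.inr j)) * (C (1 / √(N (j + 1))) * legendre (j + 1)) := by
    rw [shapeComb, derivative_sum]
    simp only [derivative_C_mul]
    rw [Fintype.sum_sum_type, Fin.sum_univ_two]
    simp only [shapeIdx, derivative_shapePoly, N]
    congr 1
    simp only [shapePoly, derivative_C_mul, map_sub, map_add,
      derivative_one, derivative_X, zero_sub, zero_add, mul_neg, mul_one]
    simp only [← C_mul, ← C_neg, ← C_add]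
    congr 1; ring
  have h1 : ∀ j : Fin m, polyInner (C ((d (.inl 1) - d (.inl 0)) / 2)) (legendre (j + 1)) = 0 := by
    intro j
    rw [polyInner_comm]
    exact polyInner_legendre_of_natDegree_lt (by simp)
  have h2 : ∀ i j : Fin m, polyInner (legendre (i + 1)) (legendre (j + 1)) =
      if i = j then N (j + 1) else 0 := by
    intro i j
    split_ifs with h
    · rw [h]
    · rcases lt_or_gt_of_ne (fun h' => h (Fin.ext h')) with h | h
      · rw [polyInner_comm]
        exact polyInner_legendre_of_natDegree_lt (by rw [natDegree_legendre]; omega)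
      · exact polyInner_legendre_of_natDegree_lt (by rw [natDegree_legendre]; omega)
  have h3 : polyInner (C ((d (.inl 1) - d (.inl 0)) / 2)) (C ((d (.inl 1) - d (.inl 0)) / 2)) =
      (d (.inl 1) - d (.inl 0)) ^ 2 / 2 := by
    simp [polyInner]; ring
  rw [hder]
  simp only [polyInner_add_left, polyInner_add_right, polyInner_sum_left, polyInner_sum_right,
    polyInner_C_mul_left, polyInner_C_mul_right, h1, h2, h3]
  simp only [polyInner_comm _ (C ((d (.inl 1) - d (.inl 0)) / 2)), h1]
  simp only [mul_zero, Finset.sum_const_zero, add_zero, zero_add, mul_ite,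
    Finset.mem_univ, if_true, Finset.sum_ite_eq']
  congr 1
  refine Finset.sum_congr rfl fun j _ => ?_
  have hN : 0 < N (j + 1) := polyInner_legendre_self_pos _
  have := Real.mul_self_sqrt hN.le
  have hs : 0 < √(N (j + 1)) := Real.sqrt_pos.mpr hN
  field_simp
  nlinarith

/-- Trace inequality at the end points, from integrating the derivative of `(1 ± x) q² / 2`. -/
lemma eval_endpt_sq_le (q : ℝ[X]) (a : Fin 2) :
    q.eval (endpt a) ^ 2 ≤ 3 / 2 * polyInner q q + polyInner (derivative q) (derivative q) := by
  have key : ∀ s : ℝ, s ^ 2 = 1 →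
      q.eval s ^ 2 ≤ 3 / 2 * polyInner q q + polyInner (derivative q) (derivative q) := by
    intro s hs
    have h := integral_derivative_eval (C (s / 2) * ((1 + C s * X) * (q * q))) (-1) 1
    have hend : (C (s / 2) * ((1 + C s * X) * (q * q))).eval 1 -
        (C (s / 2) * ((1 + C s * X) * (q * q))).eval (-1) = q.eval s ^ 2 := by
      rcases eq_or_eq_neg_of_sq_eq_sq s 1 (by rw [hs, one_pow]) with h | h <;>
        · subst h; simp; ring
    rw [hend] at h
    rw [← h]
    simp only [polyInner]
    rw [← intervalIntegral.integral_const_mul,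
      ← intervalIntegral.integral_add (by apply Continuous.intervalIntegrable; fun_prop)
      (by apply Continuous.intervalIntegrable; fun_prop)]
    refine intervalIntegral.integral_mono_on (by norm_num)
      (by apply Continuous.intervalIntegrable; fun_prop)
      (by apply Continuous.intervalIntegrable; fun_prop) fun x hx => ?_
    simp only [derivative_mul, derivative_C, derivative_add, derivative_one, derivative_X,
      eval_add, eval_mul, eval_C, eval_one, eval_X, eval_zero]
    have hsx : |s * x| ≤ 1 := by
      rw [abs_mul, show |s| = 1 by rw [← sq_eq_sq₀ (abs_nonneg _) zero_le_one]; simpa using hs,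
        one_mul]
      exact abs_le.mpr hx
    set A := q.eval x
    set B := (derivative q).eval x
    have h1 := abs_le.mp hsx
    have hAB : |A * B| ≤ (A * A + B * B) / 2 := by
      rw [abs_le]; constructor <;> nlinarith [sq_nonneg (A - B), sq_nonneg (A + B)]
    have hs1 : |s| = 1 := by rw [← sq_eq_sq₀ (abs_nonneg _) zero_le_one]; simpa using hs
    have h2 : s * (1 + s * x) * (A * B) ≤ 2 * ((A * A + B * B) / 2) := by
      refine (le_abs_self _).trans ?_
      rw [abs_mul, abs_mul, hs1, one_mul]
      refine mul_le_mul ?_ hAB (abs_nonneg _) (by norm_num)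
      rw [abs_le]; constructor <;> linarith
    have h3 : s / 2 * s * (A * A) = 1 / 2 * (A * A) := by linear_combination (A * A / 2) * hs
    nlinarith
  exact key _ (endpt_sq a)

lemma sum_sq_le_polyInner_shapeComb {m : ℕ} (d : Fin 2 ⊕ Fin m → ℝ) :
    ∑ k, d k ^ 2 ≤ 3 * (polyInner (shapeComb d) (shapeComb d) +
      polyInner (derivative (shapeComb d)) (derivative (shapeComb d))) := by
  have h0 := eval_endpt_sq_le (shapeComb d) 0
  have h1 := eval_endpt_sq_le (shapeComb d) 1
  rw [shapeComb_eval_endpt] at h0 h1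
  have h2 := polyInner_derivative_shapeComb d
  rw [Fintype.sum_sum_type, Fin.sum_univ_two]
  nlinarith [sq_nonneg (d (.inl 1) - d (.inl 0))]

lemma polyInner_derivative_shapeComb_le {m : ℕ} (d : Fin 2 ⊕ Fin m → ℝ) :
    polyInner (derivative (shapeComb d)) (derivative (shapeComb d)) ≤ ∑ k, d k ^ 2 := by
  rw [polyInner_derivative_shapeComb, Fintype.sum_sum_type, Fin.sum_univ_two]
  nlinarith [sq_nonneg (d (.inl 1) + d (.inl 0))]

/-- A one-dimensional Friedrichs inequality, from integrating the derivative of `x q²`. -/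
lemma polyInner_self_le (q : ℝ[X]) : polyInner q q ≤
    2 * (q.eval 1 ^ 2 + q.eval (-1) ^ 2) + 4 * polyInner (derivative q) (derivative q) := by
  have h := integral_derivative_eval (X * (q * q)) (-1) 1
  have hle : ∫ x in (-1 : ℝ)..1, (derivative (X * (q * q))).eval x ≥
      (1 / 2) * polyInner q q - 2 * polyInner (derivative q) (derivative q) := by
    simp only [polyInner]
    rw [← intervalIntegral.integral_const_mul, ← intervalIntegral.integral_const_mul,
      ← intervalIntegral.integral_sub (by apply Continuous.intervalIntegrable; fun_prop)
      (by apply Continuous.intervalIntegrable; fun_prop)]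
    refine intervalIntegral.integral_mono_on (by norm_num)
      (by apply Continuous.intervalIntegrable; fun_prop)
      (by apply Continuous.intervalIntegrable; fun_prop) fun x hx => ?_
    simp only [derivative_mul, derivative_X, eval_add, eval_mul, eval_one, eval_X]
    set A := q.eval x
    set B := (derivative q).eval x
    have hx2 : x ^ 2 ≤ 1 := by nlinarith [hx.1, hx.2]
    nlinarith [sq_nonneg (A / 2 + 2 * x * B), mul_nonneg (sub_nonneg.mpr hx2) (sq_nonneg B),
      sq_nonneg (A + 2 * x * B)]
  simp only [eval_mul, eval_X] at h
  nlinarith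

lemma polyInner_shapeComb_le {m : ℕ} (d : Fin 2 ⊕ Fin m → ℝ) :
    polyInner (shapeComb d) (shapeComb d) ≤ 6 * ∑ k, d k ^ 2 := by
  have h := polyInner_self_le (shapeComb d)
  have h0 := shapeComb_eval_endpt d 0
  have h1 := shapeComb_eval_endpt d 1
  simp only [endpt, if_true, one_ne_zero, if_false] at h0 h1
  rw [h0, h1] at h
  have h2 := polyInner_derivative_shapeComb_le d
  have h3 : d (.inl 0) ^ 2 + d (.inl 1) ^ 2 ≤ ∑ k, d k ^ 2 := by
    rw [Fintype.sum_sum_type, Fin.sum_univ_two]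
    have : 0 ≤ ∑ j : Fin m, d (.inr j) ^ 2 := Finset.sum_nonneg fun _ _ => sq_nonneg _
    linarith
  linarith

end Shape

/-! ### Stability of the tensor product basis on the reference square -/

section Reference

open Polynomial

/-- The squared `L²`-norm over the reference square. -/
def sqInt (F : ℝ × ℝ → ℝ) : ℝ := ∫ z in refSquare, F z ^ 2

lemma isCompact_refSquare : IsCompact refSquare := isCompact_Icc.prod isCompact_Icc

lemma measurableSet_refSquare : MeasurableSet refSquare := isCompact_refSquare.measurableSet

lemma integrableOn_refSquare {F : ℝ × ℝ → ℝ} (hF : Continuous F) : IntegrableOn F refSquare :=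
  hF.continuousOn.integrableOn_compact isCompact_refSquare

lemma sqInt_nonneg (F : ℝ × ℝ → ℝ) : 0 ≤ sqInt F := integral_nonneg fun _ => sq_nonneg _

lemma sqInt_eq_integral_integral {F : ℝ × ℝ → ℝ} (hF : Continuous F) :
    sqInt F = ∫ x in (-1 : ℝ)..1, ∫ y in (-1 : ℝ)..1, F (x, y) ^ 2 := by
  have hi : IntegrableOn (fun z => F z ^ 2) (Icc (-1) 1 ×ˢ Icc (-1) 1) :=
    integrableOn_refSquare (by fun_prop)
  rw [sqInt, refSquare, Measure.volume_eq_prod, setIntegral_prod _ hi]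
  simp only [intervalIntegral.integral_of_le (show (-1 : ℝ) ≤ 1 by norm_num),
    integral_Icc_eq_integral_Ioc]

lemma sqInt_comp_swap (F : ℝ × ℝ → ℝ) : sqInt (F ∘ Prod.swap) = sqInt F := by
  have h : refSquare = Prod.swap ⁻¹' refSquare := by
    ext z; simp only [refSquare, mem_prod, mem_preimage, Prod.fst_swap, Prod.snd_swap, and_comm]
  have hm : MeasurePreserving (Prod.swap : ℝ × ℝ → ℝ × ℝ) := by
    rw [Measure.volume_eq_prod]; exact Measure.measurePreserving_swap
  rw [sqInt]
  conv => enter [1, 1, 2]; rw [h]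
  exact hm.setIntegral_preimage_emb (MeasurableEquiv.prodComm.measurableEmbedding)
    (fun z => F z ^ 2) refSquare

lemma continuous_integral_sq {F : ℝ × ℝ → ℝ} (hF : Continuous F) :
    Continuous fun x => ∫ y in (-1 : ℝ)..1, F (x, y) ^ 2 :=
  intervalIntegral.continuous_parametric_intervalIntegral_of_continuous' (by fun_prop) _ _

lemma sqInt_le_of_forall {F G : ℝ × ℝ → ℝ} (hF : Continuous F) (hG : Continuous G) (K : ℝ)
    (h : ∀ x, ∫ y in (-1 : ℝ)..1, F (x, y) ^ 2 ≤ K * ∫ y in (-1 : ℝ)..1, G (x, y) ^ 2) :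
    sqInt F ≤ K * sqInt G := by
  rw [sqInt_eq_integral_integral hF, sqInt_eq_integral_integral hG,
    ← intervalIntegral.integral_const_mul]
  exact intervalIntegral.integral_mono_on (by norm_num)
    ((continuous_integral_sq hF).intervalIntegrable _ _)
    (((continuous_integral_sq hG).const_smul K).intervalIntegrable _ _) fun x _ => h x

variable {m : ℕ}

/-- The functions `φ_k`, with the index split into nodal and interior functions. -/
def sh (k : Fin 2 ⊕ Fin m) : ℝ[X] := shapePoly (shapeIdx k)

/-- The derivatives `φ_k'`. -/
def dsh (k : Fin 2 ⊕ Fin m) : ℝ[X] := derivative (sh k)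

/-- The function `∑ c_kl f_k ⊗ g_l` on the plane. -/
def biComb (f g : Fin 2 ⊕ Fin m → ℝ[X]) (c : Fin 2 ⊕ Fin m → Fin 2 ⊕ Fin m → ℝ)
    (z : ℝ × ℝ) : ℝ :=
  ∑ k, ∑ l, c k l * ((f k).eval z.1 * (g l).eval z.2)

@[fun_prop]
lemma contDiff_biComb (f g : Fin 2 ⊕ Fin m → ℝ[X]) (c) : ContDiff ℝ ∞ (biComb f g c) := by
  unfold biComb
  have h : ∀ q : ℝ[X], ContDiff ℝ ∞ fun x : ℝ => q.eval x := fun q => by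
    simpa using q.contDiff_aeval (𝕜 := ℝ) ∞
  refine ContDiff.sum fun k _ => ContDiff.sum fun l _ => contDiff_const.mul
    (((h _).comp contDiff_fst).mul ((h _).comp contDiff_snd))

@[fun_prop]
lemma continuous_biComb (f g : Fin 2 ⊕ Fin m → ℝ[X]) (c) : Continuous (biComb f g c) :=
  (contDiff_biComb f g c).continuous

lemma biComb_comp_swap (f g : Fin 2 ⊕ Fin m → ℝ[X]) (c) :
    biComb f g c ∘ Prod.swap = biComb g f (fun l k => c k l) := by
  funext z
  simp only [biComb, Function.comp, Prod.fst_swap, Prod.snd_swap]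
  rw [Finset.sum_comm]
  simp only [mul_comm]

/-- The coefficients, with respect to the second variable, of `∑ c_kl f_k ⊗ g_l` at fixed `x`. -/
def rowComb (f : Fin 2 ⊕ Fin m → ℝ[X]) (c : Fin 2 ⊕ Fin m → Fin 2 ⊕ Fin m → ℝ) (x : ℝ)
    (l : Fin 2 ⊕ Fin m) : ℝ :=
  ∑ k, c k l * (f k).eval x

lemma biComb_sh_right (f : Fin 2 ⊕ Fin m → ℝ[X]) (c) (x y : ℝ) :
    biComb f sh c (x, y) = (shapeComb (rowComb f c x)).eval y := by
  simp only [biComb, shapeComb, rowComb, eval_finsetSum, eval_mul, eval_C, Finset.sum_mul, sh]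
  rw [Finset.sum_comm]
  simp only [mul_assoc]

lemma biComb_dsh_right (f : Fin 2 ⊕ Fin m → ℝ[X]) (c) (x y : ℝ) :
    biComb f dsh c (x, y) = (derivative (shapeComb (rowComb f c x))).eval y := by
  simp only [biComb, shapeComb, rowComb, derivative_sum, derivative_C_mul, eval_finsetSum,
    eval_mul, eval_C, Finset.sum_mul, dsh, sh]
  rw [Finset.sum_comm]
  simp only [mul_assoc]

/-- The sum over `l` of the squared `L²(-1, 1)`-norms of `∑_k c_kl f_k`. -/
def rowSq (f : Fin 2 ⊕ Fin m → ℝ[X]) (c : Fin 2 ⊕ Fin m → Fin 2 ⊕ Fin m → ℝ) : ℝ :=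
  ∫ x in (-1 : ℝ)..1, ∑ l, rowComb f c x l ^ 2

lemma continuous_rowComb_sq (f : Fin 2 ⊕ Fin m → ℝ[X]) (c) :
    Continuous fun x => ∑ l, rowComb f c x l ^ 2 := by
  unfold rowComb; fun_prop

lemma rowSq_eq (f : Fin 2 ⊕ Fin m → ℝ[X]) (c) :
    rowSq f c = ∑ l, ∫ x in (-1 : ℝ)..1, rowComb f c x l ^ 2 := by
  rw [rowSq, intervalIntegral.integral_finsetSum]
  intro l _
  apply Continuous.intervalIntegrable
  unfold rowComb; fun_prop

lemma integral_biComb_sh_sq (f : Fin 2 ⊕ Fin m → ℝ[X]) (c) (x : ℝ) :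
    ∫ y in (-1 : ℝ)..1, biComb f sh c (x, y) ^ 2 =
      polyInner (shapeComb (rowComb f c x)) (shapeComb (rowComb f c x)) := by
  simp only [biComb_sh_right, polyInner, pow_two]

lemma integral_biComb_dsh_sq (f : Fin 2 ⊕ Fin m → ℝ[X]) (c) (x : ℝ) :
    ∫ y in (-1 : ℝ)..1, biComb f dsh c (x, y) ^ 2 =
      polyInner (derivative (shapeComb (rowComb f c x)))
        (derivative (shapeComb (rowComb f c x))) := by
  simp only [biComb_dsh_right, polyInner, pow_two]

lemma sqInt_biComb_sh_le (f : Fin 2 ⊕ Fin m → ℝ[X]) (c) :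
    sqInt (biComb f sh c) ≤ 6 * rowSq f c := by
  rw [sqInt_eq_integral_integral (by fun_prop), rowSq, ← intervalIntegral.integral_const_mul]
  refine intervalIntegral.integral_mono_on (by norm_num)
    ((continuous_integral_sq (by fun_prop)).intervalIntegrable _ _)
    (((continuous_rowComb_sq f c).const_smul (6 : ℝ)).intervalIntegrable _ _) fun x _ => ?_
  rw [integral_biComb_sh_sq]
  exact polyInner_shapeComb_le _

lemma sqInt_biComb_dsh_le (f : Fin 2 ⊕ Fin m → ℝ[X]) (c) :
    sqInt (biComb f dsh c) ≤ rowSq f c := by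
  rw [sqInt_eq_integral_integral (by fun_prop), rowSq]
  refine intervalIntegral.integral_mono_on (by norm_num)
    ((continuous_integral_sq (by fun_prop)).intervalIntegrable _ _)
    ((continuous_rowComb_sq f c).intervalIntegrable _ _) fun x _ => ?_
  rw [integral_biComb_dsh_sq]
  exact polyInner_derivative_shapeComb_le _

lemma rowSq_le (f : Fin 2 ⊕ Fin m → ℝ[X]) (c) :
    rowSq f c ≤ 3 * (sqInt (biComb f sh c) + sqInt (biComb f dsh c)) := by
  rw [sqInt_eq_integral_integral (by fun_prop), sqInt_eq_integral_integral (by fun_prop), rowSq,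
    ← intervalIntegral.integral_add ((continuous_integral_sq (by fun_prop)).intervalIntegrable _ _)
      ((continuous_integral_sq (by fun_prop)).intervalIntegrable _ _),
    ← intervalIntegral.integral_const_mul]
  refine intervalIntegral.integral_mono_on (by norm_num)
    ((continuous_rowComb_sq f c).intervalIntegrable _ _)
    ((((continuous_integral_sq (by fun_prop)).add
      (continuous_integral_sq (by fun_prop))).const_smul (3 : ℝ)).intervalIntegrable _ _) fun x _ => ?_
  rw [integral_biComb_dsh_sq, integral_biComb_sh_sq]
  exact sum_sq_le_polyInner_shapeComb _

lemma rowComb_sh (c : Fin 2 ⊕ Fin m → Fin 2 ⊕ Fin m → ℝ) (x : ℝ) (l) :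
    rowComb sh c x l = (shapeComb fun k => c k l).eval x := by
  simp only [rowComb, shapeComb, eval_finsetSum, eval_mul, eval_C, sh]

lemma rowComb_dsh (c : Fin 2 ⊕ Fin m → Fin 2 ⊕ Fin m → ℝ) (x : ℝ) (l) :
    rowComb dsh c x l = (derivative (shapeComb fun k => c k l)).eval x := by
  simp only [rowComb, shapeComb, derivative_sum, derivative_C_mul, eval_finsetSum, eval_mul,
    eval_C, dsh, sh]

lemma rowSq_sh (c : Fin 2 ⊕ Fin m → Fin 2 ⊕ Fin m → ℝ) : rowSq sh c =
    ∑ l, polyInner (shapeComb fun k => c k l) (shapeComb fun k => c k l) := by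
  simp only [rowSq_eq, rowComb_sh, polyInner, pow_two]

lemma rowSq_dsh (c : Fin 2 ⊕ Fin m → Fin 2 ⊕ Fin m → ℝ) : rowSq dsh c =
    ∑ l, polyInner (derivative (shapeComb fun k => c k l))
      (derivative (shapeComb fun k => c k l)) := by
  simp only [rowSq_eq, rowComb_dsh, polyInner, pow_two]

/-- The squared Euclidean norm of a coefficient array. -/
def coeffSq (c : Fin 2 ⊕ Fin m → Fin 2 ⊕ Fin m → ℝ) : ℝ := ∑ k, ∑ l, c k l ^ 2

lemma coeffSq_nonneg (c : Fin 2 ⊕ Fin m → Fin 2 ⊕ Fin m → ℝ) : 0 ≤ coeffSq c :=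
  Finset.sum_nonneg fun _ _ => Finset.sum_nonneg fun _ _ => sq_nonneg _

lemma rowSq_sh_le (c : Fin 2 ⊕ Fin m → Fin 2 ⊕ Fin m → ℝ) : rowSq sh c ≤ 6 * coeffSq c := by
  rw [rowSq_sh, coeffSq, Finset.sum_comm, Finset.mul_sum]
  exact Finset.sum_le_sum fun l _ => polyInner_shapeComb_le _

lemma rowSq_dsh_le (c : Fin 2 ⊕ Fin m → Fin 2 ⊕ Fin m → ℝ) : rowSq dsh c ≤ coeffSq c := by
  rw [rowSq_dsh, coeffSq, Finset.sum_comm]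
  exact Finset.sum_le_sum fun l _ => polyInner_derivative_shapeComb_le _

lemma coeffSq_le_rowSq (c : Fin 2 ⊕ Fin m → Fin 2 ⊕ Fin m → ℝ) :
    coeffSq c ≤ 3 * (rowSq sh c + rowSq dsh c) := by
  rw [rowSq_sh, rowSq_dsh, coeffSq, Finset.sum_comm, ← Finset.sum_add_distrib, Finset.mul_sum]
  exact Finset.sum_le_sum fun l _ => sum_sq_le_polyInner_shapeComb _

lemma sqInt_biComb_le (c : Fin 2 ⊕ Fin m → Fin 2 ⊕ Fin m → ℝ) :
    sqInt (biComb sh sh c) ≤ 36 * coeffSq c := by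
  linarith [sqInt_biComb_sh_le sh c, rowSq_sh_le c]

lemma sqInt_biComb_dsh_left_le (c : Fin 2 ⊕ Fin m → Fin 2 ⊕ Fin m → ℝ) :
    sqInt (biComb dsh sh c) ≤ 6 * coeffSq c := by
  linarith [sqInt_biComb_sh_le dsh c, rowSq_dsh_le c]

lemma sqInt_biComb_dsh_right_le (c : Fin 2 ⊕ Fin m → Fin 2 ⊕ Fin m → ℝ) :
    sqInt (biComb sh dsh c) ≤ 6 * coeffSq c := by
  linarith [sqInt_biComb_dsh_le sh c, rowSq_sh_le c]

lemma markov_right (f : Fin 2 ⊕ Fin m → ℝ[X]) (c) : sqInt (biComb f dsh c) ≤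
    3 * ((m + 1 : ℕ) : ℝ) ^ 4 * sqInt (biComb f sh c) := by
  refine sqInt_le_of_forall (by fun_prop) (by fun_prop) _ fun x => ?_
  rw [integral_biComb_dsh_sq, integral_biComb_sh_sq]
  exact polyInner_derivative_self_le _ _ (natDegree_shapeComb_le _)

lemma markov_left (g : Fin 2 ⊕ Fin m → ℝ[X]) (c) : sqInt (biComb dsh g c) ≤
    3 * ((m + 1 : ℕ) : ℝ) ^ 4 * sqInt (biComb sh g c) := by
  rw [← sqInt_comp_swap, ← sqInt_comp_swap (biComb sh g c), biComb_comp_swap, biComb_comp_swap]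
  exact markov_right _ _

/-- The tensorized one-dimensional estimate, in the norm of `H¹ ⊗ H¹`. -/
lemma coeffSq_le (c : Fin 2 ⊕ Fin m → Fin 2 ⊕ Fin m → ℝ) :
    coeffSq c ≤ 9 * (sqInt (biComb sh sh c) + sqInt (biComb sh dsh c) +
      (sqInt (biComb dsh sh c) + sqInt (biComb dsh dsh c))) := by
  linarith [coeffSq_le_rowSq c, rowSq_le sh c, rowSq_le dsh c]

/-- The mixed derivative costs a factor `p⁴` relative to the gradient. -/
lemma coeffSq_le_h1 (c : Fin 2 ⊕ Fin m → Fin 2 ⊕ Fin m → ℝ) :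
    coeffSq c ≤ 36 * (sqInt (biComb sh sh c) + ((m + 1 : ℕ) : ℝ) ^ 4 *
      (sqInt (biComb dsh sh c) + sqInt (biComb sh dsh c))) := by
  have h1 := coeffSq_le c
  have h2 := markov_right dsh c
  have hP : (1 : ℝ) ≤ ((m + 1 : ℕ) : ℝ) ^ 4 := one_le_pow₀ (by simp)
  have h3 := mul_le_mul_of_nonneg_right hP
    (add_nonneg (sqInt_nonneg (biComb dsh sh c)) (sqInt_nonneg (biComb sh dsh c)))
  have h4 := sqInt_nonneg (biComb sh sh c)
  have h5 := mul_nonneg (zero_le_one.trans hP) (sqInt_nonneg (biComb sh dsh c))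
  linarith

/-- Markov's inequality in both variables bounds the mixed derivative by `p⁸` times the `L²`-norm. -/
lemma coeffSq_le_l2 (c : Fin 2 ⊕ Fin m → Fin 2 ⊕ Fin m → ℝ) :
    coeffSq c ≤ 144 * (((m + 1 : ℕ) : ℝ) ^ 8 * sqInt (biComb sh sh c)) := by
  have h1 := coeffSq_le c
  have h2 := markov_right dsh c
  have h3 := markov_right sh c
  have h4 := markov_left sh c
  set P : ℝ := ((m + 1 : ℕ) : ℝ) ^ 4 with hPdef
  have hP : 1 ≤ P := one_le_pow₀ (by simp)
  have hP8 : ((m + 1 : ℕ) : ℝ) ^ 8 = P * P := by rw [hPdef]; ring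
  rw [hP8]
  set D := sqInt (biComb sh sh c)
  have hD : 0 ≤ D := sqInt_nonneg _
  have h5 : sqInt (biComb dsh dsh c) ≤ 9 * (P * P * D) := by
    have := mul_le_mul_of_nonneg_left h4 (show 0 ≤ 3 * P by positivity)
    linarith
  have h6 : P * D ≤ P * P * D := by
    have := mul_le_mul_of_nonneg_right hP (show 0 ≤ P * D by positivity)
    linarith
  have h7 : D ≤ P * D := by
    have := mul_le_mul_of_nonneg_right hP hD
    linarith
  linarith

end Reference

/-! ### Surface measure of affine quadrilaterals -/

section Area

/-- The tangent vector `∂F/∂x₁` of an affine parametrization. -/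
def vecA (F : ℝ × ℝ →ᵃ[ℝ] E3) : E3 := F.linear (1, 0)

/-- The tangent vector `∂F/∂x₂` of an affine parametrization. -/
def vecB (F : ℝ × ℝ →ᵃ[ℝ] E3) : E3 := F.linear (0, 1)

/-- The Gram determinant of the two tangent vectors, i.e. the square of the area density. -/
def gramDet (F : ℝ × ℝ →ᵃ[ℝ] E3) : ℝ :=
  ‖vecA F‖ ^ 2 * ‖vecB F‖ ^ 2 - ⟪vecA F, vecB F⟫ ^ 2

/-- The area density of an affine parametrization. -/
def jac (F : ℝ × ℝ →ᵃ[ℝ] E3) : ℝ := √(gramDet F)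

lemma affine_apply (F : ℝ × ℝ →ᵃ[ℝ] E3) (z : ℝ × ℝ) :
    F z = z.1 • vecA F + z.2 • vecB F + F 0 := by
  have h := congrFun F.decomp z
  simp only [Pi.add_apply] at h
  rw [h]
  congr 1
  rw [vecA, vecB, ← map_smul, ← map_smul, ← map_add]
  simp

lemma affine_sub (F : ℝ × ℝ →ᵃ[ℝ] E3) (z w : ℝ × ℝ) :
    F z - F w = (z.1 - w.1) • vecA F + (z.2 - w.2) • vecB F := by
  rw [affine_apply F z, affine_apply F w]; module

lemma continuous_affine (F : ℝ × ℝ →ᵃ[ℝ] E3) : Continuous F :=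
  F.continuous_of_finiteDimensional

/-- The linear part of an affine parametrization, on the plane with its Euclidean structure. -/
def euclLinear (F : ℝ × ℝ →ᵃ[ℝ] E3) : EuclideanSpace ℝ (Fin 2) →ₗ[ℝ] E3 where
  toFun x := x 0 • vecA F + x 1 • vecB F
  map_add' x y := by simp only [PiLp.add_apply]; module
  map_smul' c x := by simp only [PiLp.smul_apply, smul_eq_mul, RingHom.id_apply]; module

lemma normDet_euclLinear_sq (F : ℝ × ℝ →ᵃ[ℝ] E3) : (euclLinear F).normDet ^ 2 = gramDet F := by
  have h := (euclLinear F).normDet_sq_eq_det_gram (EuclideanSpace.basisFun (Fin 2) ℝ)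
  simp only [RCLike.ofReal_real_eq_id, id_eq] at h
  rw [h, Matrix.det_fin_two]
  simp only [Matrix.gram_apply, euclLinear, EuclideanSpace.basisFun_apply, LinearMap.coe_mk,
    AddHom.coe_mk, gramDet]
  simp [real_inner_comm]
  ring

lemma normDet_euclLinear (F : ℝ × ℝ →ᵃ[ℝ] E3) : (euclLinear F).normDet = jac F := by
  rw [jac, ← normDet_euclLinear_sq, Real.sqrt_sq (LinearMap.normDet_nonneg _)]

lemma gramDet_nonneg (F : ℝ × ℝ →ᵃ[ℝ] E3) : 0 ≤ gramDet F := by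
  rw [← normDet_euclLinear_sq]; positivity

lemma jac_sq (F : ℝ × ℝ →ᵃ[ℝ] E3) : jac F ^ 2 = gramDet F := Real.sq_sqrt (gramDet_nonneg F)

lemma jac_nonneg (F : ℝ × ℝ →ᵃ[ℝ] E3) : 0 ≤ jac F := Real.sqrt_nonneg _

lemma jac_pos {F : ℝ × ℝ →ᵃ[ℝ] E3} (hF : Function.Injective F) : 0 < jac F := by
  refine lt_of_le_of_ne (jac_nonneg F) fun h => ?_
  rw [← normDet_euclLinear] at h
  refine LinearMap.normDet_eq_zero_iff_ker_ne_bot.mp h.symm ?_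
  rw [LinearMap.ker_eq_bot]
  intro x y hxy
  have : F (x 0, x 1) = F (y 0, y 1) := by
    rw [affine_apply F (x 0, x 1), affine_apply F (y 0, y 1)]
    simp only [euclLinear, LinearMap.coe_mk, AddHom.coe_mk] at hxy
    simp only [hxy]
  have := Prod.mk.inj (hF this)
  ext i; fin_cases i
  · exact this.1
  · exact this.2

/-- The area formula for affine parametrizations. -/
lemma measure_affine_image (F : ℝ × ℝ →ᵃ[ℝ] E3) (A : Set (ℝ × ℝ)) :
    μHE[2] (F '' A) = ENNReal.ofReal (jac F) * volume A := by
  set e : EuclideanSpace ℝ (Fin 2) → ℝ × ℝ := fun x => (x 0, x 1)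
  have he : MeasurePreserving e volume volume := by
    have := (volume_preserving_finTwoArrow ℝ).comp (PiLp.volume_preserving_ofLp (Fin 2))
    exact this
  have hemb : MeasurableEmbedding e := by
    have : Continuous e := by fun_prop
    refine this.measurableEmbedding fun x y hxy => ?_
    have := Prod.mk.inj hxy
    ext i; fin_cases i
    · exact this.1
    · exact this.2
  have himg : F '' A = (fun v => v + F 0) '' (euclLinear F '' (e ⁻¹' A)) := by
    ext v
    simp only [mem_image, exists_exists_and_eq_and, mem_preimage]
    constructor
    · rintro ⟨z, hz, rfl⟩
      refine ⟨!₂[z.1, z.2], by simpa [e] using hz, ?_⟩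
      rw [affine_apply F z]; simp [euclLinear]
    · rintro ⟨x, hx, rfl⟩
      refine ⟨_, hx, ?_⟩
      rw [affine_apply]; simp [euclLinear, e]
  have hiso : Isometry fun v : E3 => v + F 0 := isometry_add_right (F 0)
  rw [himg, hiso.euclideanHausdorffMeasure_image]
  have h2 := (euclLinear F).euclideanHausdorffMeasure_image_eq_normDet_mul_volume (e ⁻¹' A)
  rw [finrank_euclideanSpace_fin] at h2
  rw [h2, normDet_euclLinear, he.measure_preimage_emb hemb]

lemma measurableEmbedding_affine {F : ℝ × ℝ →ᵃ[ℝ] E3} (hF : Function.Injective F) :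
    MeasurableEmbedding F := (continuous_affine F).measurableEmbedding hF

lemma restrict_affine_image {F : ℝ × ℝ →ᵃ[ℝ] E3} (hF : Function.Injective F)
    (A : Set (ℝ × ℝ)) (hA : MeasurableSet A) : (μHE[2] : Measure E3).restrict (F '' A) =
      ENNReal.ofReal (jac F) • (volume.restrict A).map F := by
  ext s hs
  rw [Measure.restrict_apply hs, Measure.smul_apply,
    (measurableEmbedding_affine hF).map_apply, Measure.restrict_apply'
      hA, smul_eq_mul, ← measure_affine_image, image_preimage_inter]

lemma lintegral_affine_image {F : ℝ × ℝ →ᵃ[ℝ] E3} (hF : Function.Injective F)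
    {A : Set (ℝ × ℝ)} (hA : MeasurableSet A) (f : E3 → ℝ≥0∞) :
    ∫⁻ x in F '' A, f x ∂μHE[2] = ENNReal.ofReal (jac F) * ∫⁻ z in A, f (F z) := by
  rw [restrict_affine_image hF A hA, lintegral_smul_measure,
    (measurableEmbedding_affine hF).lintegral_map, smul_eq_mul]

lemma integral_affine_image {F : ℝ × ℝ →ᵃ[ℝ] E3} (hF : Function.Injective F)
    {A : Set (ℝ × ℝ)} (hA : MeasurableSet A) (f : E3 → ℝ) :
    ∫ x in F '' A, f x ∂μHE[2] = jac F * ∫ z in A, f (F z) := by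
  rw [restrict_affine_image hF A hA, integral_smul_measure,
    (measurableEmbedding_affine hF).integral_map, smul_eq_mul,
    ENNReal.toReal_ofReal (jac_nonneg F)]

lemma ae_affine_image_iff {F : ℝ × ℝ →ᵃ[ℝ] E3} (hF : Function.Injective F)
    {A : Set (ℝ × ℝ)} (hA : MeasurableSet A) (p : E3 → Prop) :
    (∀ᵐ x ∂(μHE[2] : Measure E3).restrict (F '' A), p x) ↔
      ∀ᵐ z ∂(volume.restrict A), p (F z) := by
  rw [restrict_affine_image hF A hA, Measure.ae_ennreal_smul_measure_iff
    (by simpa using jac_pos hF), (measurableEmbedding_affine hF).ae_map_iff]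

lemma integrableOn_affine_image_iff {E : Type*} [NormedAddCommGroup E]
    {F : ℝ × ℝ →ᵃ[ℝ] E3} (hF : Function.Injective F)
    {A : Set (ℝ × ℝ)} (hA : MeasurableSet A) (f : E3 → E) :
    IntegrableOn f (F '' A) μHE[2] ↔ IntegrableOn (fun z => f (F z)) A := by
  rw [IntegrableOn, restrict_affine_image hF A hA, integrable_smul_measure
    (by simpa using jac_pos hF) ENNReal.ofReal_ne_top,
    (measurableEmbedding_affine hF).integrable_map_iff]
  rfl

lemma aestronglyMeasurable_affine_image {E : Type*} [NormedAddCommGroup E]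
    {F : ℝ × ℝ →ᵃ[ℝ] E3} (hF : Function.Injective F)
    {A : Set (ℝ × ℝ)} (hA : MeasurableSet A) (f : E3 → E)
    (hf : AEStronglyMeasurable (fun z => f (F z)) (volume.restrict A)) :
    AEStronglyMeasurable f ((μHE[2] : Measure E3).restrict (F '' A)) := by
  rw [restrict_affine_image hF A hA]
  exact ((measurableEmbedding_affine hF).aestronglyMeasurable_map_iff.mpr hf).smul_measure _

lemma volume_refSquare : volume refSquare = 4 := by
  rw [refSquare, Measure.volume_eq_prod, Measure.prod_prod, Real.volume_Icc]
  rw [← ENNReal.ofReal_mul (by norm_num)]; norm_num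

lemma measure_elem (F : ℝ × ℝ →ᵃ[ℝ] E3) :
    μHE[2] (F '' refSquare) = ENNReal.ofReal (4 * jac F) := by
  rw [measure_affine_image, volume_refSquare, mul_comm 4,
    ENNReal.ofReal_mul (jac_nonneg F)]
  norm_num

lemma isCompact_elem (F : ℝ × ℝ →ᵃ[ℝ] E3) : IsCompact (F '' refSquare) :=
  isCompact_refSquare.image (continuous_affine F)

lemma mem_refSquare {z : ℝ × ℝ} : z ∈ refSquare ↔ |z.1| ≤ 1 ∧ |z.2| ≤ 1 := by
  simp only [refSquare, mem_prod, mem_Icc, abs_le]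

lemma two_mul_norm_vecA_le (F : ℝ × ℝ →ᵃ[ℝ] E3) :
    2 * ‖vecA F‖ ≤ Metric.diam (F '' refSquare) := by
  have h : ‖F (1, 0) - F (-1, 0)‖ = 2 * ‖vecA F‖ := by
    rw [affine_sub]; norm_num [norm_smul]
  rw [← h, ← dist_eq_norm]
  exact Metric.dist_le_diam_of_mem (isCompact_elem F).isBounded
    (mem_image_of_mem _ (by norm_num [mem_refSquare]))
    (mem_image_of_mem _ (by norm_num [mem_refSquare]))

lemma two_mul_norm_vecB_le (F : ℝ × ℝ →ᵃ[ℝ] E3) :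
    2 * ‖vecB F‖ ≤ Metric.diam (F '' refSquare) := by
  have h : ‖F (0, 1) - F (0, -1)‖ = 2 * ‖vecB F‖ := by
    rw [affine_sub]; norm_num [norm_smul]
  rw [← h, ← dist_eq_norm]
  exact Metric.dist_le_diam_of_mem (isCompact_elem F).isBounded
    (mem_image_of_mem _ (by norm_num [mem_refSquare]))
    (mem_image_of_mem _ (by norm_num [mem_refSquare]))

lemma four_mul_jac_le (F : ℝ × ℝ →ᵃ[ℝ] E3) :
    4 * jac F ≤ Metric.diam (F '' refSquare) ^ 2 := by
  have h1 := two_mul_norm_vecA_le F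
  have h2 := two_mul_norm_vecB_le F
  have h3 : jac F ≤ ‖vecA F‖ * ‖vecB F‖ := by
    refine abs_le_of_sq_le_sq' ?_ (by positivity) |>.2
    rw [jac_sq, gramDet, mul_pow]
    linarith [sq_nonneg ⟪vecA F, vecB F⟫]
  have h4 := mul_le_mul h1 h2 (by positivity) Metric.diam_nonneg
  nlinarith

lemma diam_elem_pos {F : ℝ × ℝ →ᵃ[ℝ] E3} (hF : Function.Injective F) :
    0 < Metric.diam (F '' refSquare) := by
  have h1 := four_mul_jac_le F
  have h2 := jac_pos hF
  exact lt_of_le_of_ne Metric.diam_nonneg fun h => by rw [← h] at h1; norm_num at h1; linarith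

/-- The tangential vector with given inner products with `∂F/∂x₁` and `∂F/∂x₂`: the surface gradient
of a function whose pull-back under `F` has the gradient `(s, t)`. -/
def tangVec (F : ℝ × ℝ →ᵃ[ℝ] E3) (s t : ℝ) : E3 :=
  ((s * ‖vecB F‖ ^ 2 - t * ⟪vecA F, vecB F⟫) / gramDet F) • vecA F +
    ((t * ‖vecA F‖ ^ 2 - s * ⟪vecA F, vecB F⟫) / gramDet F) • vecB F

lemma inner_tangVec_vecA {F : ℝ × ℝ →ᵃ[ℝ] E3} (hF : Function.Injective F) (s t : ℝ) :
    ⟪tangVec F s t, vecA F⟫ = s := by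
  have h : 0 < gramDet F := by rw [← jac_sq]; exact pow_pos (jac_pos hF) 2
  rw [tangVec, inner_add_left, real_inner_smul_left, real_inner_smul_left,
    real_inner_self_eq_norm_sq, real_inner_comm (vecA F) (vecB F)]
  field_simp
  rw [gramDet]; ring

lemma inner_tangVec_vecB {F : ℝ × ℝ →ᵃ[ℝ] E3} (hF : Function.Injective F) (s t : ℝ) :
    ⟪tangVec F s t, vecB F⟫ = t := by
  have h : 0 < gramDet F := by rw [← jac_sq]; exact pow_pos (jac_pos hF) 2
  rw [tangVec, inner_add_left, real_inner_smul_left, real_inner_smul_left,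
    real_inner_self_eq_norm_sq]
  field_simp
  rw [gramDet]; ring

lemma norm_tangVec_sq {F : ℝ × ℝ →ᵃ[ℝ] E3} (hF : Function.Injective F) (s t : ℝ) :
    ‖tangVec F s t‖ ^ 2 * gramDet F =
      s ^ 2 * ‖vecB F‖ ^ 2 - 2 * s * t * ⟪vecA F, vecB F⟫ + t ^ 2 * ‖vecA F‖ ^ 2 := by
  have h : 0 < gramDet F := by rw [← jac_sq]; exact pow_pos (jac_pos hF) 2
  rw [← real_inner_self_eq_norm_sq]
  nth_rewrite 2 [tangVec]
  rw [inner_add_right, real_inner_smul_right, real_inner_smul_right, inner_tangVec_vecA hF,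
    inner_tangVec_vecB hF]
  field_simp
  ring

/-- The Dirichlet density is bounded by that of the reference square, without a power of the element
diameter: the surface has dimension two. -/
lemma norm_tangVec_sq_mul_jac_le {F : ℝ × ℝ →ᵃ[ℝ] E3} (hF : Function.Injective F) {γ : ℝ}
    (hγ : Metric.diam (F '' refSquare) ^ 2 ≤ γ * (4 * jac F)) (s t : ℝ) :
    jac F * ‖tangVec F s t‖ ^ 2 ≤ 2 * γ * (s ^ 2 + t ^ 2) := by
  have hJ := jac_pos hF
  have h1 := norm_tangVec_sq hF s t
  rw [← jac_sq] at h1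
  have h2 := two_mul_norm_vecA_le F
  have h3 := two_mul_norm_vecB_le F
  set d := Metric.diam (F '' refSquare)
  have h4 : s ^ 2 * ‖vecB F‖ ^ 2 - 2 * s * t * ⟪vecA F, vecB F⟫ + t ^ 2 * ‖vecA F‖ ^ 2 ≤
      2 * (s ^ 2 * ‖vecB F‖ ^ 2 + t ^ 2 * ‖vecA F‖ ^ 2) := by
    have h5 := norm_add_sq_real (s • vecB F) (t • vecA F)
    rw [norm_smul, norm_smul, mul_pow, mul_pow, real_inner_smul_left, real_inner_smul_right,
      real_inner_comm, Real.norm_eq_abs, Real.norm_eq_abs, sq_abs, sq_abs] at h5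
    nlinarith [sq_nonneg ‖s • vecB F + t • vecA F‖]
  have h6 : ‖vecA F‖ ^ 2 ≤ γ * jac F := by nlinarith [norm_nonneg (vecA F)]
  have h7 : ‖vecB F‖ ^ 2 ≤ γ * jac F := by nlinarith [norm_nonneg (vecB F)]
  have h8 : jac F * (jac F * ‖tangVec F s t‖ ^ 2) ≤ jac F * (2 * γ * (s ^ 2 + t ^ 2)) := by
    have := mul_le_mul_of_nonneg_left h7 (sq_nonneg s)
    have := mul_le_mul_of_nonneg_left h6 (sq_nonneg t)
    nlinarith
  exact le_of_mul_le_mul_left h8 hJ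

lemma sq_add_sq_le_jac_mul {F : ℝ × ℝ →ᵃ[ℝ] E3} (hF : Function.Injective F) {γ : ℝ}
    (hγ : Metric.diam (F '' refSquare) ^ 2 ≤ γ * (4 * jac F)) (s t : ℝ) :
    s ^ 2 + t ^ 2 ≤ 2 * γ * (jac F * ‖tangVec F s t‖ ^ 2) := by
  have h2 := two_mul_norm_vecA_le F
  have h3 := two_mul_norm_vecB_le F
  set d := Metric.diam (F '' refSquare)
  have h6 : ‖vecA F‖ ^ 2 ≤ γ * jac F := by nlinarith [norm_nonneg (vecA F)]
  have h7 : ‖vecB F‖ ^ 2 ≤ γ * jac F := by nlinarith [norm_nonneg (vecB F)]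
  have hs : s ^ 2 ≤ ‖tangVec F s t‖ ^ 2 * ‖vecA F‖ ^ 2 := by
    have := abs_real_inner_le_norm (tangVec F s t) (vecA F)
    rw [inner_tangVec_vecA hF] at this
    rw [← mul_pow, ← sq_abs s]; gcongr
  have ht : t ^ 2 ≤ ‖tangVec F s t‖ ^ 2 * ‖vecB F‖ ^ 2 := by
    have := abs_real_inner_le_norm (tangVec F s t) (vecB F)
    rw [inner_tangVec_vecB hF] at this
    rw [← mul_pow, ← sq_abs t]; gcongr
  have := mul_le_mul_of_nonneg_left h7 (sq_nonneg ‖tangVec F s t‖)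
  have := mul_le_mul_of_nonneg_left h6 (sq_nonneg ‖tangVec F s t‖)
  linarith

/-- A ball cuts a plane in a set of area at most a multiple of the squared radius. -/
lemma measure_plane_inter_closedBall_le {n : E3} (hn : n ≠ 0) (b : ℝ) (x₀ : E3) (r : ℝ) :
    μHE[2] ({x | ⟪n, x⟫ = b} ∩ Metric.closedBall x₀ r) ≤ ENNReal.ofReal (16 * r ^ 2) := by
  rcases ({x | ⟪n, x⟫ = b} ∩ Metric.closedBall x₀ r).eq_empty_or_nonempty with h | ⟨x₁, hx₁, hx₁'⟩
  · rw [h]; simp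
  have hfr : Fact (Module.finrank ℝ E3 = 2 + 1) := ⟨by simp⟩
  have hdim : Module.finrank ℝ (ℝ ∙ n)ᗮ = 2 := Submodule.finrank_orthogonal_span_singleton hn
  let B : OrthonormalBasis (Fin 2) ℝ (ℝ ∙ n)ᗮ := (stdOrthonormalBasis ℝ _).reindex (finCongr hdim)
  set F : ℝ × ℝ →ᵃ[ℝ] E3 := AffineMap.mk' (fun z => z.1 • (B 0 : E3) + z.2 • (B 1 : E3) + x₁)
    { toFun := fun z => z.1 • (B 0 : E3) + z.2 • (B 1 : E3)
      map_add' := fun z w => by simp only [Prod.fst_add, Prod.snd_add]; module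
      map_smul' := fun c z => by
        simp only [Prod.smul_fst, Prod.smul_snd, smul_eq_mul, RingHom.id_apply]; module }
    0 (fun z => by simp) with hF
  have hA : vecA F = B 0 := by simp [vecA, hF]
  have hB : vecB F = B 1 := by simp [vecB, hF]
  have h0 : ‖(B 0 : E3)‖ = 1 := B.orthonormal.1 0
  have h1 : ‖(B 1 : E3)‖ = 1 := B.orthonormal.1 1
  have h01 : ⟪(B 0 : E3), (B 1 : E3)⟫ = 0 := B.orthonormal.2 (show (0 : Fin 2) ≠ 1 by decide)
  have hjac : jac F = 1 := by rw [jac, gramDet, hA, hB, h0, h1, h01]; norm_num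
  have hsub : {x | ⟪n, x⟫ = b} ∩ Metric.closedBall x₀ r ⊆
      F '' (Icc (-(2 * r)) (2 * r) ×ˢ Icc (-(2 * r)) (2 * r)) := by
    rintro x ⟨hx, hx'⟩
    have hmem : x - x₁ ∈ (ℝ ∙ n)ᗮ := by
      rw [Submodule.mem_orthogonal_singleton_iff_inner_right, inner_sub_right]
      simp only [mem_ofPred_eq] at hx hx₁
      rw [hx, hx₁, sub_self]
    have hd : ‖x - x₁‖ ≤ 2 * r := by
      rw [← dist_eq_norm]
      have := dist_triangle_right x x₁ x₀
      simp only [Metric.mem_closedBall] at hx' hx₁'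
      linarith
    have hrep := congrArg Subtype.val (B.sum_repr' ⟨x - x₁, hmem⟩)
    simp only [Fin.sum_univ_two, Submodule.coe_add, Submodule.coe_smul] at hrep
    refine ⟨(⟪(B 0 : E3), x - x₁⟫, ⟪(B 1 : E3), x - x₁⟫), ?_, ?_⟩
    · have e0 := abs_real_inner_le_norm (B 0 : E3) (x - x₁)
      have e1 := abs_real_inner_le_norm (B 1 : E3) (x - x₁)
      rw [h0, one_mul] at e0
      rw [h1, one_mul] at e1
      exact ⟨abs_le.mp (e0.trans hd), abs_le.mp (e1.trans hd)⟩
    · simp only [hF, AffineMap.coe_mk']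
      simp only [Submodule.coe_inner] at hrep
      rw [hrep]; abel
  refine (measure_mono hsub).trans ?_
  have hr : 0 ≤ r := dist_nonneg.trans hx₁'
  rw [measure_affine_image, hjac, Measure.volume_eq_prod, Measure.prod_prod, Real.volume_Icc,
    ENNReal.ofReal_one, one_mul, ← ENNReal.ofReal_mul (by linarith)]
  apply le_of_eq; congr 1; ring

end Area

/-! ### Stokes' theorem for Lipschitz functions -/

section Stokes

open Filter Topology

variable {E : Type*} [NormedAddCommGroup E] [NormedSpace ℝ E]

/-- A function that grows at most linearly with a uniform constant near each point is Lipschitz. -/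
lemma lipschitzWith_of_eventually_le {F : Type*} [NormedAddCommGroup F] {f : E → F} {C : ℝ≥0}
    (h : ∀ x, ∀ᶠ y in 𝓝 x, ‖f y - f x‖ ≤ C * ‖y - x‖) : LipschitzWith C f := by
  have hcont : Continuous f := by
    rw [continuous_iff_continuousAt]
    intro x
    rw [ContinuousAt, tendsto_iff_norm_sub_tendsto_zero]
    refine squeeze_zero' (Eventually.of_forall fun _ => norm_nonneg _) (h x) ?_
    have : Continuous fun y => (C : ℝ) * ‖y - x‖ := by fun_prop
    simpa using this.tendsto x
  refine LipschitzWith.of_dist_le_mul fun y x => ?_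
  rw [dist_eq_norm, dist_eq_norm]
  set v := y - x
  let s : Set ℝ := {t | ‖f (x + t • v) - f x‖ ≤ C * (t * ‖v‖)}
  have hs : IsClosed s := isClosed_le (by fun_prop) (by fun_prop)
  have hsub : Icc (0 : ℝ) 1 ⊆ s := by
    refine IsClosed.Icc_subset_of_forall_exists_gt (hs.inter isClosed_Icc) (by simp [s]) ?_
    rintro t ⟨ht, ht0, ht1⟩ r hr
    have hlim : Tendsto (fun τ : ℝ => x + τ • v) (𝓝[>] t) (𝓝 (x + t • v)) := by
      have : Continuous fun τ : ℝ => x + τ • v := by fun_prop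
      exact (this.tendsto t).mono_left nhdsWithin_le_nhds
    obtain ⟨τ, hτ1, hτ2⟩ := ((hlim.eventually (h (x + t • v))).and
      (Ioc_mem_nhdsGT hr)).exists
    refine ⟨τ, ?_, hτ2⟩
    have e : x + τ • v - (x + t • v) = (τ - t) • v := by module
    rw [e, norm_smul, Real.norm_eq_abs, abs_of_pos (sub_pos.mpr hτ2.1)] at hτ1
    have ht' : ‖f (x + t • v) - f x‖ ≤ C * (t * ‖v‖) := ht
    calc ‖f (x + τ • v) - f x‖
        ≤ ‖f (x + τ • v) - f (x + t • v)‖ + ‖f (x + t • v) - f x‖ :=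
          norm_sub_le_norm_sub_add_norm_sub _ _ _
      _ ≤ C * (τ * ‖v‖) := by linarith
  have := hsub (right_mem_Icc.mpr zero_le_one)
  simpa [s, v] using this

lemma lineDeriv_eq_zero_of_notMem_tsupport {g : E → ℝ} {x : E} (hx : x ∉ tsupport g) (v : E) :
    lineDeriv ℝ g x v = 0 := by
  have h : g =ᶠ[𝓝 x] fun _ => 0 := notMem_tsupport_iff_eventuallyEq.mp hx
  have hf : HasFDerivAt g (0 : E →L[ℝ] ℝ) x := (hasFDerivAt_const 0 x).congr_of_eventuallyEq h
  simpa using (hf.hasLineDerivAt v).lineDeriv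

variable [MeasurableSpace E] [BorelSpace E] [FiniteDimensional ℝ E] {μ : Measure E}
  [μ.IsAddHaarMeasure]

lemma integrable_lineDeriv {C : ℝ≥0} {g : E → ℝ} (hg : LipschitzWith C g)
    (hc : HasCompactSupport g) (v : E) : Integrable (fun x => lineDeriv ℝ g x v) μ := by
  have h := (hg.locallyIntegrable_lineDeriv (μ := μ) v).integrableOn_isCompact hc.isCompact
  exact h.integrable_of_forall_notMem_eq_zero fun x hx =>
    lineDeriv_eq_zero_of_notMem_tsupport hx v

/-- Stokes' theorem `∫ dg ∧ df = 0` for Lipschitz functions, one of them compactly supported. The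
derivative of `f` along `v` is replaced by difference quotients, to which the integration by parts
formula applies. -/
lemma integral_lineDeriv_mul_lineDeriv_comm {C D : ℝ≥0} {f g : E → ℝ} (hf : LipschitzWith C f)
    (hg : LipschitzWith D g) (hc : HasCompactSupport g) (v w : E) :
    ∫ x, lineDeriv ℝ f x v * lineDeriv ℝ g x w ∂μ =
      ∫ x, lineDeriv ℝ g x v * lineDeriv ℝ f x w ∂μ := by
  have hlim1 := hf.integral_inv_smul_sub_mul_tendsto_integral_lineDeriv_mul
    (integrable_lineDeriv (μ := μ) hg hc w) v
  -- `K` contains the supports of all translates `g (· - t v)` with `t ≤ 1`, so that cutting off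
  -- `lineDeriv f` outside of `K` makes it integrable without changing the integrals below
  set K := Metric.cthickening ‖v‖ (tsupport g)
  have hK : IsCompact K := IsCompact.cthickening hc
  set k : E → ℝ := K.indicator fun x => lineDeriv ℝ f x w
  have hk : Integrable k μ := (integrable_indicator_iff hK.measurableSet).mpr
    ((hf.locallyIntegrable_lineDeriv (μ := μ) w).integrableOn_isCompact hK)
  have hlim2 := hg.integral_inv_smul_sub_mul_tendsto_integral_lineDeriv_mul hk (-v)
  have hlast : ∫ x, lineDeriv ℝ g x (-v) * k x ∂μ =
      -∫ x, lineDeriv ℝ g x v * lineDeriv ℝ f x w ∂μ := by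
    rw [← integral_neg]
    congr 1; ext x
    rw [lineDeriv_neg]
    by_cases hx : x ∈ tsupport g
    · have hkx : k x = lineDeriv ℝ f x w :=
        indicator_of_mem (Metric.self_subset_cthickening _ hx) _
      rw [hkx, neg_mul]
    · simp [lineDeriv_eq_zero_of_notMem_tsupport hx]
  rw [hlast] at hlim2
  have hlim3 := hlim2.neg
  rw [neg_neg] at hlim3
  refine tendsto_nhds_unique hlim1 (hlim3.congr' ?_)
  filter_upwards [Ioc_mem_nhdsGT zero_lt_one] with t ht
  have ht0 : 0 < t := ht.1
  set q : E → ℝ := fun x => t⁻¹ • (f (x + t • v) - f x)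
  have hshift : LipschitzWith C fun x => f (x + t • v) := by
    simpa [Function.comp_def] using
      hf.comp ((LipschitzWith.id (α := E)).add (LipschitzWith.const (t • v)))
  have hq : LipschitzWith (‖t⁻¹‖₊ * (C + C)) q :=
    (lipschitzWith_smul t⁻¹).comp (hshift.sub hf)
  have hibp := hq.integral_lineDeriv_mul_eq hg hc (μ := μ) (-w)
  rw [neg_neg] at hibp
  have hcomm : ∫ x, q x * lineDeriv ℝ g x w ∂μ = ∫ x, lineDeriv ℝ g x w * q x ∂μ := by
    simp only [mul_comm]
  change -_ = ∫ x, q x * lineDeriv ℝ g x w ∂μ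
  rw [hcomm, ← hibp]
  have hqd : ∀ᵐ x ∂μ, lineDeriv ℝ q x (-w) =
      -(t⁻¹ * (lineDeriv ℝ f (x + t • v) w - lineDeriv ℝ f x w)) := by
    have h1 := hf.ae_lineDifferentiableAt (μ := μ) w
    have h2 := hshift.ae_lineDifferentiableAt (μ := μ) w
    filter_upwards [h1, h2] with x hx1 hx2
    rw [lineDeriv_neg]
    congr 1
    have e2 : lineDeriv ℝ (fun x => f (x + t • v)) x w = lineDeriv ℝ f (x + t • v) w := by
      simp only [lineDeriv, add_right_comm]
    rw [← e2]
    have d1 : HasDerivAt (fun τ : ℝ => f (x + τ • w)) (lineDeriv ℝ f x w) 0 :=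
      hx1.hasLineDerivAt
    have d2 : HasDerivAt (fun τ : ℝ => f (x + τ • w + t • v))
      (lineDeriv ℝ (fun x => f (x + t • v)) x w) 0 := hx2.hasLineDerivAt
    exact ((d2.sub d1).const_mul t⁻¹).deriv
  have e3 : ∫ x, lineDeriv ℝ q x (-w) * g x ∂μ =
      -(t⁻¹ * ∫ x, (lineDeriv ℝ f (x + t • v) w - lineDeriv ℝ f x w) * g x ∂μ) := by
    rw [← integral_const_mul, ← integral_neg]
    refine integral_congr_ae ?_
    filter_upwards [hqd] with x hx
    rw [hx]; ring
  have e4 : ∀ x, t⁻¹ • (g (x + t • -v) - g x) * k x =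
      t⁻¹ * ((g (x + t • -v) - g x) * lineDeriv ℝ f x w) := by
    intro x
    by_cases hx : x ∈ K
    · simp only [k, indicator_of_mem hx, smul_eq_mul, mul_assoc]
    · have A : g x = 0 := by
        rw [← Function.notMem_support]
        contrapose! hx
        exact Metric.self_subset_cthickening _ (subset_tsupport _ hx)
      have B : g (x + t • -v) = 0 := by
        rw [← Function.notMem_support]
        contrapose! hx
        refine Metric.mem_cthickening_of_dist_le _ _ _ (tsupport g) (subset_tsupport _ hx) ?_
        simp only [dist_eq_norm, sub_add_cancel_left, norm_neg, norm_smul, Real.norm_eq_abs,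
          abs_of_pos ht0]
        exact mul_le_of_le_one_left (norm_nonneg v) ht.2
      rw [A, B]; simp
  rw [e3]
  simp_rw [e4]
  rw [integral_const_mul]
  congr 2
  -- discrete integration by parts: translation invariance moves the shift to the other factor
  have hloc := (hf.locallyIntegrable_lineDeriv (μ := μ) w)
  have i1 : Integrable (fun x => g (x + t • -v) * lineDeriv ℝ f x w) μ :=
    hloc.integrable_smul_left_of_hasCompactSupport
      (hg.continuous.comp (continuous_add_const _))
      (hc.comp_homeomorph (Homeomorph.addRight (t • -v)))
  have i2 : Integrable (fun x => g x * lineDeriv ℝ f x w) μ :=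
    hloc.integrable_smul_left_of_hasCompactSupport hg.continuous hc
  have i3 : Integrable (fun x => g x * lineDeriv ℝ f (x + t • v) w) μ := by
    have := i1.comp_add_right (t • v)
    simpa using this
  have S : ∫ x, g x * lineDeriv ℝ f (x + t • v) w ∂μ =
      ∫ x, g (x + t • -v) * lineDeriv ℝ f x w ∂μ := by
    rw [← integral_add_right_eq_self (fun x => g (x + t • -v) * lineDeriv ℝ f x w) (t • v)]
    simp
  have e5 : ∀ x, (lineDeriv ℝ f (x + t • v) w - lineDeriv ℝ f x w) * g x =
      g x * lineDeriv ℝ f (x + t • v) w - g x * lineDeriv ℝ f x w := fun x => by ring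
  simp_rw [e5, sub_mul]
  rw [integral_sub i3 i2, integral_sub i1 i2, S]

end Stokes

/-! ### The boundary near interior points of flat pieces -/

section Geometry

open Filter Topology

/-- The cross product. -/
def crossE (a b : E3) : E3 :=
  !₂[a 1 * b 2 - a 2 * b 1, a 2 * b 0 - a 0 * b 2, a 0 * b 1 - a 1 * b 0]

lemma inner_E3 (a b : E3) : ⟪a, b⟫ = a 0 * b 0 + a 1 * b 1 + a 2 * b 2 := by
  simp [PiLp.inner_apply, Fin.sum_univ_three]; ring

lemma inner_crossE_crossE (a b c d : E3) :
    ⟪crossE a b, crossE c d⟫ = ⟪a, c⟫ * ⟪b, d⟫ - ⟪a, d⟫ * ⟪b, c⟫ := by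
  simp only [inner_E3, crossE]; simp; ring

lemma inner_crossE_left (a b : E3) : ⟪crossE a b, a⟫ = 0 := by
  simp only [inner_E3, crossE]; simp; ring

lemma inner_crossE_right (a b : E3) : ⟪crossE a b, b⟫ = 0 := by
  simp only [inner_E3, crossE]; simp; ring

/-- The vectors which `ρ` maps to the coordinate directions. -/
def frameVec (ρ : E3 ≃ᵃⁱ[ℝ] E3) (i : Fin 3) : E3 :=
  ρ.linearIsometryEquiv.symm (EuclideanSpace.single i 1)

/-- The horizontal coordinates of a point. -/
def gproj (ρ : E3 ≃ᵃⁱ[ℝ] E3) (y : E3) : ℝ × ℝ := (ρ y 0, ρ y 1)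

/-- The point with horizontal coordinates `p` and height `r`. -/
def gpoint (ρ : E3 ≃ᵃⁱ[ℝ] E3) (p : ℝ × ℝ) (r : ℝ) : E3 := ρ.symm !₂[p.1, p.2, r]

lemma rho_gpoint (ρ : E3 ≃ᵃⁱ[ℝ] E3) (p : ℝ × ℝ) (r : ℝ) : ρ (gpoint ρ p r) = !₂[p.1, p.2, r] :=
  ρ.apply_symm_apply _

lemma gproj_gpoint (ρ : E3 ≃ᵃⁱ[ℝ] E3) (p : ℝ × ℝ) (r : ℝ) : gproj ρ (gpoint ρ p r) = p := by
  simp [gproj, rho_gpoint]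

lemma gpoint_gproj (ρ : E3 ≃ᵃⁱ[ℝ] E3) (y : E3) : gpoint ρ (gproj ρ y) (ρ y 2) = y := by
  apply ρ.injective
  rw [rho_gpoint]
  ext i; fin_cases i <;> simp [gproj]

lemma rho_apply_sub (ρ : E3 ≃ᵃⁱ[ℝ] E3) (x y : E3) (i : Fin 3) :
    ρ x i - ρ y i = ⟪frameVec ρ i, x - y⟫ := by
  have h : ρ.linearIsometryEquiv (x - y) = ρ x - ρ y := ρ.map_vsub x y
  rw [frameVec, ← ρ.linearIsometryEquiv.inner_map_map, LinearIsometryEquiv.apply_symm_apply, h,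
    EuclideanSpace.inner_single_left]
  simp

lemma inner_frameVec (ρ : E3 ≃ᵃⁱ[ℝ] E3) (i j : Fin 3) :
    ⟪frameVec ρ i, frameVec ρ j⟫ = if i = j then 1 else 0 := by
  rw [frameVec, frameVec, LinearIsometryEquiv.inner_map_map, EuclideanSpace.inner_single_left]
  simp

lemma sum_inner_frameVec (ρ : E3 ≃ᵃⁱ[ℝ] E3) (v : E3) : v = ⟪frameVec ρ 0, v⟫ • frameVec ρ 0 +
    ⟪frameVec ρ 1, v⟫ • frameVec ρ 1 + ⟪frameVec ρ 2, v⟫ • frameVec ρ 2 := by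
  apply ρ.linearIsometryEquiv.injective
  simp only [map_add, map_smul, frameVec, LinearIsometryEquiv.apply_symm_apply]
  have h : ∀ i, ⟪ρ.linearIsometryEquiv.symm (EuclideanSpace.single i 1), v⟫ =
      ρ.linearIsometryEquiv v i := fun i => by
    rw [← ρ.linearIsometryEquiv.inner_map_map, LinearIsometryEquiv.apply_symm_apply,
      EuclideanSpace.inner_single_left]
    simp
  simp only [h]
  ext i; fin_cases i <;> simp

lemma continuous_gpoint (ρ : E3 ≃ᵃⁱ[ℝ] E3) : Continuous fun q : (ℝ × ℝ) × ℝ => gpoint ρ q.1 q.2 := by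
  unfold gpoint
  refine ρ.symm.continuous.comp ?_
  refine (PiLp.continuous_toLp 2 _).comp (continuous_pi fun i => ?_)
  fin_cases i <;> simp <;> fun_prop

lemma continuous_gproj (ρ : E3 ≃ᵃⁱ[ℝ] E3) : Continuous (gproj ρ) := by
  unfold gproj
  have := ρ.continuous
  fun_prop

/-- `Ω` lies, inside the open set `V`, below the graph of the Lipschitz function `ζ`. -/
structure IsPatch (Ω V : Set E3) (ρ : E3 ≃ᵃⁱ[ℝ] E3) (ζ : ℝ × ℝ → ℝ) : Prop where
  isOpen : IsOpen V
  lipschitz : ∃ L : ℝ≥0, LipschitzWith L ζ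
  mem_iff : ∀ y ∈ V, (y ∈ Ω ↔ ρ y 2 < ζ (gproj ρ y))

lemma IsHypographIn.isPatch {Ω U : Set E3} {ρ : E3 ≃ᵃⁱ[ℝ] E3} {ζ : ℝ × ℝ → ℝ}
    (h : IsHypographIn Ω U ρ ζ) : IsPatch Ω (interior U) ρ ζ :=
  ⟨isOpen_interior, h.1, fun y hy => h.2 y (interior_subset hy)⟩

variable {Ω V : Set E3} {ρ : E3 ≃ᵃⁱ[ℝ] E3} {ζ : ℝ × ℝ → ℝ}

lemma IsPatch.continuous (h : IsPatch Ω V ρ ζ) : Continuous ζ := by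
  obtain ⟨L, hL⟩ := h.lipschitz
  exact hL.continuous

/-- Inside a patch, the boundary is the graph. -/
lemma IsPatch.mem_frontier_iff (h : IsPatch Ω V ρ ζ) (hΩ : IsOpen Ω) {y : E3} (hy : y ∈ V) :
    y ∈ frontier Ω ↔ ρ y 2 = ζ (gproj ρ y) := by
  have hζ := h.continuous
  have hp := continuous_gproj ρ
  have hρ := ρ.continuous
  rw [hΩ.frontier_eq]
  constructor
  · rintro ⟨hcl, hn⟩
    rw [h.mem_iff y hy, not_lt] at hn
    refine le_antisymm ?_ hn
    by_contra! hlt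
    have hopen : IsOpen (V ∩ {y | ζ (gproj ρ y) < ρ y 2}) :=
      h.isOpen.inter (isOpen_lt (by fun_prop) (by fun_prop))
    obtain ⟨z, ⟨hzV, hz⟩, hzΩ⟩ := mem_closure_iff.mp hcl _ hopen ⟨hy, hlt⟩
    exact absurd ((h.mem_iff z hzV).mp hzΩ) (not_lt.mpr (le_of_lt hz))
  · intro he
    refine ⟨?_, fun hm => absurd ((h.mem_iff y hy).mp hm) (by rw [he]; exact lt_irrefl _)⟩
    have hlim : Tendsto (fun t : ℝ => gpoint ρ (gproj ρ y) (ρ y 2 - t)) (𝓝[>] 0) (𝓝 y) := by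
      have hc : Continuous fun t : ℝ => gpoint ρ (gproj ρ y) (ρ y 2 - t) :=
        (continuous_gpoint ρ).comp
          (f := fun t : ℝ => (gproj ρ y, ρ y 2 - t)) (by fun_prop)
      have := hc.tendsto 0
      rw [sub_zero, gpoint_gproj] at this
      exact this.mono_left nhdsWithin_le_nhds
    refine mem_closure_of_tendsto hlim ?_
    filter_upwards [hlim.eventually (h.isOpen.mem_nhds hy), self_mem_nhdsWithin] with t ht ht0
    rw [h.mem_iff _ ht, gproj_gpoint, rho_gpoint, ← he]
    simpa using ht0

/-- The open reference square. -/
def refInterior : Set (ℝ × ℝ) := Ioo (-1) 1 ×ˢ Ioo (-1) 1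

lemma isOpen_refInterior : IsOpen refInterior := isOpen_Ioo.prod isOpen_Ioo

lemma refInterior_subset : refInterior ⊆ refSquare := prod_mono Ioo_subset_Icc_self Ioo_subset_Icc_self

lemma ae_refInterior : ∀ᵐ z ∂(volume.restrict refSquare), z ∈ refInterior := by
  have h : (refInterior : Set (ℝ × ℝ)) =ᵐ[volume] refSquare := by
    rw [refInterior, refSquare, Measure.volume_eq_prod]
    exact Measure.set_prod_ae_eq Ioo_ae_eq_Icc Ioo_ae_eq_Icc
  rw [← Measure.restrict_congr_set h]
  exact ae_restrict_mem isOpen_refInterior.measurableSet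

/-- The determinant of the parametrization followed by the projection to horizontal coordinates. -/
def projDet (ρ : E3 ≃ᵃⁱ[ℝ] E3) (F : ℝ × ℝ →ᵃ[ℝ] E3) : ℝ :=
  ⟪vecA F, frameVec ρ 0⟫ * ⟪vecB F, frameVec ρ 1⟫ - ⟪vecA F, frameVec ρ 1⟫ * ⟪vecB F, frameVec ρ 0⟫

/-- The sign by which `ρ` changes the orientation of space. -/
def frameSign (ρ : E3 ≃ᵃⁱ[ℝ] E3) : ℝ := ⟪crossE (frameVec ρ 0) (frameVec ρ 1), frameVec ρ 2⟫

lemma crossE_frameVec (ρ : E3 ≃ᵃⁱ[ℝ] E3) :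
    crossE (frameVec ρ 0) (frameVec ρ 1) = frameSign ρ • frameVec ρ 2 := by
  conv_lhs => rw [sum_inner_frameVec ρ (crossE (frameVec ρ 0) (frameVec ρ 1))]
  rw [real_inner_comm, inner_crossE_left, real_inner_comm, inner_crossE_right, frameSign,
    real_inner_comm (frameVec ρ 2)]
  simp

lemma frameSign_sq (ρ : E3 ≃ᵃⁱ[ℝ] E3) : frameSign ρ ^ 2 = 1 := by
  have h := inner_crossE_crossE (frameVec ρ 0) (frameVec ρ 1) (frameVec ρ 0) (frameVec ρ 1)
  rw [crossE_frameVec, real_inner_smul_left, real_inner_smul_right] at h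
  simp only [inner_frameVec] at h
  simp at h
  linarith

lemma projDet_eq (ρ : E3 ≃ᵃⁱ[ℝ] E3) (F : ℝ × ℝ →ᵃ[ℝ] E3) :
    projDet ρ F = frameSign ρ * ⟪crossE (vecA F) (vecB F), frameVec ρ 2⟫ := by
  rw [projDet, ← inner_crossE_crossE, crossE_frameVec, real_inner_smul_right]

lemma norm_crossE_sq (F : ℝ × ℝ →ᵃ[ℝ] E3) : ‖crossE (vecA F) (vecB F)‖ ^ 2 = jac F ^ 2 := by
  rw [← real_inner_self_eq_norm_sq, inner_crossE_crossE, jac_sq, gramDet,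
    real_inner_self_eq_norm_sq, real_inner_self_eq_norm_sq, real_inner_comm (vecA F) (vecB F)]
  ring

lemma gproj_affine_sub (ρ : E3 ≃ᵃⁱ[ℝ] E3) (F : ℝ × ℝ →ᵃ[ℝ] E3) (z w : ℝ × ℝ) (i : Fin 3) :
    ρ (F z) i - ρ (F w) i =
      (z.1 - w.1) * ⟪vecA F, frameVec ρ i⟫ + (z.2 - w.2) * ⟪vecB F, frameVec ρ i⟫ := by
  rw [rho_apply_sub, affine_sub, inner_add_right, real_inner_smul_right, real_inner_smul_right,
    real_inner_comm (vecA F), real_inner_comm (vecB F)]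

variable {F : ℝ × ℝ →ᵃ[ℝ] E3}

lemma eventually_line_mem (hV : IsOpen V) {z : ℝ × ℝ} (hz : z ∈ refInterior) (hzV : F z ∈ V)
    (v : ℝ × ℝ) : ∀ᶠ t in 𝓝 (0 : ℝ), z + t • v ∈ refInterior ∧ F (z + t • v) ∈ V := by
  have hc : Continuous fun t : ℝ => z + t • v := by fun_prop
  have h0 : z + (0 : ℝ) • v = z := by simp
  have h1 := hc.continuousAt.eventually_mem (x := 0)
    (isOpen_refInterior.mem_nhds (by rw [h0]; exact hz))
  have h2 := ((continuous_affine F).comp hc).continuousAt.eventually_mem (x := 0)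
    (hV.mem_nhds (by simpa [h0] using hzV))
  exact h1.and h2

/-- A flat piece of the boundary projects injectively to the horizontal coordinates of a patch. -/
lemma IsPatch.projDet_ne_zero (h : IsPatch Ω V ρ ζ) (hΩ : IsOpen Ω) (hF : Function.Injective F)
    (hsub : F '' refSquare ⊆ frontier Ω) {z : ℝ × ℝ} (hz : z ∈ refInterior) (hzV : F z ∈ V) :
    projDet ρ F ≠ 0 := by
  intro hdet
  obtain ⟨v, hv, hv0, hv1⟩ : ∃ v : ℝ × ℝ, v ≠ 0 ∧
      v.1 * ⟪vecA F, frameVec ρ 0⟫ + v.2 * ⟪vecB F, frameVec ρ 0⟫ = 0 ∧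
      v.1 * ⟪vecA F, frameVec ρ 1⟫ + v.2 * ⟪vecB F, frameVec ρ 1⟫ = 0 := by
    rw [projDet] at hdet
    by_cases h0 : ⟪vecA F, frameVec ρ 0⟫ = 0 ∧ ⟪vecB F, frameVec ρ 0⟫ = 0
    · by_cases h1 : ⟪vecA F, frameVec ρ 1⟫ = 0 ∧ ⟪vecB F, frameVec ρ 1⟫ = 0
      · exact ⟨(1, 0), by simp, by simp [h0], by simp [h1]⟩
      · refine ⟨(⟪vecB F, frameVec ρ 1⟫, -⟪vecA F, frameVec ρ 1⟫), ?_, by simp [h0], by ring⟩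
        intro h2
        simp only [Prod.mk_eq_zero, neg_eq_zero] at h2
        exact h1 ⟨h2.2, h2.1⟩
    · refine ⟨(⟪vecB F, frameVec ρ 0⟫, -⟪vecA F, frameVec ρ 0⟫), ?_, by ring, by linarith⟩
      intro h2
      simp only [Prod.mk_eq_zero, neg_eq_zero] at h2
      exact h0 ⟨h2.2, h2.1⟩
  -- moving along `v` does not change the horizontal coordinates, hence not the boundary point
  obtain ⟨t, ⟨ht, htV⟩, ht0⟩ := (((eventually_line_mem h.isOpen hz hzV v).filter_mono
    nhdsWithin_le_nhds).and (self_mem_nhdsWithin (a := (0 : ℝ)) (s := {0}ᶜ))).exists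
  have e0 := gproj_affine_sub ρ F (z + t • v) z 0
  have e1 := gproj_affine_sub ρ F (z + t • v) z 1
  simp only [Prod.fst_add, Prod.smul_fst, Prod.snd_add, Prod.smul_snd, smul_eq_mul,
    add_sub_cancel_left, mul_assoc, ← mul_add, hv0, hv1, mul_zero] at e0 e1
  have hg : gproj ρ (F (z + t • v)) = gproj ρ (F z) := by
    simp only [gproj, sub_eq_zero.mp e0, sub_eq_zero.mp e1]
  have m1 := (h.mem_frontier_iff hΩ htV).mp (hsub (mem_image_of_mem _ (refInterior_subset ht)))
  have m2 := (h.mem_frontier_iff hΩ hzV).mp (hsub (mem_image_of_mem _ (refInterior_subset hz)))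
  have : F (z + t • v) = F z := by
    rw [← gpoint_gproj ρ (F (z + t • v)), ← gpoint_gproj ρ (F z), m1, m2, hg]
  have h3 := hF this
  simp only [add_eq_left, smul_eq_zero] at h3
  exact h3.elim (fun h => ht0 h) hv

/-- A point of the parameter plane with prescribed horizontal coordinates. -/
lemma exists_gproj_eq (hdet : projDet ρ F ≠ 0) (z : ℝ × ℝ) (p : ℝ × ℝ) :
    gproj ρ (F (z + (((p.1 - ρ (F z) 0) * ⟪vecB F, frameVec ρ 1⟫ -
        (p.2 - ρ (F z) 1) * ⟪vecB F, frameVec ρ 0⟫) / projDet ρ F,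
      ((p.2 - ρ (F z) 1) * ⟪vecA F, frameVec ρ 0⟫ -
        (p.1 - ρ (F z) 0) * ⟪vecA F, frameVec ρ 1⟫) / projDet ρ F))) = p := by
  set w : ℝ × ℝ := z + (((p.1 - ρ (F z) 0) * ⟪vecB F, frameVec ρ 1⟫ -
        (p.2 - ρ (F z) 1) * ⟪vecB F, frameVec ρ 0⟫) / projDet ρ F,
      ((p.2 - ρ (F z) 1) * ⟪vecA F, frameVec ρ 0⟫ -
        (p.1 - ρ (F z) 0) * ⟪vecA F, frameVec ρ 1⟫) / projDet ρ F) with hw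
  have e0 := gproj_affine_sub ρ F w z 0
  have e1 := gproj_affine_sub ρ F w z 1
  simp only [hw, Prod.fst_add, Prod.snd_add, add_sub_cancel_left] at e0 e1
  rw [← hw] at e0 e1
  ext
  · have : ρ (F w) 0 - ρ (F z) 0 = p.1 - ρ (F z) 0 := by
      rw [e0]; field_simp; rw [projDet]; ring
    simpa [gproj] using this
  · have : ρ (F w) 1 - ρ (F z) 1 = p.2 - ρ (F z) 1 := by
      rw [e1]; field_simp; rw [projDet]; ring
    simpa [gproj] using this

/-- Near an interior point of a flat piece of the boundary, `Ω` is a half-space. -/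
lemma IsPatch.isOuterNormal (h : IsPatch Ω V ρ ζ) (hΩ : IsOpen Ω) (hF : Function.Injective F)
    (hsub : F '' refSquare ⊆ frontier Ω) {z : ℝ × ℝ} (hz : z ∈ refInterior) (hzV : F z ∈ V)
    {ν : E3} (hν : ‖ν‖ = 1) (hνa : ⟪ν, vecA F⟫ = 0) (hνb : ⟪ν, vecB F⟫ = 0)
    (hνρ : 0 < ⟪ν, frameVec ρ 2⟫) : IsOuterNormal Ω (F z) ν := by
  refine ⟨hν, ?_⟩
  have hdet := h.projDet_ne_zero hΩ hF hsub hz hzV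
  -- `F (w y)` is the point of the flat piece with the same horizontal coordinates as `y`
  set w : E3 → ℝ × ℝ := fun y =>
    z + (((ρ y 0 - ρ (F z) 0) * ⟪vecB F, frameVec ρ 1⟫ -
        (ρ y 1 - ρ (F z) 1) * ⟪vecB F, frameVec ρ 0⟫) / projDet ρ F,
      ((ρ y 1 - ρ (F z) 1) * ⟪vecA F, frameVec ρ 0⟫ -
        (ρ y 0 - ρ (F z) 0) * ⟪vecA F, frameVec ρ 1⟫) / projDet ρ F) with hw
  have hwp : ∀ y, gproj ρ (F (w y)) = gproj ρ y := fun y => exists_gproj_eq hdet z (gproj ρ y)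
  have hwc : Continuous w := by
    have := ρ.continuous
    simp only [hw]
    fun_prop
  have hwz : w (F z) = z := by simp [hw]
  have hev : ∀ᶠ y in 𝓝 (F z), y ∈ V ∧ w y ∈ refInterior ∧ F (w y) ∈ V := by
    refine Eventually.and (h.isOpen.mem_nhds hzV) (Eventually.and ?_ ?_)
    · exact hwc.continuousAt.eventually_mem (isOpen_refInterior.mem_nhds (by rwa [hwz]))
    · exact ((continuous_affine F).comp hwc).continuousAt.eventually_mem
        (h.isOpen.mem_nhds (by simpa [hwz] using hzV))
  obtain ⟨ε, hε, hball⟩ := Metric.eventually_nhds_iff.mp hev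
  refine ⟨ε, hε, fun y hy => ?_⟩
  obtain ⟨hyV, hwi, hwV⟩ := hball hy
  have m := (h.mem_frontier_iff hΩ hwV).mp (hsub (mem_image_of_mem _ (refInterior_subset hwi)))
  rw [h.mem_iff y hyV, ← hwp y, ← m]
  have hdiff : y - F (w y) = (ρ y 2 - ρ (F (w y)) 2) • frameVec ρ 2 := by
    rw [sum_inner_frameVec ρ (y - F (w y)), ← rho_apply_sub, ← rho_apply_sub, ← rho_apply_sub]
    have := Prod.mk.inj (hwp y)
    rw [this.1, this.2]
    simp
  have hin : ⟪ν, y - F z⟫ = (ρ y 2 - ρ (F (w y)) 2) * ⟪ν, frameVec ρ 2⟫ := by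
    have : y - F z = (y - F (w y)) + (F (w y) - F z) := by abel
    rw [this, inner_add_right, hdiff, real_inner_smul_right, affine_sub, inner_add_right,
      real_inner_smul_right, real_inner_smul_right, hνa, hνb]
    ring
  rw [hin]
  constructor
  · intro hlt
    exact mul_neg_of_neg_of_pos (by linarith) hνρ
  · intro hlt
    by_contra! hle
    exact absurd hlt (not_lt.mpr (mul_nonneg (by linarith) hνρ.le))

lemma IsOuterNormal.unique {x ν ν' : E3} (h : IsOuterNormal Ω x ν) (h' : IsOuterNormal Ω x ν') :
    ν = ν' := by
  obtain ⟨hν, ε, hε, H⟩ := h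
  obtain ⟨hν', ε', hε', H'⟩ := h'
  by_contra hne
  have hlt : ⟪ν, ν'⟫ < 1 := (inner_lt_one_iff_real_of_norm_eq_one hν hν').mpr hne
  have hlim : Tendsto (fun t : ℝ => x + t • (ν' - ν)) (𝓝[>] 0) (𝓝 x) := by
    have hc : Continuous fun t : ℝ => x + t • (ν' - ν) := by fun_prop
    have := hc.tendsto 0
    rw [zero_smul, add_zero] at this
    exact this.mono_left nhdsWithin_le_nhds
  -- the points `x + t (ν' - ν)` with small `t > 0` are in `Ω` according to `ν`, but not to `ν'`
  obtain ⟨t, ⟨ht1, ht2⟩, ht0⟩ := ((hlim.eventually (Eventually.and (Metric.ball_mem_nhds x hε)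
    (Metric.ball_mem_nhds x hε'))).and self_mem_nhdsWithin).exists
  have e1 : ⟪ν, x + t • (ν' - ν) - x⟫ = t * (⟪ν, ν'⟫ - 1) := by
    rw [add_sub_cancel_left, real_inner_smul_right, inner_sub_right, real_inner_self_eq_norm_sq, hν]
    norm_num
  have e2 : ⟪ν', x + t • (ν' - ν) - x⟫ = t * (1 - ⟪ν, ν'⟫) := by
    rw [add_sub_cancel_left, real_inner_smul_right, inner_sub_right, real_inner_self_eq_norm_sq,
      hν', real_inner_comm]
    norm_num
  have h1 := (H _ ht1).mpr (by rw [e1]; exact mul_neg_of_pos_of_neg ht0 (by linarith))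
  have h2 := (H' _ ht2).mp h1
  rw [e2] at h2
  have := mul_pos (show 0 < t from ht0) (show 0 < 1 - ⟪ν, ν'⟫ by linarith)
  linarith

lemma outerNormal_eq {x ν : E3} (h : IsOuterNormal Ω x ν) : outerNormal Ω x = ν := by
  have hex : ∃ ν, IsOuterNormal Ω x ν := ⟨ν, h⟩
  rw [outerNormal, dif_pos hex]
  exact hex.choose_spec.unique h

/-- Inside a patch the outer normal of a flat piece is the unit normal pointing upwards. -/
lemma IsPatch.outerNormal_eq (h : IsPatch Ω V ρ ζ) (hΩ : IsOpen Ω) (hF : Function.Injective F)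
    (hsub : F '' refSquare ⊆ frontier Ω) {z : ℝ × ℝ} (hz : z ∈ refInterior) (hzV : F z ∈ V)
    {s : ℝ} (hs : s ^ 2 = 1) (hpos : 0 < s * ⟪crossE (vecA F) (vecB F), frameVec ρ 2⟫) :
    outerNormal Ω (F z) = (s / jac F) • crossE (vecA F) (vecB F) := by
  have hJ := jac_pos hF
  refine QuadBEM.outerNormal_eq (h.isOuterNormal hΩ hF hsub hz hzV ?_ ?_ ?_ ?_)
  · have : ‖(s / jac F) • crossE (vecA F) (vecB F)‖ ^ 2 = 1 := by
      rw [norm_smul, mul_pow, norm_crossE_sq, Real.norm_eq_abs, sq_abs, div_pow, hs]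
      field_simp
    exact (pow_eq_one_iff_of_nonneg (norm_nonneg _) two_ne_zero).mp this
  · rw [real_inner_smul_left, inner_crossE_left, mul_zero]
  · rw [real_inner_smul_left, inner_crossE_right, mul_zero]
  · rw [real_inner_smul_left, div_mul_eq_mul_div]
    exact div_pos hpos hJ

/-- The outer normal is constant on the interior of a flat piece of the boundary; it is one of the
two unit normals of the piece and points upwards in every patch. -/
lemma exists_outerNormal_eq (hΩ : IsLipschitzPolyhedron Ω) (hF : Function.Injective F)
    (hsub : F '' refSquare ⊆ frontier Ω) : ∃ s : ℝ, s ^ 2 = 1 ∧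
      (∀ z ∈ refInterior, outerNormal Ω (F z) = (s / jac F) • crossE (vecA F) (vecB F)) ∧
      ∀ V ρ ζ, IsPatch Ω V ρ ζ → ∀ z ∈ refInterior, F z ∈ V →
        0 < s * ⟪crossE (vecA F) (vecB F), frameVec ρ 2⟫ := by
  have hJ := jac_pos hF
  set n := crossE (vecA F) (vecB F) with hn
  have hsign : ∀ V ρ ζ, IsPatch Ω V ρ ζ → ∀ z ∈ refInterior, F z ∈ V →
      ∃ s : ℝ, s ^ 2 = 1 ∧ 0 < s * ⟪n, frameVec ρ 2⟫ := by
    intro V ρ ζ h z hz hzV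
    have hdet := h.projDet_ne_zero hΩ.isOpen hF hsub hz hzV
    rw [projDet_eq] at hdet
    rcases lt_or_gt_of_ne (right_ne_zero_of_mul hdet) with h0 | h0
    · exact ⟨-1, by norm_num, by linarith⟩
    · exact ⟨1, by norm_num, by linarith⟩
  have hpatch : ∀ z ∈ refInterior, ∃ V ρ ζ, IsPatch Ω V ρ ζ ∧ F z ∈ V := by
    intro z hz
    obtain ⟨U, hU, ρ, ζ, h⟩ := hΩ.isLipschitz (F z)
      (hsub (mem_image_of_mem _ (refInterior_subset hz)))
    exact ⟨_, ρ, ζ, h.isPatch, mem_interior_iff_mem_nhds.mpr hU⟩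
  set f : ℝ × ℝ → ℝ := fun z => ⟪outerNormal Ω (F z), n⟫ / jac F with hf
  have hval : ∀ s : ℝ, ⟪(s / jac F) • n, n⟫ / jac F = s := by
    intro s
    rw [real_inner_smul_left, real_inner_self_eq_norm_sq, hn, norm_crossE_sq]
    field_simp
  -- in a patch, the sign of the normal is determined by the requirement to point upwards
  have hloc : ∀ V ρ ζ, IsPatch Ω V ρ ζ → ∀ z ∈ refInterior, F z ∈ V → ∀ s : ℝ, s ^ 2 = 1 →
      0 < s * ⟪n, frameVec ρ 2⟫ → f z = s := by
    intro V ρ ζ h z hz hzV s hs hpos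
    simp only [hf]
    rw [h.outerNormal_eq hΩ.isOpen hF hsub hz hzV hs hpos]
    exact hval s
  have hcont : ContinuousOn f refInterior := by
    intro z hz
    obtain ⟨V, ρ, ζ, h, hzV⟩ := hpatch z hz
    obtain ⟨s, hs, hpos⟩ := hsign V ρ ζ h z hz hzV
    have hev : ∀ᶠ w in 𝓝 z, f w = s := by
      filter_upwards [isOpen_refInterior.mem_nhds hz,
        (continuous_affine F).continuousAt.eventually_mem (h.isOpen.mem_nhds hzV)] with w hw hwV
      exact hloc V ρ ζ h w hw hwV s hs hpos
    exact (continuousAt_const.congr (hev.mono fun w hw => hw.symm)).continuousWithinAt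
  have hmaps : MapsTo f refInterior ({1, -1} : Set ℝ) := by
    intro z hz
    obtain ⟨V, ρ, ζ, h, hzV⟩ := hpatch z hz
    obtain ⟨s, hs, hpos⟩ := hsign V ρ ζ h z hz hzV
    rw [hloc V ρ ζ h z hz hzV s hs hpos]
    exact eq_or_eq_neg_of_sq_eq_sq s 1 (by rw [hs, one_pow])
  have hconn : IsPreconnected refInterior := isPreconnected_Ioo.prod isPreconnected_Ioo
  have h0 : ((0, 0) : ℝ × ℝ) ∈ refInterior := by simp [refInterior]
  have hconst : ∀ z ∈ refInterior, f z = f (0, 0) := fun z hz =>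
    hconn.constant_of_mapsTo (isDiscrete_iff_discreteTopology.mpr
      ((Set.toFinite ({1, -1} : Set ℝ)).instDiscreteTopology)) hcont hmaps hz h0
  have key : ∀ V ρ ζ, IsPatch Ω V ρ ζ → ∀ z ∈ refInterior, F z ∈ V →
      f (0, 0) ^ 2 = 1 ∧ 0 < f (0, 0) * ⟪n, frameVec ρ 2⟫ := by
    intro V ρ ζ h z hz hzV
    obtain ⟨s, hs, hpos⟩ := hsign V ρ ζ h z hz hzV
    rw [← hconst z hz, hloc V ρ ζ h z hz hzV s hs hpos]
    exact ⟨hs, hpos⟩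
  refine ⟨f (0, 0), ?_, fun z hz => ?_, fun V ρ ζ h z hz hzV => (key V ρ ζ h z hz hzV).2⟩
  · obtain ⟨V, ρ, ζ, h, hzV⟩ := hpatch _ h0
    exact (key V ρ ζ h _ h0 hzV).1
  · obtain ⟨V, ρ, ζ, h, hzV⟩ := hpatch z hz
    obtain ⟨h1, h2⟩ := key V ρ ζ h z hz hzV
    exact h.outerNormal_eq hΩ.isOpen hF hsub hz hzV h1 h2

end Geometry

/-! ### Meshes of boundary pieces -/

section Mesh

open Filter Topology

variable {Ω Γ : Set E3}

lemma IsLipschitzPiece.subset_frontier (hΓ : IsLipschitzPiece Ω Γ) : Γ ⊆ frontier Ω := by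
  obtain ⟨O, -, rfl⟩ := hΓ.isRelOpen
  exact inter_subset_right

lemma IsLipschitzPiece.closure_subset_frontier (hΓ : IsLipschitzPiece Ω Γ) :
    closure Γ ⊆ frontier Ω :=
  closure_minimal hΓ.subset_frontier isClosed_frontier

lemma refVertex_notMem_refInterior (a : Fin 2 × Fin 2) : refVertex a ∉ refInterior := by
  intro h
  have := h.1
  simp only [refVertex, endpt] at this
  split_ifs at this <;> simp at this

lemma refEdge_notMem_refInterior (d b : Fin 2) (s : ℝ) : refEdge d b s ∉ refInterior := by
  intro h
  obtain ⟨h1, h2⟩ := h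
  simp only [refEdge, endpt] at h1 h2
  split_ifs at h1 h2 <;> simp at h1 h2

lemma refEdge_mem_refSquare (d b : Fin 2) {s : ℝ} (hs : s ∈ Icc (-1 : ℝ) 1) :
    refEdge d b s ∈ refSquare := by
  simp only [refEdge, endpt, refSquare]
  split_ifs <;> simp_all

lemma refVertex_mem_refSquare (a : Fin 2 × Fin 2) : refVertex a ∈ refSquare := by
  simp only [refVertex, endpt, refSquare]
  constructor <;> split_ifs <;> simp

namespace QuadMesh

variable (T : QuadMesh Γ)

lemma elem_subset_closure (K : Fin T.N) : T.elem K ⊆ closure Γ := by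
  rw [← T.cover]; exact subset_iUnion (fun K => T.F K '' refSquare) K

lemma elem_subset_frontier (hΓ : IsLipschitzPiece Ω Γ) (K : Fin T.N) :
    T.F K '' refSquare ⊆ frontier Ω :=
  (T.elem_subset_closure K).trans hΓ.closure_subset_frontier

/-- The image of an interior point of the reference square belongs to a single element, because
elements meet only in vertices and edges. -/
lemma notMem_elem_of_ne {K K' : Fin T.N} (h : K ≠ K') {z : ℝ × ℝ} (hz : z ∈ refInterior) :
    T.F K z ∉ T.elem K' := by
  intro hmem
  have hin : T.F K z ∈ T.F K '' refSquare ∩ T.F K' '' refSquare :=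
    ⟨mem_image_of_mem _ (refInterior_subset hz), hmem⟩
  rcases T.conforming K K' h with h1 | ⟨a, a', -, h1⟩ | ⟨d, b, d', b', -, h1⟩
  · rw [h1] at hin; exact hin
  · rw [h1] at hin
    rw [T.injective K hin] at hz
    exact refVertex_notMem_refInterior a hz
  · rw [h1] at hin
    obtain ⟨_, ⟨s, -, rfl⟩, hs⟩ := hin
    rw [← T.injective K hs] at hz
    exact refEdge_notMem_refInterior d b s hz

/-- Element interiors do not meet the relative boundary of `Γ`: there, in graph coordinates, an
element would contain points on both sides of the Lipschitz curve bounding `Γ`. -/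
lemma image_refInterior_subset (hΩ : IsLipschitzPolyhedron Ω) (hΓ : IsLipschitzPiece Ω Γ)
    (K : Fin T.N) {z : ℝ × ℝ} (hz : z ∈ refInterior) : T.F K z ∈ Γ := by
  by_contra hnot
  have hcl : T.F K z ∈ closure Γ :=
    T.elem_subset_closure K (mem_image_of_mem _ (refInterior_subset hz))
  obtain ⟨U, hU, ρ, ζ, hyp, η, ⟨L, hL⟩, hη⟩ := hΓ.isLipschitz _ ⟨hcl, hnot⟩
  have hp := hyp.isPatch
  have hzV : T.F K z ∈ interior U := mem_interior_iff_mem_nhds.mpr hU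
  have hdet := hp.projDet_ne_zero hΩ.isOpen (T.injective K) (T.elem_subset_frontier hΓ K) hz hzV
  -- moving along `v` increases the first coordinate, in which `Γ` is a hypograph, and fixes the
  -- second one
  set v : ℝ × ℝ := (⟪vecB (T.F K), frameVec ρ 1⟫ / projDet ρ (T.F K),
    -⟪vecA (T.F K), frameVec ρ 1⟫ / projDet ρ (T.F K)) with hv
  obtain ⟨t, ⟨ht, htV⟩, ht0⟩ := (((eventually_line_mem hp.isOpen hz hzV v).filter_mono
    nhdsWithin_le_nhds).and (self_mem_nhdsWithin (a := (0 : ℝ)) (s := Ioi 0))).exists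
  have e0 : ρ (T.F K (z + t • v)) 0 = ρ (T.F K z) 0 + t := by
    have := gproj_affine_sub ρ (T.F K) (z + t • v) z 0
    simp only [hv, Prod.fst_add, Prod.smul_fst, Prod.snd_add, Prod.smul_snd, smul_eq_mul,
      add_sub_cancel_left] at this
    rw [← hv] at this
    rw [← sub_eq_iff_eq_add', this]
    field_simp
    rw [projDet]; ring
  have e1 : ρ (T.F K (z + t • v)) 1 = ρ (T.F K z) 1 := by
    have := gproj_affine_sub ρ (T.F K) (z + t • v) z 1
    simp only [hv, Prod.fst_add, Prod.smul_fst, Prod.snd_add, Prod.smul_snd, smul_eq_mul,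
      add_sub_cancel_left] at this
    rw [← hv] at this
    rw [← sub_eq_zero, this]
    ring
  have hx : η (ρ (T.F K z) 1) ≤ ρ (T.F K z) 0 := by
    rw [← not_lt, ← hη _ ⟨interior_subset hzV, hΓ.closure_subset_frontier hcl⟩]
    exact hnot
  have hρ := ρ.continuous
  have hηc := hL.continuous
  have hopen : IsOpen (interior U ∩ {y | η (ρ y 1) < ρ y 0}) :=
    isOpen_interior.inter (isOpen_lt (by fun_prop) (by fun_prop))
  have hmem : T.F K (z + t • v) ∈ closure Γ :=
    T.elem_subset_closure K (mem_image_of_mem _ (refInterior_subset ht))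
  have ht0' : 0 < t := ht0
  obtain ⟨y, ⟨hyU, hy⟩, hyΓ⟩ := mem_closure_iff.mp hmem _ hopen ⟨htV, by
    change η (ρ (T.F K (z + t • v)) 1) < ρ (T.F K (z + t • v)) 0
    rw [e0, e1]; linarith⟩
  exact absurd ((hη y ⟨interior_subset hyU, hΓ.subset_frontier hyΓ⟩).mp hyΓ)
    (not_lt.mpr (le_of_lt hy))

lemma volume_refSquare_diff : volume (refSquare \ refInterior) = 0 := by
  have h := ae_refInterior
  rw [ae_restrict_iff' measurableSet_refSquare] at h
  refine measure_mono_null (fun z hz => ?_) h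
  simpa [Set.mem_sdiff] using hz

lemma measure_image_diff (K : Fin T.N) :
    μHE[2] (T.F K '' (refSquare \ refInterior)) = 0 := by
  rw [measure_affine_image, volume_refSquare_diff, mul_zero]

lemma measurableSet_elem (K : Fin T.N) : MeasurableSet (T.elem K) :=
  (isCompact_elem (T.F K)).measurableSet

lemma aedisjoint_elem {K K' : Fin T.N} (h : K ≠ K') :
    AEDisjoint μHE[2] (T.elem K) (T.elem K') := by
  refine measure_mono_null ?_ (T.measure_image_diff K)
  rintro x ⟨⟨z, hz, rfl⟩, hx⟩
  exact mem_image_of_mem _ ⟨hz, fun hi => T.notMem_elem_of_ne h hi hx⟩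

/-- Surface measure on `Γ` is the sum of the surface measures of the elements. -/
lemma restrict_eq_sum (hΩ : IsLipschitzPolyhedron Ω) (hΓ : IsLipschitzPiece Ω Γ) :
    (μHE[2] : Measure E3).restrict Γ = Measure.sum fun K => μHE[2].restrict (T.elem K) := by
  have h1 : (Γ : Set E3) =ᵐ[μHE[2]] ⋃ K, T.elem K := by
    have hsub : (⋃ K, T.elem K) \ Γ ⊆ ⋃ K, T.F K '' (refSquare \ refInterior) := by
      rintro x ⟨hx, hxΓ⟩
      obtain ⟨K, z, hz, rfl⟩ := mem_iUnion.mp hx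
      exact mem_iUnion.mpr ⟨K, mem_image_of_mem _ ⟨hz, fun hi =>
        hxΓ (T.image_refInterior_subset hΩ hΓ K hi)⟩⟩
    have hsup : Γ ⊆ ⋃ K, T.elem K := by
      have := T.cover
      rw [show (⋃ K, T.elem K) = closure Γ from this]
      exact subset_closure
    refine hsup.eventuallyLE.antisymm ?_
    rw [ae_le_set]
    exact measure_mono_null hsub (measure_iUnion_null fun K => T.measure_image_diff K)
  rw [Measure.restrict_congr_set h1, Measure.restrict_iUnion_ae
    (fun K K' h => T.aedisjoint_elem h) fun K => (T.measurableSet_elem K).nullMeasurableSet]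

lemma lintegral_eq_sum (hΩ : IsLipschitzPolyhedron Ω) (hΓ : IsLipschitzPiece Ω Γ)
    (f : E3 → ℝ≥0∞) : ∫⁻ x in Γ, f x ∂μHE[2] =
      ∑ K, ENNReal.ofReal (jac (T.F K)) * ∫⁻ z in refSquare, f (T.F K z) := by
  rw [T.restrict_eq_sum hΩ hΓ, lintegral_sum_measure, tsum_fintype]
  exact Finset.sum_congr rfl fun K _ =>
    lintegral_affine_image (T.injective K) measurableSet_refSquare f

lemma integrableOn_iff (hΩ : IsLipschitzPolyhedron Ω) (hΓ : IsLipschitzPiece Ω Γ)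
    {E : Type*} [NormedAddCommGroup E] (f : E3 → E) : IntegrableOn f Γ μHE[2] ↔
      ∀ K, IntegrableOn (fun z => f (T.F K z)) refSquare := by
  rw [IntegrableOn, T.restrict_eq_sum hΩ hΓ, Measure.sum_fintype, integrable_finsetSum_measure]
  simp only [Finset.mem_univ, true_implies]
  exact forall_congr' fun K => integrableOn_affine_image_iff (T.injective K) measurableSet_refSquare f

lemma integral_eq_sum (hΩ : IsLipschitzPolyhedron Ω) (hΓ : IsLipschitzPiece Ω Γ) {f : E3 → ℝ}
    (hf : IntegrableOn f Γ μHE[2]) : ∫ x in Γ, f x ∂μHE[2] =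
      ∑ K, jac (T.F K) * ∫ z in refSquare, f (T.F K z) := by
  have h := (T.integrableOn_iff hΩ hΓ f).mp hf
  rw [T.restrict_eq_sum hΩ hΓ, Measure.sum_fintype,
    integral_finsetSum_measure (μ := fun K => μHE[2].restrict (T.elem K)) fun K _ =>
    (integrableOn_affine_image_iff (T.injective K) measurableSet_refSquare f).mpr (h K)]
  exact Finset.sum_congr rfl fun K _ =>
    integral_affine_image (T.injective K) measurableSet_refSquare f

lemma ae_iff (hΩ : IsLipschitzPolyhedron Ω) (hΓ : IsLipschitzPiece Ω Γ) (p : E3 → Prop) :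
    (∀ᵐ x ∂(μHE[2] : Measure E3).restrict Γ, p x) ↔
      ∀ K, ∀ᵐ z ∂(volume.restrict refSquare), p (T.F K z) := by
  rw [T.restrict_eq_sum hΩ hΓ, Measure.ae_sum_iff]
  exact forall_congr' fun K => ae_affine_image_iff (T.injective K) measurableSet_refSquare p

lemma aestronglyMeasurable (hΩ : IsLipschitzPolyhedron Ω) (hΓ : IsLipschitzPiece Ω Γ)
    {E : Type*} [NormedAddCommGroup E] {f : E3 → E}
    (hf : ∀ K, AEStronglyMeasurable (fun z => f (T.F K z)) (volume.restrict refSquare)) :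
    AEStronglyMeasurable f ((μHE[2] : Measure E3).restrict Γ) := by
  rw [T.restrict_eq_sum hΩ hΓ, aestronglyMeasurable_sum_measure_iff]
  exact fun K => aestronglyMeasurable_affine_image (T.injective K) measurableSet_refSquare f (hf K)

lemma diam_le_size (K : Fin T.N) : Metric.diam (T.elem K) ≤ T.size :=
  le_ciSup (f := fun K => Metric.diam (T.elem K)) (finite_range _).bddAbove K

lemma nonempty_index (hΓ : IsLipschitzPiece Ω Γ) : Nonempty (Fin T.N) := by
  obtain ⟨x, hx⟩ := hΓ.isConnected.nonempty
  have := T.cover.ge (subset_closure hx)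
  exact ⟨(mem_iUnion.mp this).choose⟩

lemma size_pos (hΓ : IsLipschitzPiece Ω Γ) : 0 < T.size := by
  obtain ⟨K⟩ := T.nonempty_index hΓ
  exact (diam_elem_pos (T.injective K)).trans_le (T.diam_le_size K)

lemma size_le_diam (hΩ : IsLipschitzPolyhedron Ω) (hΓ : IsLipschitzPiece Ω Γ) :
    T.size ≤ Metric.diam (frontier Ω) := by
  have := T.nonempty_index hΓ
  refine ciSup_le fun K => Metric.diam_mono (T.elem_subset_frontier hΓ K) ?_
  exact hΩ.isBounded.closure.subset frontier_subset_closure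

variable {T} {γ κ : ℝ}

lemma IsShapeRegular.diam_sq_le (h : T.IsShapeRegular γ) (K : Fin T.N) :
    Metric.diam (T.F K '' refSquare) ^ 2 ≤ max γ 1 * (4 * jac (T.F K)) := by
  have hJ := jac_pos (T.injective K)
  have h1 := h K
  rw [elem, measure_elem, ENNReal.toReal_ofReal (by positivity), div_le_iff₀ (by positivity)] at h1
  exact h1.trans (mul_le_mul_of_nonneg_right (le_max_left _ _) (by positivity))

lemma IsQuasiUniform.size_le (h : T.IsQuasiUniform κ) (K : Fin T.N) :
    T.size ≤ max κ 1 * Metric.diam (T.F K '' refSquare) :=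
  (h K).trans (mul_le_mul_of_nonneg_right (le_max_left _ _) Metric.diam_nonneg)

/-- The area density of every element is at least a multiple of `h²`. -/
lemma size_sq_le (h : T.IsShapeRegular γ) (h' : T.IsQuasiUniform κ) (hΓ : IsLipschitzPiece Ω Γ)
    (K : Fin T.N) : T.size ^ 2 ≤ max κ 1 ^ 2 * max γ 1 * (4 * jac (T.F K)) := by
  have h1 := pow_le_pow_left₀ (T.size_pos hΓ).le (h'.size_le K) 2
  rw [mul_pow] at h1
  refine h1.trans ?_
  rw [mul_assoc]
  exact mul_le_mul_of_nonneg_left (h.diam_sq_le K) (by positivity)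

open Classical in
/-- The number of elements meeting at a point is bounded by the number of planes containing `∂Ω`:
these elements have area comparable to `h²` and lie in a ball of radius `h`. -/
lemma exists_card_elem_le (hΩ : IsLipschitzPolyhedron Ω) (hΓ : IsLipschitzPiece Ω Γ) (γ κ : ℝ) :
    ∃ M : ℝ, 1 ≤ M ∧ ∀ T : QuadMesh Γ, T.IsShapeRegular γ → T.IsQuasiUniform κ → ∀ x : E3,
      ((Finset.univ.filter fun K => x ∈ T.elem K).card : ℝ) ≤ M := by
  obtain ⟨P, hP, hP0, hPc⟩ := hΩ.isPolyhedral
  set A : ℝ := max κ 1 ^ 2 * max γ 1 with hA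
  have hApos : 0 < A := by positivity
  refine ⟨max 1 (16 * hP.toFinset.card * A), le_max_left _ _, fun T h h' x => ?_⟩
  set s := Finset.univ.filter fun K => x ∈ T.elem K
  set r := T.size
  have hr : 0 < r := T.size_pos hΓ
  have hsub : (⋃ K ∈ s, T.elem K) ⊆
      ⋃ q ∈ hP.toFinset, {y | ⟪q.1, y⟫ = q.2} ∩ Metric.closedBall x r := by
    intro y hy
    simp only [mem_iUnion, exists_prop] at hy
    obtain ⟨K, hK, hyK⟩ := hy
    have hxK : x ∈ T.elem K := (Finset.mem_filter.mp hK).2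
    obtain ⟨q, hq, hyq⟩ := hPc y (T.elem_subset_frontier hΓ K hyK)
    simp only [mem_iUnion, exists_prop]
    exact ⟨q, hP.mem_toFinset.mpr hq, hyq, (Metric.dist_le_diam_of_mem
      (isCompact_elem (T.F K)).isBounded hyK hxK).trans (T.diam_le_size K)⟩
  have hle : μHE[2] (⋃ K ∈ s, T.elem K) ≤
      ENNReal.ofReal (hP.toFinset.card * (16 * r ^ 2)) := by
    refine (measure_mono hsub).trans ((measure_biUnion_finset_le _ _).trans ?_)
    refine (Finset.sum_le_sum fun q hq => measure_plane_inter_closedBall_le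
      (hP0 q (hP.mem_toFinset.mp hq)) q.2 x r).trans ?_
    rw [Finset.sum_const, nsmul_eq_mul, ENNReal.ofReal_mul (p := (hP.toFinset.card : ℝ)) (by positivity),
      ENNReal.ofReal_natCast]
  have hge : ENNReal.ofReal (s.card * (r ^ 2 / A)) ≤ μHE[2] (⋃ K ∈ s, T.elem K) := by
    rw [measure_biUnion_finset₀ (fun K _ K' _ hne => T.aedisjoint_elem hne)
      fun K _ => (T.measurableSet_elem K).nullMeasurableSet,
      ENNReal.ofReal_mul (by positivity), ENNReal.ofReal_natCast, ← nsmul_eq_mul,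
      ← Finset.sum_const]
    refine Finset.sum_le_sum fun K _ => ?_
    rw [elem, measure_elem]
    refine ENNReal.ofReal_le_ofReal ?_
    rw [div_le_iff₀ hApos, mul_comm]
    exact size_sq_le h h' hΓ K
  have hfin := (ENNReal.ofReal_le_ofReal_iff (by positivity)).mp (hge.trans hle)
  refine le_trans ?_ (le_max_right _ _)
  have hr2 : 0 < r ^ 2 / A := by positivity
  refine le_of_mul_le_mul_right (hfin.trans (le_of_eq ?_)) hr2
  field_simp

end QuadMesh
end Mesh

/-! ### The global basis on the elements -/

section Basis

variable {Γ : Set E3}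

lemma shape2D_refVertex (a a' : Fin 2 × Fin 2) :
    shape2D a.1 a.2 (refVertex a') = if a = a' then 1 else 0 := by
  simp only [shape2D, refVertex, shape1D_fin_endpt, Prod.ext_iff]
  split_ifs <;> simp_all

lemma edgeShape_refVertex (d b : Fin 2) (j : ℕ) (a : Fin 2 × Fin 2) :
    edgeShape d b (j + 2) (refVertex a) = 0 := by
  simp only [edgeShape, refVertex]
  split_ifs <;> simp [shape2D, shape1D_endpt]

lemma edgeShape_refEdge_self (d b : Fin 2) (j : ℕ) (s : ℝ) :
    edgeShape d b (j + 2) (refEdge d b s) = shape1D (j + 2) s := by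
  simp only [edgeShape, refEdge]
  split_ifs <;> simp [shape2D, shape1D_fin_endpt]

lemma edgeShape_refEdge_of_ne {d b d' b' : Fin 2} (h : (d', b') ≠ (d, b)) (j : ℕ) (s : ℝ) :
    edgeShape d' b' (j + 2) (refEdge d b s) = 0 := by
  by_cases hd : d' = d
  · have hb : b' ≠ b := fun hb => h (by rw [hd, hb])
    simp only [edgeShape, refEdge, hd]
    split_ifs <;> simp [shape2D, shape1D_fin_endpt, hb]
  · simp only [edgeShape, refEdge]
    split_ifs with h1 h2 h2
    · exact absurd (h1.trans h2.symm) hd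
    · simp [shape2D, shape1D_endpt]
    · simp [shape2D, shape1D_endpt]
    · exact absurd (by omega) hd

lemma shape2D_bubble_refVertex (i j : ℕ) (a : Fin 2 × Fin 2) :
    shape2D (i + 2) (j + 2) (refVertex a) = 0 := by
  simp [shape2D, refVertex, shape1D_endpt]

lemma shape2D_bubble_refEdge (i j : ℕ) (d b : Fin 2) (s : ℝ) :
    shape2D (i + 2) (j + 2) (refEdge d b s) = 0 := by
  simp only [refEdge]
  split_ifs <;> simp [shape2D, shape1D_endpt]

lemma affine_refEdge (F : ℝ × ℝ →ᵃ[ℝ] E3) (d b : Fin 2) (s : ℝ) : F (refEdge d b s) =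
    ((1 - s) / 2) • F (refEdge d b (-1)) + ((1 + s) / 2) • F (refEdge d b 1) := by
  rw [affine_apply F (refEdge d b s), affine_apply F (refEdge d b (-1)),
    affine_apply F (refEdge d b 1)]
  simp only [refEdge]
  split_ifs <;> module

lemma refEdge_injective (d b : Fin 2) : Function.Injective (refEdge d b) := by
  intro s t h
  simp only [refEdge] at h
  split_ifs at h <;> simp_all

namespace QuadMesh

variable {T : QuadMesh Γ}

/-- The sign of an edge function of degree `j + 2` on the edge `refEdge d b` of `K`. -/
def edgeSign (o : T.Orientation) (K : Fin T.N) (d b : Fin 2) (j : ℕ) : ℝ :=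
  open Classical in
  if o.start (T.edge K d b) = T.F K (refEdge d b (-1)) then 1 else (-1) ^ (j + 2)

lemma edgeSign_sq (o : T.Orientation) (K : Fin T.N) (d b : Fin 2) (j : ℕ) :
    edgeSign o K d b j ^ 2 = 1 := by
  unfold edgeSign
  split_ifs
  · norm_num
  · rw [← pow_mul, mul_comm, pow_mul]; norm_num

section LocalValues

open Classical

variable (o : T.Orientation) {p : ℕ} (K : Fin T.N)

lemma localShape_refVertex (δ : T.Dof p) (a : Fin 2 × Fin 2) :
    localShape o K δ (refVertex a) =
      match δ with
      | .inl z => if T.F K (refVertex a) = z then 1 else 0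
      | .inr _ => 0 := by
  match δ with
  | .inl z =>
    simp only [localShape, shape2D_refVertex]
    rw [Finset.sum_eq_single a]
    · simp
    · intro b _ hb; simp [hb]
    · simp
  | .inr (.inl (e, j)) => simp [localShape, edgeShape_refVertex]
  | .inr (.inr (K', i, j)) => simp [localShape, shape2D_bubble_refVertex]

lemma localShape_refEdge (δ : T.Dof p) (d b : Fin 2) (s : ℝ) :
    localShape o K δ (refEdge d b s) =
      match δ with
      | .inl z => (if T.F K (refEdge d b (-1)) = z then (1 - s) / 2 else 0) +
          (if T.F K (refEdge d b 1) = z then (1 + s) / 2 else 0)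
      | .inr (.inl (e, j)) =>
          if T.edge K d b = e then edgeSign o K d b j * shape1D (j + 2) s else 0
      | .inr (.inr _) => 0 := by
  match δ with
  | .inl z =>
    simp only [localShape, Fintype.sum_prod_type, Fin.sum_univ_two, shape2D, refVertex, refEdge]
    fin_cases d <;> fin_cases b <;> simp [shape1D, endpt]
  | .inr (.inl (e, j)) =>
    simp only [localShape]
    rw [Finset.sum_eq_single (d, b)]
    · simp only [edgeShape_refEdge_self]
      split_ifs with h1 h2
      · rw [edgeSign, h1, if_pos h2]
      · rw [edgeSign, h1, if_neg h2]
      · rfl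
    · intro q _ hq
      rw [edgeShape_refEdge_of_ne hq]
      simp
    · simp
  | .inr (.inr (K', i, j)) => simp [localShape, shape2D_bubble_refEdge]

end LocalValues

/-- Two parametrized edges with the same image agree up to reversal. -/
lemma refEdge_match {K K' : Fin T.N} {d b d' b' : Fin 2} (h : T.edge K d b = T.edge K' d' b')
    {s s' : ℝ} (hs : T.F K (refEdge d b s) = T.F K' (refEdge d' b' s')) :
    (T.F K (refEdge d b (-1)) = T.F K' (refEdge d' b' (-1)) ∧
      T.F K (refEdge d b 1) = T.F K' (refEdge d' b' 1) ∧ s' = s) ∨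
    (T.F K (refEdge d b (-1)) = T.F K' (refEdge d' b' 1) ∧
      T.F K (refEdge d b 1) = T.F K' (refEdge d' b' (-1)) ∧ s' = -s) := by
  have hl : (-1 : ℝ) ∈ Icc (-1 : ℝ) 1 := by norm_num
  have hr : (1 : ℝ) ∈ Icc (-1 : ℝ) 1 := by norm_num
  have hinj : Function.Injective fun s => T.F K (refEdge d b s) :=
    (T.injective K).comp (refEdge_injective d b)
  obtain ⟨_, ⟨s1, ⟨h1l, h1r⟩, rfl⟩, e1⟩ :=
    h.ge (mem_image_of_mem (T.F K') (mem_image_of_mem (refEdge d' b') hl))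
  obtain ⟨_, ⟨s2, ⟨h2l, h2r⟩, rfl⟩, e2⟩ :=
    h.ge (mem_image_of_mem (T.F K') (mem_image_of_mem (refEdge d' b') hr))
  obtain ⟨_, ⟨t1, ⟨ht1l, ht1r⟩, rfl⟩, f1⟩ :=
    h.le (mem_image_of_mem (T.F K) (mem_image_of_mem (refEdge d b) hl))
  obtain ⟨_, ⟨t2, ⟨ht2l, ht2r⟩, rfl⟩, f2⟩ :=
    h.le (mem_image_of_mem (T.F K) (mem_image_of_mem (refEdge d b) hr))
  have hcomp : ∀ t : ℝ, T.F K' (refEdge d' b' t) =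
      T.F K (refEdge d b ((1 - t) / 2 * s1 + (1 + t) / 2 * s2)) := by
    intro t
    rw [affine_refEdge, ← e1, ← e2, affine_refEdge _ _ _ s1, affine_refEdge _ _ _ s2,
      affine_refEdge _ _ _ (_ + _)]
    module
  rw [hcomp] at f1 f2 hs
  have g1 := hinj f1
  have g2 := hinj f2
  have g3 := hinj hs
  -- the affine reparametrization maps `[-1, 1]` onto itself, so it maps end points to end points
  have hm : (1 - t1) / 2 * (s1 + 1) = 0 ∧ (1 + t1) / 2 * (s2 + 1) = 0 := by
    have a1 : 0 ≤ (1 - t1) / 2 * (s1 + 1) := mul_nonneg (by linarith) (by linarith)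
    have a2 : 0 ≤ (1 + t1) / 2 * (s2 + 1) := mul_nonneg (by linarith) (by linarith)
    constructor <;> linarith
  have hp : (1 - t2) / 2 * (1 - s1) = 0 ∧ (1 + t2) / 2 * (1 - s2) = 0 := by
    have a1 : 0 ≤ (1 - t2) / 2 * (1 - s1) := mul_nonneg (by linarith) (by linarith)
    have a2 : 0 ≤ (1 + t2) / 2 * (1 - s2) := mul_nonneg (by linarith) (by linarith)
    constructor <;> linarith
  rcases eq_or_ne s1 (-1) with hs1 | hs1
  · have hs2 : s2 = 1 := by
      subst hs1
      have := hp.1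
      have ht : t2 = 1 := by linarith
      subst ht
      linarith [hp.2]
    subst hs1 hs2
    refine Or.inl ⟨e1, e2, ?_⟩
    linarith
  · have ht : t1 = 1 := by
      rcases mul_eq_zero.mp hm.1 with h0 | h0
      · linarith
      · exact absurd (by linarith) hs1
    subst ht
    have hs2 : s2 = -1 := by linarith [hm.2]
    subst hs2
    have ht2 : t2 = -1 := by linarith [hp.2]
    subst ht2
    have hs1' : s1 = 1 := by linarith [hp.1]
    subst hs1'
    refine Or.inr ⟨e2, e1, ?_⟩
    linarith

/-- The pull-backs of the basis functions match at common points of elements. -/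
lemma localShape_eq_of_apply_eq (o : T.Orientation) {p : ℕ} (δ : T.Dof p) {K K' : Fin T.N}
    {z z' : ℝ × ℝ} (hz : z ∈ refSquare) (hz' : z' ∈ refSquare) (h : T.F K z = T.F K' z') :
    localShape o K δ z = localShape o K' δ z' := by
  rcases eq_or_ne K K' with rfl | hne
  · rw [T.injective K h]
  have hin : T.F K z ∈ T.F K '' refSquare ∩ T.F K' '' refSquare :=
    ⟨mem_image_of_mem _ hz, h ▸ mem_image_of_mem _ hz'⟩
  rcases T.conforming K K' hne with h1 | ⟨a, a', ha, h1⟩ | ⟨d, b, d', b', he, h1⟩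
  · rw [h1] at hin; exact hin.elim
  · rw [h1] at hin
    have hza : z = refVertex a := T.injective K hin
    have hza' : z' = refVertex a' := by
      apply T.injective K'
      rw [← h, hza, ha]
    rw [hza, hza', localShape_refVertex, localShape_refVertex, ha]
  · rw [h1] at hin
    obtain ⟨_, ⟨s, hs, rfl⟩, hzs⟩ := hin
    have hin' : T.F K z ∈ T.F K' '' (refEdge d' b' '' Icc (-1) 1) := by
      rw [← he, ← hzs]; exact mem_image_of_mem _ (mem_image_of_mem _ hs)
    obtain ⟨_, ⟨s', hs', rfl⟩, hzs'⟩ := hin'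
    rw [← T.injective K hzs, ← T.injective K' (hzs'.trans h), localShape_refEdge,
      localShape_refEdge]
    have hedge : T.edge K d b = T.edge K' d' b' := he
    have hPQ : T.F K (refEdge d b (-1)) ≠ T.F K (refEdge d b 1) := fun h' => by
      have := refEdge_injective d b (T.injective K h')
      norm_num at this
    rcases refEdge_match hedge (hzs.trans hzs'.symm) with ⟨m1, m2, rfl⟩ | ⟨m1, m2, rfl⟩
    · match δ with
      | .inl z => simp only [m1, m2]
      | .inr (.inl (e, j)) => simp only [edgeSign, hedge, m1]
      | .inr (.inr _) => rfl
    · match δ with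
      | .inl z => simp only [m1, m2]; rw [add_comm]; ring_nf
      | .inr (.inl (e, j)) =>
        -- the edge is oriented along exactly one of its two parametrizations, and the sign
        -- `(-1)^j` makes up for the parity of the shape function
        simp only [edgeSign, hedge, shape1D_neg]
        have hst := o.start_mem K d b
        rw [hedge] at hst
        rw [← m2]
        have hone : ((-1 : ℝ) ^ (j : ℕ)) * (-1) ^ (j : ℕ) = 1 := by rw [← mul_pow]; norm_num
        rcases hst with hst | hst
        · rw [hst, if_pos rfl, if_neg hPQ]
          split_ifs
          · linear_combination (-(shape1D (j + 2) s)) * hone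
          · rfl
        · rw [hst, if_pos rfl, if_neg hPQ.symm]
          split_ifs
          · ring
          · rfl
      | .inr (.inr _) => rfl

/-- The choice of an element in the definition of `basisFun` does not matter. -/
lemma basisFun_apply (o : T.Orientation) {p : ℕ} (δ : T.Dof p) (K : Fin T.N) {z : ℝ × ℝ}
    (hz : z ∈ refSquare) : basisFun o δ (T.F K z) = localShape o K δ z := by
  have h : ∃ K', T.F K z ∈ T.elem K' := ⟨K, mem_image_of_mem _ hz⟩
  rw [basisFun, dif_pos h]
  obtain ⟨z', hz', hzz⟩ := h.choose_spec
  have hinv : Function.invFun (T.F h.choose) (T.F K z) = z' := by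
    nth_rewrite 2 [← hzz]
    exact Function.leftInverse_invFun (T.injective _) z'
  rw [hinv]
  exact localShape_eq_of_apply_eq o δ hz' hz hzz

end QuadMesh
end Basis

/-! ### Local and global coefficients -/

section Coefficients

open Classical

variable {Γ : Set E3}

lemma sum_subtype_ite {α : Type*} (s : Finset α) (v : α) (g : s → ℝ)
    {_ : ∀ z : s, Decidable (v = z)} [Decidable (v ∈ s)] :
    ∑ z : s, (if v = z then g z else 0) = if h : v ∈ s then g ⟨v, h⟩ else 0 := by
  split_ifs with h
  · rw [Finset.sum_eq_single ⟨v, h⟩]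
    · simp
    · rintro ⟨w, hw⟩ _ hne
      rw [if_neg]
      rintro rfl
      exact hne rfl
    · simp
  · refine Finset.sum_eq_zero fun z _ => ?_
    rw [if_neg]
    rintro rfl
    exact h z.2

lemma sum_dite_mem_eq {ι α : Type*} [Fintype ι] (s : Finset α) (f : ι → α) (g : s → ℝ)
    {_ : ∀ i, Decidable (f i ∈ s)} {_ : ∀ z : s, DecidablePred fun i => f i = z} :
    ∑ i, (if h : f i ∈ s then g ⟨f i, h⟩ else 0) =
      ∑ z : s, ((Finset.univ.filter fun i => f i = z).card : ℝ) * g z := by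
  have h : ∀ i, (if h : f i ∈ s then g ⟨f i, h⟩ else 0) =
      ∑ z : s, (if f i = z then g z else 0) := fun i => (sum_subtype_ite s (f i) g).symm
  simp_rw [h]
  rw [Finset.sum_comm]
  refine Finset.sum_congr rfl fun z _ => ?_
  rw [Finset.sum_ite, Finset.sum_const, Finset.sum_const_zero, add_zero, nsmul_eq_mul]

namespace QuadMesh

variable {T : QuadMesh Γ}

/-- The coefficients of `∑ c_δ Φ_δ` on the element `K` with respect to the shape functions. -/
def locCoeff (o : T.Orientation) {p : ℕ} (c : T.Dof p → ℝ) (K : Fin T.N) :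
    Fin 2 ⊕ Fin (p - 1) → Fin 2 ⊕ Fin (p - 1) → ℝ
  | .inl a, .inl b =>
      if h : T.F K (refVertex (a, b)) ∈ T.vertices then c (.inl ⟨_, h⟩) else 0
  | .inr j, .inl b =>
      if h : T.edge K 0 b ∈ T.edges then
        edgeSign o K 0 b j * c (.inr (.inl (⟨_, h⟩, j))) else 0
  | .inl b, .inr j =>
      if h : T.edge K 1 b ∈ T.edges then
        edgeSign o K 1 b j * c (.inr (.inl (⟨_, h⟩, j))) else 0
  | .inr i, .inr j => c (.inr (.inr (K, i, j)))

variable (o : T.Orientation) {p : ℕ} (c : T.Dof p → ℝ)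

/-- The function `∑ c_δ Φ_δ` on the element `K`, pulled back to the reference square. -/
def locFun (K : Fin T.N) : ℝ × ℝ → ℝ := biComb sh sh (locCoeff o c K)

lemma sum_localShape (K : Fin T.N) (z : ℝ × ℝ) :
    ∑ δ, c δ * localShape o K δ z = locFun o c K z := by
  have hs : ∀ k l : Fin 2 ⊕ Fin (p - 1), (sh k).eval z.1 * (sh l).eval z.2 =
      shape2D (shapeIdx k) (shapeIdx l) z := fun k l => by
    simp only [sh, shape2D, shape1D_eq_eval]
  simp only [locFun, biComb, hs]
  rw [Fintype.sum_sum_type, Fintype.sum_sum_type, Fintype.sum_sum_type]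
  simp only [Fintype.sum_sum_type, Finset.sum_add_distrib]
  have hV : ∑ v : T.vertices, c (.inl v) * localShape o K (.inl v : T.Dof p) z =
      ∑ a : Fin 2, ∑ b : Fin 2, locCoeff o c K (.inl a) (.inl b) *
        shape2D (shapeIdx (.inl a : Fin 2 ⊕ Fin (p - 1)))
          (shapeIdx (.inl b : Fin 2 ⊕ Fin (p - 1))) z := by
    simp only [localShape, Finset.mul_sum]
    rw [Finset.sum_comm, Fintype.sum_prod_type]
    refine Finset.sum_congr rfl fun a _ => Finset.sum_congr rfl fun b _ => ?_
    simp only [mul_ite, mul_zero]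
    rw [sum_subtype_ite T.vertices (T.F K (refVertex (a, b)))
      (fun v => c (.inl v) * shape2D a b z)]
    simp only [locCoeff, shapeIdx, dite_mul, zero_mul]
  have hE : ∑ e : T.edges × Fin (p - 1), c (.inr (.inl e)) *
        localShape o K (.inr (.inl e) : T.Dof p) z =
      ∑ a : Fin 2, ∑ j : Fin (p - 1), locCoeff o c K (.inl a) (.inr j) *
        shape2D (shapeIdx (.inl a : Fin 2 ⊕ Fin (p - 1)))
          (shapeIdx (.inr j : Fin 2 ⊕ Fin (p - 1))) z +
      ∑ j : Fin (p - 1), ∑ b : Fin 2, locCoeff o c K (.inr j) (.inl b) *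
        shape2D (shapeIdx (.inr j : Fin 2 ⊕ Fin (p - 1)))
          (shapeIdx (.inl b : Fin 2 ⊕ Fin (p - 1))) z := by
    have h1 : ∀ (d b : Fin 2) (j : Fin (p - 1)),
        ∑ e : T.edges, c (.inr (.inl (e, j))) * (if T.edge K d b = e then
          (if o.start e = T.F K (refEdge d b (-1)) then 1 else (-1) ^ (j.val + 2)) *
            edgeShape d b (j.val + 2) z else 0) =
        (if h : T.edge K d b ∈ T.edges then
          edgeSign o K d b j * c (.inr (.inl (⟨_, h⟩, j))) else 0) *
            edgeShape d b (j.val + 2) z := by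
      intro d b j
      simp only [mul_ite, mul_zero]
      rw [sum_subtype_ite T.edges (T.edge K d b) (fun e => c (.inr (.inl (e, j))) *
        ((if o.start e = T.F K (refEdge d b (-1)) then 1 else (-1) ^ (j.val + 2)) *
          edgeShape d b (j.val + 2) z))]
      split_ifs <;> simp_all [edgeSign]
      ring
    rw [Fintype.sum_prod_type, Finset.sum_comm]
    have h2 : ∀ j : Fin (p - 1), ∑ e : T.edges, c (.inr (.inl (e, j))) *
        localShape o K (.inr (.inl (e, j)) : T.Dof p) z =
        ∑ b : Fin 2, locCoeff o c K (.inr j) (.inl b) * shape2D (j.val + 2) b z +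
        ∑ a : Fin 2, locCoeff o c K (.inl a) (.inr j) * shape2D a (j.val + 2) z := by
      intro j
      simp only [localShape, Finset.mul_sum]
      rw [Finset.sum_comm, Fintype.sum_prod_type, Fin.sum_univ_two]
      simp only [h1]
      simp [locCoeff, edgeShape]
    simp only [h2, shapeIdx, Finset.sum_add_distrib]
    rw [Finset.sum_comm (s := (Finset.univ : Finset (Fin 2)))]
    ring
  have hB : ∑ q : Fin T.N × Fin (p - 1) × Fin (p - 1), c (.inr (.inr q)) *
        localShape o K (.inr (.inr q) : T.Dof p) z =
      ∑ i : Fin (p - 1), ∑ j : Fin (p - 1), locCoeff o c K (.inr i) (.inr j) *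
        shape2D (shapeIdx (.inr i : Fin 2 ⊕ Fin (p - 1)))
          (shapeIdx (.inr j : Fin 2 ⊕ Fin (p - 1))) z := by
    rw [Fintype.sum_prod_type, Finset.sum_eq_single K]
    · rw [Fintype.sum_prod_type]
      simp [localShape, locCoeff, shapeIdx]
    · intro K' _ hne
      simp [localShape, hne]
    · simp
  rw [hV, hE, hB]
  ring

/-- The squares of the local coefficients, sorted by vertices, edges and the interior. -/
lemma coeffSq_locCoeff (K : Fin T.N) : coeffSq (locCoeff o c K) =
    ∑ a : Fin 2 × Fin 2,
      (if h : T.F K (refVertex a) ∈ T.vertices then c (.inl ⟨_, h⟩) ^ 2 else 0) +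
    (∑ j, ∑ q : Fin 2 × Fin 2,
      (if h : T.edge K q.1 q.2 ∈ T.edges then c (.inr (.inl (⟨_, h⟩, j))) ^ 2 else 0) +
    ∑ q, c (.inr (.inr (K, q))) ^ 2) := by
  have h1 : ∀ d b (j : Fin (p - 1)), (if h : T.edge K d b ∈ T.edges then
      edgeSign o K d b j * c (.inr (.inl (⟨_, h⟩, j))) else 0) ^ 2 =
      if h : T.edge K d b ∈ T.edges then c (.inr (.inl (⟨_, h⟩, j))) ^ 2 else 0 := by
    intro d b j
    split_ifs
    · rw [mul_pow, edgeSign_sq, one_mul]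
    · norm_num
  have h2 : ∀ a, (if h : T.F K (refVertex a) ∈ T.vertices then c (.inl ⟨_, h⟩) else 0) ^ 2 =
      if h : T.F K (refVertex a) ∈ T.vertices then c (.inl ⟨_, h⟩) ^ 2 else 0 := by
    intro a
    split_ifs <;> norm_num
  simp only [coeffSq, Fintype.sum_sum_type, Fintype.sum_prod_type, Finset.sum_add_distrib,
    locCoeff, h1, h2]
  rw [Finset.sum_comm (s := (Finset.univ : Finset (Fin (p - 1)))) (t := (Finset.univ : Finset (Fin 2)))
    (f := fun x i => if h : T.edge K 0 i ∈ T.edges then c (.inr (.inl (⟨_, h⟩, x))) ^ 2 else 0)]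
  simp only [Fin.sum_univ_two, Finset.sum_add_distrib]
  ring

lemma sum_coeffSq_locCoeff : ∑ K, coeffSq (locCoeff o c K) =
    ∑ z : T.vertices, ((Finset.univ.filter fun q : Fin T.N × Fin 2 × Fin 2 =>
      T.F q.1 (refVertex q.2) = z).card : ℝ) * c (.inl z) ^ 2 +
    (∑ e : T.edges × Fin (p - 1), ((Finset.univ.filter fun q : Fin T.N × Fin 2 × Fin 2 =>
      T.edge q.1 q.2.1 q.2.2 = e.1).card : ℝ) * c (.inr (.inl e)) ^ 2 +
    ∑ q, c (.inr (.inr q)) ^ 2) := by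
  simp only [coeffSq_locCoeff, Finset.sum_add_distrib]
  congr 1
  · rw [← sum_dite_mem_eq T.vertices (fun q : Fin T.N × Fin 2 × Fin 2 => T.F q.1 (refVertex q.2))
      (fun z => c (.inl z) ^ 2), Fintype.sum_prod_type]
  congr 1
  · rw [Finset.sum_comm, Fintype.sum_prod_type,
      Finset.sum_comm (s := (Finset.univ : Finset T.edges))]
    refine Finset.sum_congr rfl fun j _ => ?_
    simp only
    rw [← sum_dite_mem_eq T.edges (fun q : Fin T.N × Fin 2 × Fin 2 => T.edge q.1 q.2.1 q.2.2)
      (fun e => c (.inr (.inl (e, j))) ^ 2), Fintype.sum_prod_type]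
  · rw [Fintype.sum_prod_type]

/-- Each degree of freedom occurs as a local coefficient of at least one element. -/
lemma sum_sq_le_sum_coeffSq : ∑ δ, c δ ^ 2 ≤ ∑ K, coeffSq (locCoeff o c K) := by
  rw [sum_coeffSq_locCoeff, Fintype.sum_sum_type, Fintype.sum_sum_type]
  refine add_le_add (Finset.sum_le_sum fun z _ => ?_)
    (add_le_add_left (Finset.sum_le_sum fun e _ => ?_) _)
  · refine le_mul_of_one_le_left (sq_nonneg _) ?_
    rw [Nat.one_le_cast, Nat.one_le_iff_ne_zero, ← Nat.pos_iff_ne_zero, Finset.card_pos]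
    obtain ⟨q, -, hq⟩ := Finset.mem_image.mp (Finset.mem_filter.mp z.2).1
    exact ⟨q, by simpa using hq⟩
  · refine le_mul_of_one_le_left (sq_nonneg _) ?_
    rw [Nat.one_le_cast, Nat.one_le_iff_ne_zero, ← Nat.pos_iff_ne_zero, Finset.card_pos]
    obtain ⟨q, -, hq⟩ := Finset.mem_image.mp (Finset.mem_filter.mp e.1.2).1
    exact ⟨q, by simpa using hq⟩

/-- A degree of freedom belonging to a vertex or an edge occurs at most four times in each of the at
most `M` elements that contain the vertex or the midpoint of the edge. -/
lemma sum_coeffSq_le {M : ℝ} (hM1 : 1 ≤ M)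
    (hM : ∀ x : E3, ((Finset.univ.filter fun K => x ∈ T.elem K).card : ℝ) ≤ M) :
    ∑ K, coeffSq (locCoeff o c K) ≤ 4 * M * ∑ δ, c δ ^ 2 := by
  have hcount : ∀ (s : Finset (Fin T.N × Fin 2 × Fin 2)) (x : E3),
      (∀ q ∈ s, x ∈ T.elem q.1) → (s.card : ℝ) ≤ 4 * M := by
    intro s x hs
    have hsub : s ⊆
        (Finset.univ.filter fun K => x ∈ T.elem K) ×ˢ (Finset.univ : Finset (Fin 2 × Fin 2)) := by
      intro q hq
      simp only [Finset.mem_product, Finset.mem_filter, Finset.mem_univ, true_and, and_true]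
      exact hs q hq
    have hle := Finset.card_le_card hsub
    rw [Finset.card_product] at hle
    have h4 : (Finset.univ : Finset (Fin 2 × Fin 2)).card = 4 := rfl
    rw [h4] at hle
    have : (s.card : ℝ) ≤ (Finset.univ.filter fun K => x ∈ T.elem K).card * 4 := by
      exact_mod_cast hle
    linarith [hM x]
  rw [sum_coeffSq_locCoeff, Fintype.sum_sum_type, Fintype.sum_sum_type, mul_add, mul_add]
  simp only [Finset.mul_sum]
  refine add_le_add (Finset.sum_le_sum fun z _ => ?_)
    (add_le_add (Finset.sum_le_sum fun e _ => ?_) (Finset.sum_le_sum fun q _ => ?_))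
  · refine mul_le_mul_of_nonneg_right (hcount _ z fun q hq => ?_) (sq_nonneg _)
    rw [← (Finset.mem_filter.mp hq).2]
    exact mem_image_of_mem _ (refVertex_mem_refSquare _)
  · refine mul_le_mul_of_nonneg_right ?_ (sq_nonneg _)
    obtain ⟨q₀, -, hq₀⟩ := Finset.mem_image.mp (Finset.mem_filter.mp e.1.2).1
    refine hcount _ (T.F q₀.1 (refEdge q₀.2.1 q₀.2.2 0)) fun q hq => ?_
    have hmem : T.F q₀.1 (refEdge q₀.2.1 q₀.2.2 0) ∈ T.edge q.1 q.2.1 q.2.2 := by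
      rw [(Finset.mem_filter.mp hq).2, ← hq₀]
      exact mem_image_of_mem _ (mem_image_of_mem _ (by norm_num))
    obtain ⟨_, ⟨s, hs, rfl⟩, h⟩ := hmem
    rw [← h]
    exact mem_image_of_mem _ (refEdge_mem_refSquare _ _ hs)
  · exact le_mul_of_one_le_left (sq_nonneg _) (by linarith)

end QuadMesh
end Coefficients

/-! ### Stokes' theorem on the mesh, inside a patch -/

section Patch

open Filter Topology

variable {Ω Γ V S : Set E3} {ρ : E3 ≃ᵃⁱ[ℝ] E3} {ζ : ℝ × ℝ → ℝ}

/-- The graph map of `ζ` in the coordinates `ρ`. -/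
def graphPt (ρ : E3 ≃ᵃⁱ[ℝ] E3) (ζ : ℝ × ℝ → ℝ) (q : ℝ × ℝ) : E3 := gpoint ρ q (ζ q)

lemma gproj_graphPt (q : ℝ × ℝ) : gproj ρ (graphPt ρ ζ q) = q := gproj_gpoint ρ q _

lemma IsPatch.graphPt_gproj (h : IsPatch Ω V ρ ζ) (hΩ : IsOpen Ω) {y : E3} (hy : y ∈ V)
    (hyf : y ∈ frontier Ω) : graphPt ρ ζ (gproj ρ y) = y := by
  rw [graphPt, ← (h.mem_frontier_iff hΩ hy).mp hyf, gpoint_gproj]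

lemma IsPatch.graphPt_mem_frontier (h : IsPatch Ω V ρ ζ) (hΩ : IsOpen Ω) {q : ℝ × ℝ}
    (hq : graphPt ρ ζ q ∈ V) : graphPt ρ ζ q ∈ frontier Ω := by
  rw [h.mem_frontier_iff hΩ hq, gproj_graphPt, graphPt, rho_gpoint]
  simp

lemma dist_gpoint_le (ρ : E3 ≃ᵃⁱ[ℝ] E3) (p q : ℝ × ℝ) (r t : ℝ) :
    dist (gpoint ρ p r) (gpoint ρ q t) ≤ 2 * dist p q + dist r t := by
  rw [gpoint, gpoint, ρ.symm.dist_map, EuclideanSpace.dist_eq]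
  refine Real.sqrt_le_iff.mpr ⟨by positivity, ?_⟩
  have h1 : dist p.1 q.1 ≤ dist p q := by rw [Prod.dist_eq]; exact le_max_left _ _
  have h2 : dist p.2 q.2 ≤ dist p q := by rw [Prod.dist_eq]; exact le_max_right _ _
  simp only [Fin.sum_univ_three]
  simp only [Matrix.cons_val_zero, Matrix.cons_val_one, Matrix.cons_val]
  nlinarith [dist_nonneg (x := p.1) (y := q.1), dist_nonneg (x := p.2) (y := q.2),
    dist_nonneg (x := r) (y := t), dist_nonneg (x := p) (y := q)]

lemma IsPatch.exists_lipschitzWith_graphPt (h : IsPatch Ω V ρ ζ) :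
    ∃ L : ℝ≥0, LipschitzWith L (graphPt ρ ζ) := by
  obtain ⟨L, hL⟩ := h.lipschitz
  refine ⟨2 + L, LipschitzWith.of_dist_le_mul fun p q => ?_⟩
  have h1 := dist_gpoint_le ρ p q (ζ p) (ζ q)
  have h2 := hL.dist_le_mul p q
  push_cast
  unfold graphPt
  linarith

namespace QuadMesh

variable (T : QuadMesh Γ)

/-- Close to a point `x` of `Γ`, each boundary point shares an element with `x`. -/
lemma eventually_exists_elem (hΓ : IsLipschitzPiece Ω Γ) {x : E3} (hx : x ∈ Γ) :
    ∀ᶠ y in 𝓝 x, y ∈ frontier Ω → ∃ K, x ∈ T.elem K ∧ y ∈ T.elem K := by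
  obtain ⟨O, hO, rfl⟩ := hΓ.isRelOpen
  have h1 : ∀ᶠ y in 𝓝 x, ∀ K, y ∈ T.elem K → x ∈ T.elem K := by
    rw [eventually_all]
    intro K
    by_cases hK : x ∈ T.elem K
    · exact Eventually.of_forall fun _ _ => hK
    · filter_upwards [(isCompact_elem (T.F K)).isClosed.isOpen_compl.mem_nhds hK] with y hy hy'
      exact absurd hy' hy
  filter_upwards [h1, hO.mem_nhds hx.1] with y hy hyO hyf
  have hy' : y ∈ ⋃ K, T.F K '' refSquare := by
    rw [T.cover]
    exact subset_closure ⟨hyO, hyf⟩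
  obtain ⟨K, hK⟩ := mem_iUnion.mp hy'
  exact ⟨K, hy K hK, hK⟩

/-- An elementwise `C¹` function is Lipschitz on each element. -/
lemma exists_lipschitz_on_elem {g : E3 → ℝ} {w : Fin T.N → ℝ × ℝ → ℝ}
    (hw : ∀ K, ContDiff ℝ 1 (w K)) (hgw : ∀ K, ∀ z ∈ refSquare, g (T.F K z) = w K z) :
    ∃ C : ℝ≥0, ∀ K, ∀ x ∈ T.elem K, ∀ y ∈ T.elem K, dist (g x) (g y) ≤ C * dist x y := by
  have hK : ∀ K, ∃ C : ℝ≥0, ∀ x ∈ T.elem K, ∀ y ∈ T.elem K,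
      dist (g x) (g y) ≤ C * dist x y := by
    intro K
    obtain ⟨C, hC⟩ := (hw K).contDiffOn.exists_lipschitzOnWith (s := refSquare) (by norm_num)
      ((convex_Icc _ _).prod (convex_Icc _ _)) isCompact_refSquare
    have hinj : Function.Injective (T.F K).linear := (T.F K).linear_injective_iff.mpr (T.injective K)
    obtain ⟨D, -, hD⟩ := (T.F K).linear.exists_antilipschitzWith
      (LinearMap.ker_eq_bot.mpr hinj)
    refine ⟨C * D, ?_⟩
    rintro _ ⟨z, hz, rfl⟩ _ ⟨z', hz', rfl⟩
    rw [hgw K z hz, hgw K z' hz']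
    have h1 := hC.dist_le_mul z hz z' hz'
    have h2 := hD.le_mul_dist z z'
    have h3 : dist ((T.F K).linear z) ((T.F K).linear z') = dist (T.F K z) (T.F K z') := by
      rw [dist_eq_norm, dist_eq_norm, ← map_sub, ← vsub_eq_sub z z', AffineMap.linearMap_vsub,
        vsub_eq_sub]
    rw [h3] at h2
    push_cast
    rw [mul_assoc]
    exact h1.trans (mul_le_mul_of_nonneg_left h2 C.2)
  choose C hC using hK
  refine ⟨∑ K, C K, fun K x hx y hy => (hC K x hx y hy).trans ?_⟩
  gcongr
  exact Finset.single_le_sum (f := C) (fun _ _ => zero_le) (Finset.mem_univ K)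

/-- An elementwise `C¹` function whose support on `∂Ω` is contained in `Γ` and in a patch is
Lipschitz continuous in graph coordinates. -/
lemma exists_lipschitzWith_comp_graphPt (h : IsPatch Ω V ρ ζ) (hΩ : IsOpen Ω)
    (hΓ : IsLipschitzPiece Ω Γ) {g : E3 → ℝ} {w : Fin T.N → ℝ × ℝ → ℝ}
    (hw : ∀ K, ContDiff ℝ 1 (w K)) (hgw : ∀ K, ∀ z ∈ refSquare, g (T.F K z) = w K z)
    (hS : IsClosed S) (hSV : S ⊆ V) (hSΓ : S ∩ frontier Ω ⊆ Γ) (hgS : ∀ x ∉ S, g x = 0) :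
    ∃ L : ℝ≥0, LipschitzWith L (g ∘ graphPt ρ ζ) := by
  obtain ⟨C, hC⟩ := T.exists_lipschitz_on_elem hw hgw
  obtain ⟨L, hL⟩ := h.exists_lipschitzWith_graphPt
  have hc := hL.continuous
  refine ⟨C * L, lipschitzWith_of_eventually_le fun q => ?_⟩
  -- at points of `S` the nearby points of the graph lie in common elements with `graphPt ρ ζ q`,
  -- and away from the closed set `S` the function is locally zero
  by_cases hq : graphPt ρ ζ q ∈ S
  · have hqΓ := hSΓ ⟨hq, h.graphPt_mem_frontier hΩ (hSV hq)⟩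
    filter_upwards [hc.continuousAt.eventually (T.eventually_exists_elem hΓ hqΓ),
      hc.continuousAt.eventually_mem (h.isOpen.mem_nhds (hSV hq))] with q' h1 h2
    obtain ⟨K, hK, hK'⟩ := h1 (h.graphPt_mem_frontier hΩ h2)
    have h3 := hC K _ hK' _ hK
    have h4 := hL.dist_le_mul q' q
    simp only [Function.comp_apply]
    rw [← dist_eq_norm, ← dist_eq_norm]
    push_cast
    rw [mul_assoc]
    exact h3.trans (mul_le_mul_of_nonneg_left h4 C.2)
  · filter_upwards [hc.continuousAt.eventually_mem (hS.isOpen_compl.mem_nhds hq)] with q' h1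
    simp only [Function.comp_apply, hgS _ hq, hgS _ h1, sub_self, norm_zero]
    positivity

end QuadMesh

/-- The derivative of `gproj ρ ∘ F`. -/
def projLin (ρ : E3 ≃ᵃⁱ[ℝ] E3) (F : ℝ × ℝ →ᵃ[ℝ] E3) : ℝ × ℝ →L[ℝ] ℝ × ℝ :=
  (Matrix.toLin (Module.Basis.finTwoProd ℝ) (Module.Basis.finTwoProd ℝ)
    !![⟪vecA F, frameVec ρ 0⟫, ⟪vecB F, frameVec ρ 0⟫;
      ⟪vecA F, frameVec ρ 1⟫, ⟪vecB F, frameVec ρ 1⟫]).toContinuousLinearMap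

lemma projLin_apply (F : ℝ × ℝ →ᵃ[ℝ] E3) (d : ℝ × ℝ) : projLin ρ F d =
    (d.1 * ⟪vecA F, frameVec ρ 0⟫ + d.2 * ⟪vecB F, frameVec ρ 0⟫,
      d.1 * ⟪vecA F, frameVec ρ 1⟫ + d.2 * ⟪vecB F, frameVec ρ 1⟫) := by
  simp [projLin, Matrix.toLin_finTwoProd_apply, mul_comm]

lemma det_projLin (F : ℝ × ℝ →ᵃ[ℝ] E3) : (projLin ρ F).det = projDet ρ F := by
  rw [projLin, LinearMap.det_toContinuousLinearMap, LinearMap.det_toLin, Matrix.det_fin_two_of,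
    projDet]
  ring

lemma gproj_affine_add (F : ℝ × ℝ →ᵃ[ℝ] E3) (z d : ℝ × ℝ) :
    gproj ρ (F (z + d)) = gproj ρ (F z) + projLin ρ F d := by
  have h0 := gproj_affine_sub ρ F (z + d) z 0
  have h1 := gproj_affine_sub ρ F (z + d) z 1
  simp only [Prod.fst_add, Prod.snd_add, add_sub_cancel_left] at h0 h1
  rw [projLin_apply]
  ext
  · simp only [gproj, Prod.fst_add]; linarith
  · simp only [gproj, Prod.snd_add]; linarith

lemma hasFDerivAt_gproj_affine (F : ℝ × ℝ →ᵃ[ℝ] E3) (z : ℝ × ℝ) :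
    HasFDerivAt (fun z => gproj ρ (F z)) (projLin ρ F) z := by
  have h : (fun z => gproj ρ (F z)) = fun z => gproj ρ (F 0) + projLin ρ F z := by
    funext z
    rw [← gproj_affine_add, zero_add]
  rw [h]
  exact (projLin ρ F).hasFDerivAt.const_add _

/-- The chain rule in graph coordinates. -/
lemma IsPatch.lineDeriv_comp_graphPt (h : IsPatch Ω V ρ ζ) (hΩ : IsOpen Ω) {F : ℝ × ℝ →ᵃ[ℝ] E3}
    (hsub : F '' refSquare ⊆ frontier Ω) {z : ℝ × ℝ} (hz : z ∈ refInterior) (hzV : F z ∈ V)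
    {g : E3 → ℝ} {w : ℝ × ℝ → ℝ} (hw : DifferentiableAt ℝ w z)
    (hgw : ∀ z ∈ refSquare, g (F z) = w z) (d : ℝ × ℝ) :
    lineDeriv ℝ (g ∘ graphPt ρ ζ) (gproj ρ (F z)) (projLin ρ F d) = fderiv ℝ w z d := by
  -- on a short line segment the graph map inverts the projection of the element
  have h1 : (fun t : ℝ => (g ∘ graphPt ρ ζ) (gproj ρ (F z) + t • projLin ρ F d)) =ᶠ[𝓝 0]
      fun t => w (z + t • d) := by
    filter_upwards [eventually_line_mem h.isOpen hz hzV d] with t ht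
    have hsq := refInterior_subset ht.1
    rw [← map_smul, ← gproj_affine_add, Function.comp_apply,
      h.graphPt_gproj hΩ ht.2 (hsub (mem_image_of_mem F hsq)), hgw _ hsq]
  rw [lineDeriv, h1.deriv_eq]
  exact (hw.hasFDerivAt.hasLineDerivAt d).lineDeriv

end Patch

section StokesPatch

open Filter Topology

variable {Ω Γ V S : Set E3} {ρ : E3 ≃ᵃⁱ[ℝ] E3} {ζ : ℝ × ℝ → ℝ}

/-- The integrand `dw ∧ d⟪F, v⟫` on the reference square. -/
def wedge (F : ℝ × ℝ →ᵃ[ℝ] E3) (w : ℝ × ℝ → ℝ) (v : E3) (z : ℝ × ℝ) : ℝ :=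
  fderiv ℝ w z (1, 0) * ⟪vecB F, v⟫ - fderiv ℝ w z (0, 1) * ⟪vecA F, v⟫

/-- The integrand `d(g ∘ P) ∧ d⟪P, v⟫` in graph coordinates, `P` being the graph map. -/
def graphWedge (ρ : E3 ≃ᵃⁱ[ℝ] E3) (ζ : ℝ × ℝ → ℝ) (g : E3 → ℝ) (v : E3) (q : ℝ × ℝ) : ℝ :=
  lineDeriv ℝ (g ∘ graphPt ρ ζ) q (1, 0) * lineDeriv ℝ ((⟪·, v⟫) ∘ graphPt ρ ζ) q (0, 1) -
    lineDeriv ℝ ((⟪·, v⟫) ∘ graphPt ρ ζ) q (1, 0) * lineDeriv ℝ (g ∘ graphPt ρ ζ) q (0, 1)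

lemma hasFDerivAt_inner_affine (F : ℝ × ℝ →ᵃ[ℝ] E3) (v : E3) (z : ℝ × ℝ) :
    HasFDerivAt (fun z => ⟪F z, v⟫) (⟪vecA F, v⟫ • ContinuousLinearMap.fst ℝ ℝ ℝ +
      ⟪vecB F, v⟫ • ContinuousLinearMap.snd ℝ ℝ ℝ) z := by
  have h : (fun z => ⟪F z, v⟫) = fun z => (⟪vecA F, v⟫ • ContinuousLinearMap.fst ℝ ℝ ℝ +
      ⟪vecB F, v⟫ • ContinuousLinearMap.snd ℝ ℝ ℝ) z + ⟪F 0, v⟫ := by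
    funext z
    rw [affine_apply, inner_add_left, inner_add_left, real_inner_smul_left, real_inner_smul_left]
    simp [mul_comm]
  rw [h]
  exact (ContinuousLinearMap.hasFDerivAt _).add_const _

/-- Both wedge products are the same 2-form, in coordinates that differ by `gproj ρ ∘ F`. -/
lemma IsPatch.projDet_mul_graphWedge (h : IsPatch Ω V ρ ζ) (hΩ : IsOpen Ω)
    {F : ℝ × ℝ →ᵃ[ℝ] E3} (hF : Function.Injective F)
    (hsub : F '' refSquare ⊆ frontier Ω) {z : ℝ × ℝ} (hz : z ∈ refInterior) (hzV : F z ∈ V)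
    {g : E3 → ℝ} {w : ℝ × ℝ → ℝ} (hw : DifferentiableAt ℝ w z)
    (hgw : ∀ z ∈ refSquare, g (F z) = w z) (v : E3) :
    projDet ρ F * graphWedge ρ ζ g v (gproj ρ (F z)) = wedge F w v z := by
  have hdet := h.projDet_ne_zero hΩ hF hsub hz hzV
  set α0 := ⟪vecA F, frameVec ρ 0⟫ with hα0
  set α1 := ⟪vecA F, frameVec ρ 1⟫ with hα1
  set β0 := ⟪vecB F, frameVec ρ 0⟫ with hβ0
  set β1 := ⟪vecB F, frameVec ρ 1⟫ with hβ1
  have hD : projDet ρ F = α0 * β1 - α1 * β0 := rfl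
  set D := projDet ρ F
  -- the coordinate directions of the plane, pulled back by Cramer's rule
  have e1 : ((1 : ℝ), (0 : ℝ)) = projLin ρ F (β1 / D, -α1 / D) := by
    rw [projLin_apply]
    ext
    · simp only [← hα0, ← hβ0]; field_simp; rw [hD]; ring
    · simp only [← hα1, ← hβ1]; field_simp; ring
  have e2 : ((0 : ℝ), (1 : ℝ)) = projLin ρ F (-β0 / D, α0 / D) := by
    rw [projLin_apply]
    ext
    · simp only [← hα0, ← hβ0]; field_simp; ring
    · simp only [← hα1, ← hβ1]; field_simp; rw [hD]; ring
  have hf := hasFDerivAt_inner_affine F v z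
  have hexp : ∀ (L : ℝ × ℝ →L[ℝ] ℝ) (s t : ℝ), L (s, t) = s * L (1, 0) + t * L (0, 1) := by
    intro L s t
    have : (s, t) = s • ((1 : ℝ), (0 : ℝ)) + t • ((0 : ℝ), (1 : ℝ)) := by simp
    rw [this, map_add, map_smul, map_smul, smul_eq_mul, smul_eq_mul]
  have k := h.lineDeriv_comp_graphPt hΩ hsub hz hzV hw hgw
  have k' := h.lineDeriv_comp_graphPt hΩ hsub hz hzV (g := (⟪·, v⟫)) hf.differentiableAt
    (fun _ _ => rfl)
  rw [graphWedge, e1, e2, k, k, k', k', hf.fderiv, hexp (fderiv ℝ w z), hexp (fderiv ℝ w z) (-β0 / D),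
    wedge]
  simp only [add_apply, smul_apply,
    ContinuousLinearMap.coe_fst', ContinuousLinearMap.coe_snd', smul_eq_mul]
  field_simp
  rw [hD]
  ring

lemma IsPatch.exists_lipschitzWith_inner_graphPt (h : IsPatch Ω V ρ ζ) (v : E3) :
    ∃ L : ℝ≥0, LipschitzWith L ((⟪·, v⟫) ∘ graphPt ρ ζ) := by
  obtain ⟨L, hL⟩ := h.exists_lipschitzWith_graphPt
  refine ⟨‖v‖₊ * L, LipschitzWith.of_dist_le_mul fun p q => ?_⟩
  simp only [Function.comp_apply]
  rw [Real.dist_eq, ← inner_sub_left]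
  refine (abs_real_inner_le_norm _ _).trans ?_
  rw [← dist_eq_norm, mul_comm]
  push_cast
  rw [mul_assoc]
  exact mul_le_mul_of_nonneg_left (hL.dist_le_mul p q) (norm_nonneg v)

lemma hasCompactSupport_comp_graphPt (hS : IsCompact S) {g : E3 → ℝ} (hgS : ∀ x ∉ S, g x = 0) :
    HasCompactSupport (g ∘ graphPt ρ ζ) := by
  refine HasCompactSupport.intro (hS.image (continuous_gproj ρ)) fun q hq => hgS _ fun hqS => hq ?_
  exact ⟨_, hqS, gproj_graphPt q⟩

lemma integrable_mul_lineDeriv {C D : ℝ≥0} {f g : ℝ × ℝ → ℝ} (hf : LipschitzWith C f)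
    (hg : LipschitzWith D g) (hc : HasCompactSupport g) (v w : ℝ × ℝ) :
    Integrable fun q => lineDeriv ℝ g q v * lineDeriv ℝ f q w :=
  (integrable_lineDeriv hg hc v).mul_bdd (c := C * ‖w‖)
    (measurable_lineDeriv hf.continuous).aestronglyMeasurable
    (Eventually.of_forall fun _ => norm_lineDeriv_le_of_lipschitz ℝ hf)

lemma integrable_graphWedge {C D : ℝ≥0} {g : E3 → ℝ} {v : E3}
    (hf : LipschitzWith C ((⟪·, v⟫) ∘ graphPt ρ ζ))
    (hg : LipschitzWith D (g ∘ graphPt ρ ζ)) (hc : HasCompactSupport (g ∘ graphPt ρ ζ)) :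
    Integrable (graphWedge ρ ζ g v) := by
  have h2 := integrable_mul_lineDeriv hf hg hc (0, 1) (1, 0)
  simp only [mul_comm (lineDeriv ℝ (g ∘ graphPt ρ ζ) _ (0, 1))] at h2
  exact (integrable_mul_lineDeriv hf hg hc (1, 0) (0, 1)).sub h2

lemma integral_graphWedge {C D : ℝ≥0} {g : E3 → ℝ} {v : E3}
    (hf : LipschitzWith C ((⟪·, v⟫) ∘ graphPt ρ ζ))
    (hg : LipschitzWith D (g ∘ graphPt ρ ζ)) (hc : HasCompactSupport (g ∘ graphPt ρ ζ)) :
    ∫ q, graphWedge ρ ζ g v q = 0 := by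
  have h2 := integrable_mul_lineDeriv hf hg hc (0, 1) (1, 0)
  simp only [mul_comm (lineDeriv ℝ (g ∘ graphPt ρ ζ) _ (0, 1))] at h2
  unfold graphWedge
  rw [integral_sub (integrable_mul_lineDeriv hf hg hc (1, 0) (0, 1)) h2,
    integral_lineDeriv_mul_lineDeriv_comm hf hg hc (1, 0) (0, 1), sub_self]

/-- The part of the open reference square which `F` maps into `V`. -/
def patchPre (V : Set E3) (F : ℝ × ℝ →ᵃ[ℝ] E3) : Set (ℝ × ℝ) := refInterior ∩ F ⁻¹' V

lemma measurableSet_patchPre (h : IsPatch Ω V ρ ζ) (F : ℝ × ℝ →ᵃ[ℝ] E3) :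
    MeasurableSet (patchPre V F) :=
  (isOpen_refInterior.inter (h.isOpen.preimage (continuous_affine F))).measurableSet

lemma IsPatch.injOn_gproj_affine (h : IsPatch Ω V ρ ζ) (hΩ : IsOpen Ω)
    {F : ℝ × ℝ →ᵃ[ℝ] E3} (hF : Function.Injective F) (hsub : F '' refSquare ⊆ frontier Ω) :
    InjOn (fun z => gproj ρ (F z)) (patchPre V F) := by
  intro z hz z' hz' hzz
  apply hF
  rw [← h.graphPt_gproj hΩ hz.2 (hsub (mem_image_of_mem F (refInterior_subset hz.1))),
    ← h.graphPt_gproj hΩ hz'.2 (hsub (mem_image_of_mem F (refInterior_subset hz'.1)))]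
  exact congrArg _ hzz

/-- The wedge integrals over the reference square and over the projected element agree up to the
orientation. -/
lemma IsPatch.frameSign_mul_setIntegral_graphWedge (h : IsPatch Ω V ρ ζ) (hΩ : IsOpen Ω)
    {F : ℝ × ℝ →ᵃ[ℝ] E3} (hF : Function.Injective F)
    (hsub : F '' refSquare ⊆ frontier Ω) {s : ℝ} (hs : s ^ 2 = 1)
    (hpos : ∀ z ∈ refInterior, F z ∈ V → 0 < s * ⟪crossE (vecA F) (vecB F), frameVec ρ 2⟫)
    {g : E3 → ℝ} {w : ℝ × ℝ → ℝ} (hw : ContDiff ℝ 1 w)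
    (hgw : ∀ z ∈ refSquare, g (F z) = w z) (hS : IsClosed S) (hSV : S ⊆ V)
    (hgS : ∀ x ∉ S, g x = 0) (v : E3) :
    frameSign ρ * ∫ q in (fun z => gproj ρ (F z)) '' patchPre V F, graphWedge ρ ζ g v q =
      s * ∫ z in refSquare, wedge F w v z := by
  have hwd : Differentiable ℝ w := hw.differentiable (by norm_num)
  have hm := measurableSet_patchPre h F
  have hsq : ∫ z in refSquare, wedge F w v z = ∫ z in patchPre V F, wedge F w v z := by
    refine setIntegral_eq_of_subset_of_ae_sdiff_eq_zero measurableSet_refSquare.nullMeasurableSet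
      (inter_subset_left.trans refInterior_subset) ?_
    filter_upwards [(ae_restrict_iff' measurableSet_refSquare).mp ae_refInterior] with z hz hz'
    have hzi := hz hz'.1
    -- off `patchPre V F` the function `w` vanishes near `z`, since `S ⊆ V`
    have hzV : F z ∉ S := fun hzS => hz'.2 ⟨hzi, hSV hzS⟩
    have h0 : w =ᶠ[𝓝 z] fun _ => 0 := by
      filter_upwards [isOpen_refInterior.mem_nhds hzi,
        (continuous_affine F).continuousAt.eventually_mem (hS.isOpen_compl.mem_nhds hzV)] with z' k1 k2
      rw [← hgw z' (refInterior_subset k1), hgS _ k2]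
    simp [wedge, h0.fderiv_eq]
  rw [hsq, integral_image_eq_integral_abs_det_fderiv_smul volume hm
    (fun z _ => (hasFDerivAt_gproj_affine F z).hasFDerivWithinAt) (h.injOn_gproj_affine hΩ hF hsub),
    ← integral_const_mul, ← integral_const_mul]
  refine setIntegral_congr_fun hm fun z hz => ?_
  have h1 := h.projDet_mul_graphWedge hΩ hF hsub hz.1 hz.2 hwd.differentiableAt hgw v
  have h2 := hpos z hz.1 hz.2
  have h3 := projDet_eq ρ F
  have h4 := frameSign_sq ρ
  -- the outer normal points upwards, so the projected element has orientation `s * frameSign ρ`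
  have h5 : |projDet ρ F| = s * frameSign ρ * projDet ρ F := by
    rw [h3, show s * frameSign ρ * (frameSign ρ * ⟪crossE (vecA F) (vecB F), frameVec ρ 2⟫) =
      frameSign ρ ^ 2 * (s * ⟪crossE (vecA F) (vecB F), frameVec ρ 2⟫) by ring, h4, one_mul,
      ← abs_of_pos h2, abs_mul, abs_mul, (abs_eq zero_le_one).mpr (sq_eq_one_iff.mp h4),
      (abs_eq zero_le_one).mpr (sq_eq_one_iff.mp hs)]
  simp only [smul_eq_mul]
  rw [det_projLin, h5, ← h1]
  linear_combination (s * projDet ρ F * graphWedge ρ ζ g v (gproj ρ (F z))) * h4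

namespace QuadMesh

variable (T : QuadMesh Γ)

/-- Stokes' theorem on the mesh for a function supported in a patch: with the orientations given by
the outer normal, the wedge integrals of the elements add up to the integral of an exact form in
graph coordinates. -/
lemma sum_setIntegral_wedge_of_patch (h : IsPatch Ω V ρ ζ) (hΩ : IsLipschitzPolyhedron Ω)
    (hΓ : IsLipschitzPiece Ω Γ) {s : Fin T.N → ℝ} (hs : ∀ K, s K ^ 2 = 1)
    (hpos : ∀ K, ∀ z ∈ refInterior, T.F K z ∈ V →
      0 < s K * ⟪crossE (vecA (T.F K)) (vecB (T.F K)), frameVec ρ 2⟫)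
    {g : E3 → ℝ} {w : Fin T.N → ℝ × ℝ → ℝ}
    (hw : ∀ K, ContDiff ℝ 1 (w K)) (hgw : ∀ K, ∀ z ∈ refSquare, g (T.F K z) = w K z)
    (hS : IsCompact S) (hSV : S ⊆ V) (hSΓ : S ∩ frontier Ω ⊆ Γ) (hgS : ∀ x ∉ S, g x = 0) (v : E3) :
    ∑ K, s K * ∫ z in refSquare, wedge (T.F K) (w K) v z = 0 := by
  have hsub := T.elem_subset_frontier hΓ
  obtain ⟨L, hL⟩ := h.exists_lipschitzWith_inner_graphPt v
  obtain ⟨D, hD⟩ := T.exists_lipschitzWith_comp_graphPt h hΩ.isOpen hΓ hw hgw hS.isClosed hSV hSΓ hgS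
  have hc := hasCompactSupport_comp_graphPt (ρ := ρ) (ζ := ζ) hS hgS
  set Q : Fin T.N → Set (ℝ × ℝ) := fun K => (fun z => gproj ρ (T.F K z)) '' patchPre V (T.F K)
  have hcont : ∀ K, Continuous fun z => gproj ρ (T.F K z) := fun K =>
    (continuous_gproj ρ).comp (continuous_affine _)
  have hQm : ∀ K, MeasurableSet (Q K) := fun K =>
    (measurableSet_patchPre h (T.F K)).image_of_continuousOn_injOn (hcont K).continuousOn
      (h.injOn_gproj_affine hΩ.isOpen (T.injective K) (hsub K))
  have hP : ∀ K, ∀ z ∈ patchPre V (T.F K), graphPt ρ ζ (gproj ρ (T.F K z)) = T.F K z :=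
    fun K z hz => h.graphPt_gproj hΩ.isOpen hz.2
      (hsub K (mem_image_of_mem _ (refInterior_subset hz.1)))
  have hQd : Pairwise (Function.onFun Disjoint Q) := by
    intro K K' hKK'
    rw [Function.onFun, Set.disjoint_left]
    rintro _ ⟨z, hz, rfl⟩ ⟨z', hz', hzz⟩
    refine T.notMem_elem_of_ne hKK' hz.1 ⟨z', refInterior_subset hz'.1, ?_⟩
    rw [← hP K z hz, ← hP K' z' hz']
    exact congrArg _ hzz
  have hint := integrable_graphWedge hL hD hc
  calc ∑ K, s K * ∫ z in refSquare, wedge (T.F K) (w K) v z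
      = frameSign ρ * ∑ K, ∫ q in Q K, graphWedge ρ ζ g v q := by
        rw [Finset.mul_sum]
        refine Finset.sum_congr rfl fun K _ => ?_
        rw [h.frameSign_mul_setIntegral_graphWedge hΩ.isOpen (T.injective K) (hsub K) (hs K)
          (hpos K) (hw K) (hgw K) hS.isClosed hSV hgS v]
    _ = frameSign ρ * ∫ q in ⋃ K, Q K, graphWedge ρ ζ g v q := by
        rw [integral_iUnion_fintype hQm hQd fun K => hint.integrableOn]
    _ = frameSign ρ * ∫ q, graphWedge ρ ζ g v q := by
        congr 1
        -- off the projected elements and the null set of their edges, the graph avoids `S`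
        refine setIntegral_eq_integral_of_ae_compl_eq_zero ?_
        have hnull : ∀ᵐ q : ℝ × ℝ, ∀ K, q ∉ (fun z => gproj ρ (T.F K z)) '' (refSquare \ refInterior) := by
          rw [ae_all_iff]
          intro K
          rw [← measure_eq_zero_iff_ae_notMem]
          refine addHaar_image_eq_zero_of_differentiableOn_of_addHaar_eq_zero volume
            (fun z _ => (hasFDerivAt_gproj_affine (T.F K) z).differentiableAt.differentiableWithinAt)
            ?_
          have := (ae_restrict_iff' measurableSet_refSquare).mp ae_refInterior
          rw [measure_eq_zero_iff_ae_notMem]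
          filter_upwards [this] with z hz hz'
          exact hz'.2 (hz hz'.1)
        filter_upwards [hnull] with q hq hqQ
        have hqS : graphPt ρ ζ q ∉ S := by
          intro hqS
          have hf := h.graphPt_mem_frontier hΩ.isOpen (hSV hqS)
          have : graphPt ρ ζ q ∈ ⋃ K, T.F K '' refSquare := by
            rw [T.cover]; exact subset_closure (hSΓ ⟨hqS, hf⟩)
          obtain ⟨K, z, hz, hzq⟩ := mem_iUnion.mp this
          have hqz : gproj ρ (T.F K z) = q := by rw [hzq, gproj_graphPt]
          by_cases hzi : z ∈ refInterior
          · exact hqQ (mem_iUnion.mpr ⟨K, z, ⟨hzi, by rw [mem_preimage, hzq]; exact hSV hqS⟩, hqz⟩)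
          · exact hq K ⟨z, ⟨hz, hzi⟩, hqz⟩
        have h0 : q ∉ tsupport (g ∘ graphPt ρ ζ) := by
          rw [notMem_tsupport_iff_eventuallyEq]
          obtain ⟨L', hL'⟩ := h.exists_lipschitzWith_graphPt
          filter_upwards [hL'.continuous.continuousAt.eventually_mem
            (hS.isClosed.isOpen_compl.mem_nhds hqS)] with q' hq'
          exact hgS _ hq'
        simp [graphWedge, lineDeriv_eq_zero_of_notMem_tsupport h0]
    _ = 0 := by rw [integral_graphWedge hL hD hc, mul_zero]

end QuadMesh

end StokesPatch

/-! ### Stokes' theorem on the mesh -/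

section StokesMesh

open Filter Topology
open scoped Manifold

variable {Ω Γ : Set E3}

lemma continuous_wedge (F : ℝ × ℝ →ᵃ[ℝ] E3) {w : ℝ × ℝ → ℝ} (hw : ContDiff ℝ 1 w) (v : E3) :
    Continuous (wedge F w v) := by
  have h := hw.continuous_fderiv (by norm_num)
  unfold wedge
  fun_prop

lemma setIntegral_wedge_congr (F : ℝ × ℝ →ᵃ[ℝ] E3) {w w' : ℝ × ℝ → ℝ}
    (h : ∀ z ∈ refSquare, w z = w' z) (v : E3) :
    ∫ z in refSquare, wedge F w v z = ∫ z in refSquare, wedge F w' v z := by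
  refine integral_congr_ae ?_
  filter_upwards [ae_refInterior] with z hz
  have h0 : w =ᶠ[𝓝 z] w' := by
    filter_upwards [isOpen_refInterior.mem_nhds hz] with z' hz'
    exact h z' (refInterior_subset hz')
  simp [wedge, h0.fderiv_eq]

lemma wedge_sum {ι : Type*} (t : Finset ι) (F : ℝ × ℝ →ᵃ[ℝ] E3) {w : ι → ℝ × ℝ → ℝ}
    (hw : ∀ i ∈ t, ContDiff ℝ 1 (w i)) (v : E3) (z : ℝ × ℝ) :
    wedge F (fun z => ∑ i ∈ t, w i z) v z = ∑ i ∈ t, wedge F (w i) v z := by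
  unfold wedge
  rw [fderiv_fun_sum fun i hi => ((hw i hi).differentiable (by norm_num)).differentiableAt]
  simp [Finset.sum_mul, Finset.sum_sub_distrib]

lemma contDiff_affine (F : ℝ × ℝ →ᵃ[ℝ] E3) {n : WithTop ℕ∞} : ContDiff ℝ n F := by
  have h : (F : ℝ × ℝ → E3) = fun z => z.1 • vecA F + z.2 • vecB F + F 0 :=
    funext fun z => affine_apply F z
  rw [h]
  fun_prop

namespace QuadMesh

variable (T : QuadMesh Γ)

/-- Stokes' theorem on the mesh for `φ u`, where `u` is continuous and elementwise `C¹` and the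
test function `φ` vanishes on `∂Ω \ Γ`; it is localized to patches by a partition of unity. -/
lemma sum_setIntegral_wedge (hΩ : IsLipschitzPolyhedron Ω)
    (hΓ : IsLipschitzPiece Ω Γ) {s : Fin T.N → ℝ} (hs : ∀ K, s K ^ 2 = 1)
    (hpos : ∀ K, ∀ V ρ ζ, IsPatch Ω V ρ ζ → ∀ z ∈ refInterior, T.F K z ∈ V →
      0 < s K * ⟪crossE (vecA (T.F K)) (vecB (T.F K)), frameVec ρ 2⟫)
    {u : E3 → ℝ} {U : Fin T.N → ℝ × ℝ → ℝ}
    (hU : ∀ K, ContDiff ℝ 1 (U K)) (hu : ∀ K, ∀ z ∈ refSquare, u (T.F K z) = U K z)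
    {φ : E3 → ℝ} (hφ : ContDiff ℝ ∞ φ) (hc : HasCompactSupport φ)
    (hd : Disjoint (tsupport φ) (frontier Ω \ Γ)) (v : E3) :
    ∑ K, s K * ∫ z in refSquare, wedge (T.F K) (fun z => φ (T.F K z) * U K z) v z = 0 := by
  have hsub := T.elem_subset_frontier hΓ
  have hcpt : IsCompact (frontier Ω) :=
    Metric.isCompact_of_isClosed_isBounded isClosed_frontier
      (hΩ.isBounded.closure.subset frontier_subset_closure)
  choose! P hP using hΩ.isLipschitz
  choose! ρ ζ hρ using fun x hx => (hP x hx).2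
  obtain ⟨t, ht, htc⟩ := hcpt.elim_nhds_subcover (fun x => interior (P x))
    fun x hx => interior_mem_nhds.mpr (hP x hx).1
  obtain ⟨f, hf⟩ := SmoothPartitionOfUnity.exists_isSubordinate 𝓘(ℝ, E3)
    (s := frontier Ω) isClosed_frontier (fun x : t => interior (P x)) (fun _ => isOpen_interior)
    (by simpa [iUnion_subtype] using htc)
  have hfs : ∀ i, ContDiff ℝ ∞ (f i) := fun i => (f i).contMDiff.contDiff
  have hw : ∀ i K, ContDiff ℝ 1 fun z => f i (T.F K z) * φ (T.F K z) * U K z := fun i K =>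
    ((((hfs i).of_le (by norm_num)).comp (contDiff_affine _)).mul
      ((hφ.of_le (by norm_num)).comp (contDiff_affine _))).mul (hU K)
  have h1 : ∀ i : t, ∑ K, s K * ∫ z in refSquare,
      wedge (T.F K) (fun z => f i (T.F K z) * φ (T.F K z) * U K z) v z = 0 := by
    intro i
    have hpatch := (hρ i (ht i i.2)).isPatch
    refine T.sum_setIntegral_wedge_of_patch (g := fun x => f i x * φ x * u x)
      (S := tsupport φ ∩ tsupport (f i)) hpatch hΩ hΓ hs (fun K => hpos K _ _ _ hpatch) (hw i)
      (fun K z hz => by simp only [hu K z hz]) (hc.isCompact.inter_right (isClosed_tsupport _))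
      (inter_subset_right.trans (hf i)) ?_ ?_ v
    · rintro x ⟨⟨hx, -⟩, hxf⟩
      by_contra hxΓ
      exact Set.disjoint_left.mp hd hx ⟨hxf, hxΓ⟩
    · intro x hx
      by_cases hx1 : x ∈ tsupport φ
      · have : f i x = 0 := image_eq_zero_of_notMem_tsupport fun h => hx ⟨hx1, h⟩
        simp [this]
      · simp [image_eq_zero_of_notMem_tsupport hx1]
  have h2 : ∀ K, ∫ z in refSquare, wedge (T.F K) (fun z => φ (T.F K z) * U K z) v z =
      ∑ i, ∫ z in refSquare, wedge (T.F K) (fun z => f i (T.F K z) * φ (T.F K z) * U K z) v z := by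
    intro K
    rw [setIntegral_wedge_congr (T.F K)
      (w' := fun z => ∑ i, f i (T.F K z) * φ (T.F K z) * U K z), ← integral_finsetSum]
    · exact integral_congr_ae (Eventually.of_forall fun z => wedge_sum _ _ (fun i _ => hw i K) v z)
    · exact fun i _ => integrableOn_refSquare (continuous_wedge _ (hw i K) v)
    · intro z hz
      have h3 := f.sum_eq_one (hsub K (mem_image_of_mem _ hz))
      rw [finsum_eq_sum_of_fintype] at h3
      simp only [mul_assoc, ← Finset.sum_mul, h3, one_mul]
  simp only [h2, Finset.mul_sum]
  rw [Finset.sum_comm]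
  exact Finset.sum_eq_zero fun i _ => h1 i

end QuadMesh

end StokesMesh

/-! ### The surface gradient of an elementwise smooth function -/

section SurfGrad

open Filter Topology

variable {Ω Γ : Set E3}

/-- The surface gradient of the function on `F '' refSquare` with pull-back `w`. -/
def eltGrad (F : ℝ × ℝ →ᵃ[ℝ] E3) (w : ℝ × ℝ → ℝ) (z : ℝ × ℝ) : E3 :=
  tangVec F (fderiv ℝ w z (1, 0)) (fderiv ℝ w z (0, 1))

lemma continuous_eltGrad (F : ℝ × ℝ →ᵃ[ℝ] E3) {w : ℝ × ℝ → ℝ} (hw : ContDiff ℝ 1 w) :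
    Continuous (eltGrad F w) := by
  have h := hw.continuous_fderiv (by norm_num)
  unfold eltGrad tangVec
  fun_prop

lemma inner_tangVec_crossE (F : ℝ × ℝ →ᵃ[ℝ] E3) (s t : ℝ) :
    ⟪tangVec F s t, crossE (vecA F) (vecB F)⟫ = 0 := by
  rw [real_inner_comm, tangVec, inner_add_right, real_inner_smul_right, real_inner_smul_right,
    inner_crossE_left, inner_crossE_right]
  simp

lemma fderiv_apply_eq_sum (φ : E3 → ℝ) (x v : E3) : fderiv ℝ φ x v =
    v 0 * fderiv ℝ φ x (EuclideanSpace.single 0 1) + v 1 * fderiv ℝ φ x (EuclideanSpace.single 1 1) +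
      v 2 * fderiv ℝ φ x (EuclideanSpace.single 2 1) := by
  have h : v = v 0 • EuclideanSpace.single 0 1 + v 1 • EuclideanSpace.single 1 1 +
      v 2 • EuclideanSpace.single 2 (1 : ℝ) := by
    ext i; fin_cases i <;> simp
  conv_lhs => rw [h]
  simp

lemma hasFDerivAt_affine (F : ℝ × ℝ →ᵃ[ℝ] E3) (z : ℝ × ℝ) :
    HasFDerivAt F ((ContinuousLinearMap.fst ℝ ℝ ℝ).smulRight (vecA F) +
      (ContinuousLinearMap.snd ℝ ℝ ℝ).smulRight (vecB F)) z := by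
  have h : (F : ℝ × ℝ → E3) = fun z => ((ContinuousLinearMap.fst ℝ ℝ ℝ).smulRight (vecA F) +
      (ContinuousLinearMap.snd ℝ ℝ ℝ).smulRight (vecB F)) z + F 0 :=
    funext fun z => by rw [affine_apply F z]; simp
  conv => arg 1; rw [h]
  exact (ContinuousLinearMap.hasFDerivAt _).add_const _

lemma fderiv_comp_affine_mul (F : ℝ × ℝ →ᵃ[ℝ] E3) {φ : E3 → ℝ} (hφ : ContDiff ℝ 1 φ)
    {w : ℝ × ℝ → ℝ} (hw : ContDiff ℝ 1 w) (z d : ℝ × ℝ) :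
    fderiv ℝ (fun z => φ (F z) * w z) z d = φ (F z) * fderiv ℝ w z d +
      w z * (d.1 * fderiv ℝ φ (F z) (vecA F) + d.2 * fderiv ℝ φ (F z) (vecB F)) := by
  have h1 := ((hφ.differentiable (by norm_num)) (F z)).hasFDerivAt.comp z (hasFDerivAt_affine F z)
  have h2 := (hw.differentiable (by norm_num) z).hasFDerivAt
  have h3 := (h1.mul h2).fderiv
  simp only [Function.comp_def] at h3
  change fderiv ℝ (fun z => φ (F z) * w z) z = _ at h3
  rw [h3]
  simp [mul_add]

/-- The product rule behind integration by parts: `u (n × ∇φ) + φ (n × ∇u)` is `n × ∇(φ u)`, whose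
components are the wedge products of `φ u` with the coordinate functions. -/
lemma crossE_mul_add_eq_wedge {F : ℝ × ℝ →ᵃ[ℝ] E3} (hF : Function.Injective F)
    {φ : E3 → ℝ} (hφ : ContDiff ℝ 1 φ)
    {w : ℝ × ℝ → ℝ} (hw : ContDiff ℝ 1 w) (j k : Fin 3) (z : ℝ × ℝ) :
    w z * (crossE (vecA F) (vecB F) j * fderiv ℝ φ (F z) (EuclideanSpace.single k 1) -
        crossE (vecA F) (vecB F) k * fderiv ℝ φ (F z) (EuclideanSpace.single j 1)) +
      φ (F z) * (crossE (vecA F) (vecB F) j * eltGrad F w z k -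
        crossE (vecA F) (vecB F) k * eltGrad F w z j) =
      wedge F (fun z => φ (F z) * w z) (crossE (EuclideanSpace.single j 1)
        (EuclideanSpace.single k 1)) z := by
  have h1 : fderiv ℝ w z (1, 0) = ⟪eltGrad F w z, vecA F⟫ := (inner_tangVec_vecA hF _ _).symm
  have h2 : fderiv ℝ w z (0, 1) = ⟪eltGrad F w z, vecB F⟫ := (inner_tangVec_vecB hF _ _).symm
  rw [wedge, fderiv_comp_affine_mul F hφ hw, fderiv_comp_affine_mul F hφ hw, h1, h2,
    fderiv_apply_eq_sum φ _ (vecA F), fderiv_apply_eq_sum φ _ (vecB F)]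
  simp only [inner_E3]
  fin_cases j <;> fin_cases k <;> simp [crossE] <;> ring

namespace QuadMesh

variable (T : QuadMesh Γ)

open Classical in
/-- The piecewise surface gradient of the function with pull-backs `w K`; it is zero off the
images of the open reference square. -/
def surfGrad (w : Fin T.N → ℝ × ℝ → ℝ) (x : E3) : E3 :=
  if h : ∃ q : Fin T.N × (ℝ × ℝ), q.2 ∈ refInterior ∧ T.F q.1 q.2 = x then
    eltGrad (T.F h.choose.1) (w h.choose.1) h.choose.2
  else 0

lemma surfGrad_apply (w : Fin T.N → ℝ × ℝ → ℝ) (K : Fin T.N) {z : ℝ × ℝ} (hz : z ∈ refInterior) :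
    T.surfGrad w (T.F K z) = eltGrad (T.F K) (w K) z := by
  have h : ∃ q : Fin T.N × (ℝ × ℝ), q.2 ∈ refInterior ∧ T.F q.1 q.2 = T.F K z := ⟨(K, z), hz, rfl⟩
  rw [surfGrad, dif_pos h]
  have h1 := h.choose_spec
  generalize h.choose = q at h1 ⊢
  have hK : q.1 = K := by
    by_contra hne
    exact T.notMem_elem_of_ne hne h1.1 ⟨z, refInterior_subset hz, h1.2.symm⟩
  have hz' : q.2 = z := T.injective K (by rw [← h1.2, hK])
  rw [hK, hz']

/-- A function with continuous pull-backs is square integrable. -/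
lemma memLp_of_ae_eq (hΩ : IsLipschitzPolyhedron Ω) (hΓ : IsLipschitzPiece Ω Γ)
    {E : Type*} [NormedAddCommGroup E] {f : E3 → E} {g : Fin T.N → ℝ × ℝ → E}
    (hg : ∀ K, Continuous (g K))
    (hfg : ∀ K, ∀ᵐ z ∂(volume.restrict refSquare), f (T.F K z) = g K z) :
    MemLp f 2 (μHE[2].restrict Γ) := by
  have hm := T.aestronglyMeasurable hΩ hΓ (f := f) fun K =>
    ((hg K).continuousOn.aestronglyMeasurable_of_isCompact isCompact_refSquare
      measurableSet_refSquare).congr ((hfg K).mono fun z h => h.symm)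
  rw [memLp_two_iff_integrable_sq_norm hm]
  refine (T.integrableOn_iff hΩ hΓ fun x => ‖f x‖ ^ 2).mpr fun K => ?_
  have h1 : Continuous fun z => ‖g K z‖ ^ 2 := by fun_prop
  refine (integrableOn_refSquare h1).congr_fun_ae ?_
  filter_upwards [hfg K] with z hz
  rw [hz]

lemma integral_eq_sum_of_ae_eq (hΩ : IsLipschitzPolyhedron Ω) (hΓ : IsLipschitzPiece Ω Γ)
    {f : E3 → ℝ} {g : Fin T.N → ℝ × ℝ → ℝ} (hg : ∀ K, Continuous (g K))
    (hfg : ∀ K, ∀ᵐ z ∂(volume.restrict refSquare), f (T.F K z) = g K z) :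
    ∫ x in Γ, f x ∂μHE[2] = ∑ K, jac (T.F K) * ∫ z in refSquare, g K z := by
  rw [T.integral_eq_sum hΩ hΓ]
  · exact Finset.sum_congr rfl fun K _ => by rw [integral_congr_ae (hfg K)]
  · refine (T.integrableOn_iff hΩ hΓ f).mpr fun K => ?_
    exact (integrableOn_refSquare (hg K)).congr_fun_ae ((hfg K).mono fun z h => h.symm)

/-- A continuous, elementwise smooth function on `Γ` has the piecewise gradient as its weak surface
gradient. -/
theorem hasSurfGrad_surfGrad (hΩ : IsLipschitzPolyhedron Ω) (hΓ : IsLipschitzPiece Ω Γ)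
    {u v : E3 → ℝ} {w : Fin T.N → ℝ × ℝ → ℝ} (hw : ∀ K, ContDiff ℝ 1 (w K))
    (hv : ∀ K, ∀ z ∈ refSquare, v (T.F K z) = w K z)
    (huv : ∀ᵐ x ∂(μHE[2].restrict Γ : Measure E3), u x = v x) :
    HasSurfGrad Ω Γ u (T.surfGrad w) := by
  have hu : ∀ K, ∀ᵐ z ∂(volume.restrict refSquare), u (T.F K z) = w K z := fun K => by
    filter_upwards [(T.ae_iff hΩ hΓ _).mp huv K, ae_restrict_mem measurableSet_refSquare]
      with z h1 h2
    rw [h1, hv K z h2]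
  have hG : ∀ K, ∀ᵐ z ∂(volume.restrict refSquare),
      T.surfGrad w (T.F K z) = eltGrad (T.F K) (w K) z := fun K =>
    ae_refInterior.mono fun z hz => T.surfGrad_apply w K hz
  choose s hs hN hpos using fun K => exists_outerNormal_eq hΩ (T.injective K)
    (T.elem_subset_frontier hΓ K)
  refine ⟨T.memLp_of_ae_eq hΩ hΓ (fun K => (hw K).continuous) hu,
    T.memLp_of_ae_eq hΩ hΓ (fun K => continuous_eltGrad _ (hw K)) hG, ?_, ?_⟩
  · rw [T.ae_iff hΩ hΓ]
    intro K
    filter_upwards [ae_refInterior] with z hz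
    rw [hN K z hz, T.surfGrad_apply w K hz, real_inner_smul_right, eltGrad, inner_tangVec_crossE,
      mul_zero]
  · intro φ hφ hc hd j k
    have hφ1 : ContDiff ℝ 1 φ := hφ.of_le (by norm_num)
    have hφc := hφ1.continuous
    have hφd := hφ1.continuous_fderiv (by norm_num)
    set n : Fin T.N → E3 := fun K => crossE (vecA (T.F K)) (vecB (T.F K)) with hn
    have hFc : ∀ K, Continuous (T.F K) := fun K => continuous_affine _
    have hwc : ∀ K, Continuous (w K) := fun K => (hw K).continuous
    have hGc : ∀ K, Continuous (eltGrad (T.F K) (w K)) := fun K => continuous_eltGrad _ (hw K)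
    set α : Fin T.N → ℝ × ℝ → ℝ := fun K z => w K z *
      (n K j * fderiv ℝ φ (T.F K z) (EuclideanSpace.single k 1) -
        n K k * fderiv ℝ φ (T.F K z) (EuclideanSpace.single j 1)) with hα
    set β : Fin T.N → ℝ × ℝ → ℝ := fun K z => φ (T.F K z) *
      (n K j * eltGrad (T.F K) (w K) z k - n K k * eltGrad (T.F K) (w K) z j) with hβ
    have hαc : ∀ K, Continuous (α K) := fun K => by
      have := hφd.comp (hFc K)
      simp only [Function.comp_def] at this
      have := hwc K
      simp only [hα]; fun_prop
    have hβc : ∀ K, Continuous (β K) := fun K => by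
      have := hGc K
      have := hFc K
      have := hφc.comp (hFc K)
      simp only [Function.comp_def] at this
      simp only [hβ]; fun_prop
    rw [T.integral_eq_sum_of_ae_eq hΩ hΓ (g := fun K z => s K / jac (T.F K) * α K z)
        (fun K => (hαc K).const_mul _) ?_,
      T.integral_eq_sum_of_ae_eq hΩ hΓ (g := fun K z => s K / jac (T.F K) * β K z)
        (fun K => (hβc K).const_mul _) ?_, eq_neg_iff_add_eq_zero, ← Finset.sum_add_distrib,
      ← T.sum_setIntegral_wedge hΩ hΓ hs hpos hw hv hφ hc hd
        (crossE (EuclideanSpace.single j 1) (EuclideanSpace.single k 1))]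
    · refine Finset.sum_congr rfl fun K _ => ?_
      have hJ := jac_pos (T.injective K)
      rw [integral_const_mul, integral_const_mul]
      have h1 : ∫ z in refSquare, wedge (T.F K) (fun z => φ (T.F K z) * w K z)
          (crossE (EuclideanSpace.single j 1) (EuclideanSpace.single k 1)) z =
          (∫ z in refSquare, α K z) + ∫ z in refSquare, β K z := by
        rw [← integral_add (integrableOn_refSquare (hαc K)) (integrableOn_refSquare (hβc K))]
        exact integral_congr_ae (Eventually.of_forall fun z =>
          (crossE_mul_add_eq_wedge (T.injective K) hφ1 (hw K) j k z).symm)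
      rw [h1]
      field_simp
    · intro K
      filter_upwards [hG K, ae_refInterior] with z h1 h2
      rw [h1, hN K z h2]
      simp only [hβ, hn, PiLp.smul_apply, smul_eq_mul]
      ring
    · intro K
      filter_upwards [hu K, ae_refInterior] with z h1 h2
      rw [h1, tangDeriv, hN K z h2]
      simp only [hα, hn, PiLp.smul_apply, smul_eq_mul]
      ring

end QuadMesh

end SurfGrad

/-! ### Uniqueness of the surface gradient and the norms of elementwise smooth functions -/

section Norms

open Filter Topology

variable {Ω Γ : Set E3}

lemma IsLipschitzPiece.measurableSet (hΓ : IsLipschitzPiece Ω Γ) : MeasurableSet Γ := by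
  obtain ⟨O, hO, rfl⟩ := hΓ.isRelOpen
  exact hO.measurableSet.inter isClosed_frontier.measurableSet

lemma IsLipschitzPiece.isClosed_frontier_diff (hΓ : IsLipschitzPiece Ω Γ) :
    IsClosed (frontier Ω \ Γ) := by
  obtain ⟨O, hO, rfl⟩ := hΓ.isRelOpen
  have : frontier Ω \ (O ∩ frontier Ω) = frontier Ω ∩ Oᶜ := by
    ext x; simp only [Set.mem_sdiff, mem_inter_iff, mem_compl_iff]; tauto
  rw [this]
  exact isClosed_frontier.inter hO.isClosed_compl

/-- A tangential vector `d` with `ν × d = 0` vanishes. -/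
lemma eq_zero_of_inner_eq_zero_of_cross_eq_zero {ν d : E3} (hν : ‖ν‖ = 1) (h : ⟪d, ν⟫ = 0)
    (h' : ∀ j k, ν j * d k - ν k * d j = 0) : d = 0 := by
  have h1 : ν 0 * ν 0 + ν 1 * ν 1 + ν 2 * ν 2 = 1 := by
    rw [← inner_E3, real_inner_self_eq_norm_sq, hν, one_pow]
  rw [inner_E3] at h
  ext k
  have e0 := h' 0 k
  have e1 := h' 1 k
  have e2 := h' 2 k
  simp only [PiLp.zero_apply]
  linear_combination ν 0 * e0 + ν 1 * e1 + ν 2 * e2 - d k * h1 + ν k * h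

namespace QuadMesh

lemma isFiniteMeasure_restrict (T : QuadMesh Γ) (hΩ : IsLipschitzPolyhedron Ω)
    (hΓ : IsLipschitzPiece Ω Γ) : IsFiniteMeasure ((μHE[2] : Measure E3).restrict Γ) := by
  refine ⟨?_⟩
  rw [← lintegral_one, T.lintegral_eq_sum hΩ hΓ]
  refine ENNReal.sum_lt_top.mpr fun K _ => ENNReal.mul_lt_top ENNReal.ofReal_lt_top ?_
  rw [lintegral_one, Measure.restrict_apply_univ]
  exact isCompact_refSquare.measure_lt_top

/-- The surface gradient is unique: testing with all admissible `φ` determines `n × g` on `Γ`,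
and `g` is tangential. A mesh is used for the measurability of the outer normal and `|Γ| < ∞`. -/
lemma ae_eq_of_hasSurfGrad (T : QuadMesh Γ) (hΩ : IsLipschitzPolyhedron Ω) (hΓ : IsLipschitzPiece Ω Γ)
    {u : E3 → ℝ} {g g' : E3 → E3} (h : HasSurfGrad Ω Γ u g) (h' : HasSurfGrad Ω Γ u g') :
    g =ᵐ[μHE[2].restrict Γ] g' := by
  have hfin := T.isFiniteMeasure_restrict hΩ hΓ
  choose s hs hN hpos using fun K => exists_outerNormal_eq hΩ (T.injective K)
    (T.elem_subset_frontier hΓ K)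
  set μ := (μHE[2] : Measure E3).restrict Γ with hμ
  have hNm : AEStronglyMeasurable (outerNormal Ω) μ := T.aestronglyMeasurable hΩ hΓ fun K =>
    (aestronglyMeasurable_const (b := (s K / jac (T.F K)) • crossE (vecA (T.F K)) (vecB (T.F K)))).congr
      (ae_refInterior.mono fun z hz => (hN K z hz).symm)
  have hN1 : ∀ᵐ x ∂μ, ‖outerNormal Ω x‖ = 1 := by
    rw [hμ, T.ae_iff hΩ hΓ]
    intro K
    filter_upwards [ae_refInterior] with z hz
    have hJ := jac_pos (T.injective K)
    have h2 : ‖outerNormal Ω (T.F K z)‖ ^ 2 = 1 := by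
      rw [hN K z hz, norm_smul, mul_pow, norm_crossE_sq, Real.norm_eq_abs, sq_abs, div_pow, hs K]
      field_simp
    nlinarith [norm_nonneg (outerNormal Ω (T.F K z))]
  have hint : ∀ {f : E3 → E3}, MemLp f 2 μ → ∀ j k,
      Integrable (fun x => outerNormal Ω x j * f x k) μ := by
    intro f hf j k
    have h1 : Integrable (fun x => f x k) μ :=
      (EuclideanSpace.proj (𝕜 := ℝ) k).integrable_comp (hf.integrable (by norm_num))
    refine h1.bdd_mul (c := 1) ?_ ?_
    · exact (EuclideanSpace.proj (𝕜 := ℝ) j).continuous.comp_aestronglyMeasurable hNm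
    · filter_upwards [hN1] with x hx
      rw [← hx]
      exact PiLp.norm_apply_le _ j
  have hint2 : ∀ {f : E3 → E3}, MemLp f 2 μ → ∀ j k,
      Integrable (fun x => outerNormal Ω x j * f x k - outerNormal Ω x k * f x j) μ :=
    fun hf j k => (hint hf j k).sub (hint hf k j)
  have hzero : ∀ j k, ∀ᵐ x ∂μ, (outerNormal Ω x j * g x k - outerNormal Ω x k * g x j) -
      (outerNormal Ω x j * g' x k - outerNormal Ω x k * g' x j) = 0 := by
    intro j k
    have hI := hint2 h.memLp_grad j k
    have hI' := hint2 h'.memLp_grad j k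
    have key := IsOpen.ae_eq_zero_of_integral_contDiff_smul_eq_zero (μ := μ)
      hΓ.isClosed_frontier_diff.isOpen_compl ((hI.sub hI').locallyIntegrable.locallyIntegrableOn _) (by
        intro φ hφ hc hd
        obtain ⟨C, hC⟩ := hc.exists_bound_of_continuous hφ.continuous
        have hd' : Disjoint (tsupport φ) (frontier Ω \ Γ) := Set.subset_compl_iff_disjoint_right.mp hd
        have e1 := h.weak φ hφ hc hd' j k
        have e2 := h'.weak φ hφ hc hd' j k
        rw [e1, neg_inj] at e2
        simp only [Pi.sub_apply, smul_eq_mul, mul_sub (φ _) (_ - _) (_ - _)]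
        rw [integral_sub, e2, sub_self]
        · exact hI.bdd_mul (c := C) hφ.continuous.aestronglyMeasurable (Eventually.of_forall hC)
        · exact hI'.bdd_mul (c := C) hφ.continuous.aestronglyMeasurable (Eventually.of_forall hC))
    filter_upwards [key, ae_restrict_mem hΓ.measurableSet] with x hx hxΓ
    exact hx fun hx' => hx'.2 hxΓ
  have hzero' : ∀ᵐ x ∂μ, ∀ j k, (outerNormal Ω x j * g x k - outerNormal Ω x k * g x j) -
      (outerNormal Ω x j * g' x k - outerNormal Ω x k * g' x j) = 0 := by
    simpa only [ae_all_iff] using hzero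
  filter_upwards [hzero', hN1, h.tangential, h'.tangential] with x h0 h1 h2 h3
  rw [← sub_eq_zero]
  refine eq_zero_of_inner_eq_zero_of_cross_eq_zero h1 (by rw [inner_sub_left, h2, h3, sub_zero]) ?_
  intro j k
  rw [← h0 j k]
  simp only [PiLp.sub_apply]
  ring

/-- The infimum in the definition of the `H¹`-norm is attained at the elementwise gradient. -/
lemma h1NormSq_eq (T : QuadMesh Γ) (hΩ : IsLipschitzPolyhedron Ω) (hΓ : IsLipschitzPiece Ω Γ)
    {u v : E3 → ℝ} {w : Fin T.N → ℝ × ℝ → ℝ} (hw : ∀ K, ContDiff ℝ 1 (w K))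
    (hv : ∀ K, ∀ z ∈ refSquare, v (T.F K z) = w K z)
    (huv : ∀ᵐ x ∂(μHE[2].restrict Γ : Measure E3), u x = v x) :
    h1NormSq Ω Γ u = l2NormSq Γ u + l2NormSq Γ (T.surfGrad w) := by
  have h0 := T.hasSurfGrad_surfGrad hΩ hΓ hw hv huv
  refine le_antisymm (iInf₂_le _ h0) (le_iInf₂ fun g hg => ?_)
  refine add_le_add le_rfl (le_of_eq (lintegral_congr_ae ?_))
  filter_upwards [T.ae_eq_of_hasSurfGrad hΩ hΓ h0 hg] with x hx
  rw [hx]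

lemma l2NormSq_eq_sum (T : QuadMesh Γ) (hΩ : IsLipschitzPolyhedron Ω) (hΓ : IsLipschitzPiece Ω Γ)
    {E : Type*} [NormedAddCommGroup E] {f : E3 → E} {g : Fin T.N → ℝ × ℝ → E}
    (hg : ∀ K, Continuous (g K))
    (hfg : ∀ K, ∀ᵐ z ∂(volume.restrict refSquare), f (T.F K z) = g K z) :
    l2NormSq Γ f = ENNReal.ofReal (∑ K, jac (T.F K) * ∫ z in refSquare, ‖g K z‖ ^ 2) := by
  rw [l2NormSq, T.lintegral_eq_sum hΩ hΓ, ENNReal.ofReal_sum_of_nonneg fun K _ =>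
    mul_nonneg (jac_nonneg _) (integral_nonneg fun _ => by positivity)]
  refine Finset.sum_congr rfl fun K _ => ?_
  rw [ENNReal.ofReal_mul (jac_nonneg _), ofReal_integral_eq_lintegral_ofReal
    (integrableOn_refSquare (by have := hg K; fun_prop)) (Eventually.of_forall fun _ => by positivity)]
  congr 1
  refine lintegral_congr_ae ?_
  filter_upwards [hfg K] with z hz
  rw [hz, ← ofReal_norm, ENNReal.ofReal_pow (norm_nonneg _)]

end QuadMesh

end Norms

/-! ### The stability estimates -/

section Estimates

variable {m : ℕ}

lemma fderiv_biComb (c : Fin 2 ⊕ Fin m → Fin 2 ⊕ Fin m → ℝ) (z d : ℝ × ℝ) :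
    fderiv ℝ (biComb sh sh c) z d = d.1 * biComb dsh sh c z + d.2 * biComb sh dsh c z := by
  have h : HasFDerivAt (biComb sh sh c) (∑ k, ∑ l, c k l •
      ((sh k).eval z.1 • ((dsh l).eval z.2 • ContinuousLinearMap.snd ℝ ℝ ℝ) +
        (sh l).eval z.2 • ((dsh k).eval z.1 • ContinuousLinearMap.fst ℝ ℝ ℝ))) z := by
    unfold biComb
    refine HasFDerivAt.fun_sum fun k _ => HasFDerivAt.fun_sum fun l _ => HasFDerivAt.const_mul ?_ _
    refine HasFDerivAt.mul ?_ ?_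
    · exact ((sh k).hasDerivAt z.1).comp_hasFDerivAt z hasFDerivAt_fst
    · exact ((sh l).hasDerivAt z.2).comp_hasFDerivAt z hasFDerivAt_snd
  rw [h.fderiv]
  simp only [biComb, sum_apply, smul_apply, add_apply,
    ContinuousLinearMap.coe_fst', ContinuousLinearMap.coe_snd', smul_eq_mul, Finset.mul_sum,
    ← Finset.sum_add_distrib]
  refine Finset.sum_congr rfl fun k _ => Finset.sum_congr rfl fun l _ => ?_
  ring

/-- The squared `L²`-norms of the two partial derivatives on the reference square. -/
def refSemi (c : Fin 2 ⊕ Fin m → Fin 2 ⊕ Fin m → ℝ) : ℝ :=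
  sqInt (biComb dsh sh c) + sqInt (biComb sh dsh c)

variable {F : ℝ × ℝ →ᵃ[ℝ] E3} {γ : ℝ}

lemma refSemi_eq (c : Fin 2 ⊕ Fin m → Fin 2 ⊕ Fin m → ℝ) : refSemi c =
    ∫ z in refSquare, (biComb dsh sh c z ^ 2 + biComb sh dsh c z ^ 2) :=
  (integral_add (integrableOn_refSquare (by fun_prop)) (integrableOn_refSquare (by fun_prop))).symm

lemma eltGrad_biComb (c : Fin 2 ⊕ Fin m → Fin 2 ⊕ Fin m → ℝ) (z : ℝ × ℝ) :
    eltGrad F (biComb sh sh c) z = tangVec F (biComb dsh sh c z) (biComb sh dsh c z) := by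
  simp [eltGrad, fderiv_biComb]

lemma continuous_norm_eltGrad_sq (c : Fin 2 ⊕ Fin m → Fin 2 ⊕ Fin m → ℝ) :
    Continuous fun z => ‖eltGrad F (biComb sh sh c) z‖ ^ 2 := by
  have h : ContDiff ℝ 1 (biComb sh sh c) := (contDiff_biComb sh sh c).of_le (by norm_num)
  have := continuous_eltGrad F h
  fun_prop

lemma jac_mul_integral_eltGrad_le (hF : Function.Injective F)
    (hγ : Metric.diam (F '' refSquare) ^ 2 ≤ γ * (4 * jac F))
    (c : Fin 2 ⊕ Fin m → Fin 2 ⊕ Fin m → ℝ) :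
    jac F * ∫ z in refSquare, ‖eltGrad F (biComb sh sh c) z‖ ^ 2 ≤ 2 * γ * refSemi c := by
  rw [refSemi_eq, ← integral_const_mul, ← integral_const_mul]
  refine integral_mono (integrableOn_refSquare ((continuous_norm_eltGrad_sq c).const_mul _))
    (integrableOn_refSquare (by fun_prop)) fun z => ?_
  simp only [eltGrad_biComb]
  exact norm_tangVec_sq_mul_jac_le hF hγ _ _

lemma refSemi_le_jac_mul_integral_eltGrad (hF : Function.Injective F)
    (hγ : Metric.diam (F '' refSquare) ^ 2 ≤ γ * (4 * jac F))
    (c : Fin 2 ⊕ Fin m → Fin 2 ⊕ Fin m → ℝ) :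
    refSemi c ≤ 2 * γ * (jac F * ∫ z in refSquare, ‖eltGrad F (biComb sh sh c) z‖ ^ 2) := by
  rw [refSemi_eq, ← integral_const_mul, ← integral_const_mul]
  refine integral_mono (integrableOn_refSquare (by fun_prop))
    (integrableOn_refSquare (((continuous_norm_eltGrad_sq c).const_mul _).const_mul _)) fun z => ?_
  simp only [eltGrad_biComb]
  exact sq_add_sq_le_jac_mul hF hγ _ _

namespace QuadMesh

variable {Ω Γ : Set E3} {T : QuadMesh Γ} {p : ℕ} (o : T.Orientation) (c : T.Dof p → ℝ)

/-- The squared `L²(Γ)`-norm of the function with coefficient vector `c`. -/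
def l2Sq : ℝ := ∑ K, jac (T.F K) * sqInt (locFun o c K)

/-- The squared `L²(Γ)`-norm of the surface gradient of the function with coefficient vector `c`. -/
def gradSq : ℝ := ∑ K, jac (T.F K) * ∫ z in refSquare, ‖eltGrad (T.F K) (locFun o c K) z‖ ^ 2

lemma l2Sq_nonneg : 0 ≤ l2Sq o c :=
  Finset.sum_nonneg fun _ _ => mul_nonneg (jac_nonneg _) (sqInt_nonneg _)

lemma gradSq_nonneg : 0 ≤ gradSq o c :=
  Finset.sum_nonneg fun _ _ => mul_nonneg (jac_nonneg _) (integral_nonneg fun _ => by positivity)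

variable {o c}

lemma contDiff_locFun (K : Fin T.N) : ContDiff ℝ 1 (locFun o c K) :=
  (contDiff_biComb sh sh _).of_le (by norm_num)

lemma sum_basisFun_apply (K : Fin T.N) {z : ℝ × ℝ} (hz : z ∈ refSquare) :
    ∑ δ, c δ * basisFun o δ (T.F K z) = locFun o c K z := by
  rw [← sum_localShape]
  exact Finset.sum_congr rfl fun δ _ => by rw [basisFun_apply o δ K hz]

lemma IsCoeffVector.l2NormSq_eq {u : E3 → ℝ} (h : IsCoeffVector o u c)
    (hΩ : IsLipschitzPolyhedron Ω) (hΓ : IsLipschitzPiece Ω Γ) :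
    l2NormSq Γ u = ENNReal.ofReal (l2Sq o c) := by
  rw [T.l2NormSq_eq_sum hΩ hΓ (g := locFun o c) (fun K => (contDiff_locFun K).continuous)]
  · simp only [l2Sq, sqInt, Real.norm_eq_abs, sq_abs]
  · intro K
    filter_upwards [(T.ae_iff hΩ hΓ _).mp h K, ae_restrict_mem measurableSet_refSquare]
      with z h1 h2
    rw [h1, sum_basisFun_apply K h2]

lemma IsCoeffVector.h1NormSq_eq {u : E3 → ℝ} (h : IsCoeffVector o u c)
    (hΩ : IsLipschitzPolyhedron Ω) (hΓ : IsLipschitzPiece Ω Γ) :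
    h1NormSq Ω Γ u = ENNReal.ofReal (l2Sq o c + gradSq o c) := by
  rw [T.h1NormSq_eq hΩ hΓ (w := locFun o c) contDiff_locFun
    (fun K z hz => sum_basisFun_apply K hz) h, h.l2NormSq_eq hΩ hΓ,
    T.l2NormSq_eq_sum hΩ hΓ (fun K => continuous_eltGrad (T.F K) (contDiff_locFun K))
      (fun K => ae_refInterior.mono fun z hz => T.surfGrad_apply _ K hz),
    ENNReal.ofReal_add (l2Sq_nonneg o c) (gradSq_nonneg o c), gradSq]

variable {γ κ M : ℝ}

lemma l2Sq_le : l2Sq o c ≤ 9 * T.size ^ 2 * ∑ K, coeffSq (locCoeff o c K) := by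
  rw [l2Sq, Finset.mul_sum]
  refine Finset.sum_le_sum fun K _ => ?_
  have h1 : 4 * jac (T.F K) ≤ T.size ^ 2 := (four_mul_jac_le _).trans
    (pow_le_pow_left₀ Metric.diam_nonneg (T.diam_le_size K) 2)
  have h2 : sqInt (locFun o c K) ≤ 36 * coeffSq (locCoeff o c K) := sqInt_biComb_le _
  have h3 := mul_le_mul h1 h2 (sqInt_nonneg _) (sq_nonneg _)
  linarith

lemma gradSq_le (h : T.IsShapeRegular γ) :
    gradSq o c ≤ 24 * max γ 1 * ∑ K, coeffSq (locCoeff o c K) := by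
  rw [gradSq, Finset.mul_sum]
  refine Finset.sum_le_sum fun K _ => ?_
  have h1 := jac_mul_integral_eltGrad_le (T.injective K) (h.diam_sq_le K) (locCoeff o c K)
  have h2 := sqInt_biComb_dsh_left_le (locCoeff o c K)
  have h3 := sqInt_biComb_dsh_right_le (locCoeff o c K)
  have h4 : (0 : ℝ) ≤ max γ 1 := le_max_of_le_right zero_le_one
  have h5 : refSemi (locCoeff o c K) ≤ 12 * coeffSq (locCoeff o c K) := by
    unfold refSemi; linarith
  have h6 := mul_le_mul_of_nonneg_left h5 h4
  rw [locFun]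
  linarith

/-- Scaling of the `L²`-norm to the reference square. -/
lemma sum_sqInt_le (h : T.IsShapeRegular γ) (h' : T.IsQuasiUniform κ) (hΓ : IsLipschitzPiece Ω Γ) :
    ∑ K, sqInt (locFun o c K) ≤ 4 * (max κ 1 ^ 2 * max γ 1) * (T.size ^ 2)⁻¹ * l2Sq o c := by
  have hs := pow_pos (T.size_pos hΓ) 2
  rw [l2Sq, Finset.mul_sum]
  refine Finset.sum_le_sum fun K _ => ?_
  have h1 := mul_le_mul_of_nonneg_right (size_sq_le h h' hΓ K) (sqInt_nonneg (locFun o c K))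
  have h2 := mul_le_mul_of_nonneg_left h1 (inv_nonneg.mpr hs.le)
  rw [inv_mul_cancel_left₀ hs.ne'] at h2
  linarith

lemma sum_refSemi_le (h : T.IsShapeRegular γ) :
    ∑ K, refSemi (locCoeff o c K) ≤ 2 * max γ 1 * gradSq o c := by
  rw [gradSq, Finset.mul_sum]
  exact Finset.sum_le_sum fun K _ =>
    refSemi_le_jac_mul_integral_eltGrad (T.injective K) (h.diam_sq_le K) (locCoeff o c K)

lemma sum_sq_le_l2Sq (hp : 1 ≤ p) (h : T.IsShapeRegular γ) (h' : T.IsQuasiUniform κ)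
    (hΓ : IsLipschitzPiece Ω Γ) : ∑ δ, c δ ^ 2 ≤
      576 * (max κ 1 ^ 2 * max γ 1) * (T.size ^ 2)⁻¹ * (p : ℝ) ^ 8 * l2Sq o c := by
  have hp' : p - 1 + 1 = p := Nat.sub_add_cancel hp
  calc ∑ δ, c δ ^ 2 ≤ ∑ K, coeffSq (locCoeff o c K) := sum_sq_le_sum_coeffSq o c
    _ ≤ ∑ K, 144 * ((p : ℝ) ^ 8 * sqInt (locFun o c K)) := Finset.sum_le_sum fun K _ => by
        have := coeffSq_le_l2 (locCoeff o c K)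
        rwa [hp'] at this
    _ = 144 * (p : ℝ) ^ 8 * ∑ K, sqInt (locFun o c K) := by
        rw [Finset.mul_sum]; exact Finset.sum_congr rfl fun _ _ => by ring
    _ ≤ 144 * (p : ℝ) ^ 8 * (4 * (max κ 1 ^ 2 * max γ 1) * (T.size ^ 2)⁻¹ * l2Sq o c) :=
        mul_le_mul_of_nonneg_left (sum_sqInt_le h h' hΓ) (by positivity)
    _ = _ := by ring

lemma sum_sq_le_h1 (hp : 1 ≤ p) (h : T.IsShapeRegular γ) (h' : T.IsQuasiUniform κ)
    (hΓ : IsLipschitzPiece Ω Γ) : ∑ δ, c δ ^ 2 ≤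
      144 * (max κ 1 ^ 2 * max γ 1) * ((p : ℝ) ^ 4 + (T.size ^ 2)⁻¹) * (l2Sq o c + gradSq o c) := by
  have hp' : p - 1 + 1 = p := Nat.sub_add_cancel hp
  have hA := l2Sq_nonneg o c
  have hB := gradSq_nonneg o c
  have hγ1 : 1 ≤ max γ 1 := le_max_right _ _
  have hκ1 : 1 ≤ max κ 1 ^ 2 := one_le_pow₀ (le_max_right _ _)
  have hle : max γ 1 ≤ max κ 1 ^ 2 * max γ 1 := le_mul_of_one_le_left (by linarith) hκ1
  set t := max κ 1 ^ 2 * max γ 1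
  have ht : 0 ≤ t := by linarith
  have hs : 0 ≤ (T.size ^ 2)⁻¹ := by positivity
  calc ∑ δ, c δ ^ 2 ≤ ∑ K, coeffSq (locCoeff o c K) := sum_sq_le_sum_coeffSq o c
    _ ≤ ∑ K, 36 * (sqInt (locFun o c K) + (p : ℝ) ^ 4 * refSemi (locCoeff o c K)) :=
        Finset.sum_le_sum fun K _ => by
          have := coeffSq_le_h1 (locCoeff o c K)
          rwa [hp'] at this
    _ = 36 * (∑ K, sqInt (locFun o c K) + (p : ℝ) ^ 4 * ∑ K, refSemi (locCoeff o c K)) := by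
        rw [← Finset.mul_sum, Finset.sum_add_distrib, ← Finset.mul_sum]
    _ ≤ 36 * (4 * t * (T.size ^ 2)⁻¹ * l2Sq o c + (p : ℝ) ^ 4 * (4 * t * gradSq o c)) := by
        gcongr
        · exact sum_sqInt_le h h' hΓ
        · refine (sum_refSemi_le h).trans ?_
          gcongr
          linarith
    -- the missing cross terms of the product are nonnegative
    _ ≤ 36 * (4 * t * (T.size ^ 2)⁻¹ * l2Sq o c + (p : ℝ) ^ 4 * (4 * t * gradSq o c)) +
        144 * t * ((p : ℝ) ^ 4 * l2Sq o c + (T.size ^ 2)⁻¹ * gradSq o c) :=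
        le_add_of_nonneg_right (by positivity)
    _ = _ := by ring

end QuadMesh

end Estimates

end QuadBEM

end

open QuadBEM
theorem mainTheorem7 (Ω Γ : Set E3) (hΩ : IsLipschitzPolyhedron Ω) (hΓ : IsLipschitzPiece Ω Γ)
    (γ κ : ℝ) :
    ∃ c₀ c₁ C₀ C₁ : ℝ, 0 < c₀ ∧ 0 < c₁ ∧ 0 < C₀ ∧ 0 < C₁ ∧
      ∀ T : QuadMesh Γ, T.IsShapeRegular γ → T.IsQuasiUniform κ →
      ∀ (o : T.Orientation) (p : ℕ), 1 ≤ p →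
      ∀ u : E3 → ℝ, T.MemTildeQ Ω p u →
      ∀ c : T.Dof p → ℝ, QuadMesh.IsCoeffVector o u c →
        ENNReal.ofReal (c₀ * (T.size ^ 2)⁻¹) * l2NormSq Γ u ≤ ENNReal.ofReal (∑ δ, c δ ^ 2) ∧
        ENNReal.ofReal (∑ δ, c δ ^ 2) ≤
          ENNReal.ofReal (C₀ * (T.size ^ 2)⁻¹ * (p : ℝ) ^ 8) * l2NormSq Γ u ∧
        ENNReal.ofReal c₁ * h1NormSq Ω Γ u ≤ ENNReal.ofReal (∑ δ, c δ ^ 2) ∧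
        ENNReal.ofReal (∑ δ, c δ ^ 2) ≤
          ENNReal.ofReal (C₁ * ((p : ℝ) ^ 4 + (T.size ^ 2)⁻¹)) * h1NormSq Ω Γ u := by
  obtain ⟨M, hM1, hM⟩ := QuadMesh.exists_card_elem_le hΩ hΓ γ κ
  have hγ1 : 1 ≤ max γ 1 := le_max_right _ _
  have hκ1 : 1 ≤ max κ 1 := le_max_right _ _
  -- `D` bounds all mesh sizes, so that `c₁` need not depend on `h`
  set D := Metric.diam (frontier Ω)
  have hB : 0 < (9 * D ^ 2 + 24 * max γ 1) * (4 * M) := by positivity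
  refine ⟨(36 * M)⁻¹, ((9 * D ^ 2 + 24 * max γ 1) * (4 * M))⁻¹, 576 * (max κ 1 ^ 2 * max γ 1),
    144 * (max κ 1 ^ 2 * max γ 1), by positivity, by positivity, by positivity, by positivity, ?_⟩
  intro T h h' o p hp u _ c hc
  have hs := T.size_pos hΓ
  have hsD : T.size ^ 2 ≤ D ^ 2 := pow_le_pow_left₀ hs.le (T.size_le_diam hΩ hΓ) 2
  have hQ := QuadMesh.sum_coeffSq_le o c hM1 (hM T h h')
  have hQ0 : 0 ≤ ∑ K, coeffSq (QuadMesh.locCoeff o c K) :=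
    Finset.sum_nonneg fun _ _ => coeffSq_nonneg _
  have h1 := QuadMesh.l2Sq_le (o := o) (c := c)
  have h2 := QuadMesh.gradSq_le (o := o) (c := c) h
  rw [hc.l2NormSq_eq hΩ hΓ, hc.h1NormSq_eq hΩ hΓ, ← ENNReal.ofReal_mul (by positivity),
    ← ENNReal.ofReal_mul (by positivity), ← ENNReal.ofReal_mul (by positivity),
    ← ENNReal.ofReal_mul (by positivity)]
  refine ⟨ENNReal.ofReal_le_ofReal ?_, ENNReal.ofReal_le_ofReal (QuadMesh.sum_sq_le_l2Sq hp h h' hΓ),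
    ENNReal.ofReal_le_ofReal ?_, ENNReal.ofReal_le_ofReal (QuadMesh.sum_sq_le_h1 hp h h' hΓ)⟩
  · rw [← mul_inv, inv_mul_le_iff₀ (by positivity)]
    refine h1.trans ((mul_le_mul_of_nonneg_left hQ (by positivity)).trans (le_of_eq ?_))
    ring
  · rw [inv_mul_le_iff₀ hB]
    calc QuadMesh.l2Sq o c + QuadMesh.gradSq o c
        ≤ (9 * D ^ 2 + 24 * max γ 1) * ∑ K, coeffSq (QuadMesh.locCoeff o c K) := by
          nlinarith [mul_le_mul_of_nonneg_right hsD hQ0]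
      _ ≤ (9 * D ^ 2 + 24 * max γ 1) * (4 * M * ∑ δ, c δ ^ 2) := by gcongr
      _ = _ := by ring
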